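/- Write $X=(x,\xi)$ with $x\in[0,1]$, $\xi=(y,z)\in\mathbb R^2$, $v=(v_x,\underline v)\in\mathbb R^3$, $\underline v=(v_y,v_z)$, $\Theta=[0,1]\times\mathbb R^2\times\mathbb R^3$, and let $T>0$. Let $\mathbb S^2$ carry its surface measure $d\omega$. For the walls $x=0,1$ put $n(0)=-1$, $n(1)=1$; let $\mathcal S_\pm(x)=\{\omega\in\mathbb S^2:\pm n(x)\omega_x>0\}$ be the half-spheres of outgoing ($+$) and incoming ($-$) directions, equipped with the measure $|\omega_x|\,d\omega$. **Data.** Let $B\in C^1\cap W^{1,\infty}(\mathbb R^2)$, $C\in C^\infty(\mathbb R^2)$ with $C\ge 0$, and $f_I\in L^2(\Theta)$. Let $K=K(\xi,\varepsilon;\omega'\to\omega)$ be a measurable kernel such that for all $\xi\in\mathbb R^2$, $\varepsilon>0$ and $x\in\{0,1\}$: (i) $\int_{\mathcal S_-(x)}K(\omega'\to\omega)|\omega_x|\,d\omega=1$ for a.e. $\omega'\in\mathcal S_+(x)$; (ii) $K(\omega'\to\omega)=K(-\omega\to-\omega')$ for $\omega\in\mathcal S_-(x)$, $\omega'\in\mathcal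 S_+(x)$; (iii) $K(\omega'\to\omega)>0$ for a.e. $(\omega,\omega')\in\mathcal S_-(x)\times\mathcal S_+(x)$; (iv) $u\mapsto\int_{\mathcal S_+(x)}K(\omega'\to\cdot)u(\omega')|\omega'_x|\,d\omega'$ is a compact operator from $L^2(\mathcal S_+(x))$ to $L^2(\mathcal S_-(x))$. Let $\mathcal K g(v)=\int_{\mathcal S_+(x)}K(\xi,\tfrac{|v|^2}2;\omega'\to\tfrac v{|v|})\,g(|v|\omega')\,|\omega'_x|\,d\omega'$ be the associated boundary operator. **Kinetic problem.** For $\alpha>0$, a pair $(f^\alpha,\phi^\alpha)$ is a solution of the problem $$\alpha\,\partial_t f^\alpha+(\underline v\cdot\nabla_\xi+\underline E^\alpha\cdot\nabla_{\underline v})f^\alpha+\tfrac1\alpha\big(v_x\partial_x-(\underline v\times B)\cdot\nabla_{\underline v}\big)f^\alpha=0,\qquad \underline v\times B=(v_zB,-v_yB),$$ $$\underline E^\alpha=-\nabla_\xi\phi^\alpha,\qquad-\Delta_\xi\phi^\alpha=\int_0^1\!\!\int_{\mathbb R^3}f^\alpha\,dv\,dx-C,\qquad\lim_{|\xi|\to\infty}\phi^\alpha=0,$$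 $$\gamma^-(f^\alpha)=\mathcal K\gamma^+(f^\alpha),\qquad f^\alpha|_{t=0}=f_I,$$ if $f^\alpha\in L^\infty(0,T;L^2(\Theta))$; for a.e. $t$ the density $\int_0^1\int f^\alpha\,dv\,dx$ exists as a locally integrable function and the Poisson equation holds in the weak sense, with $\phi^\alpha(t,\xi)\to0$ as $|\xi|\to\infty$; and there is a trace $\gamma$ on the walls, square integrable for $|v_x|\,dt\,d\xi\,dv$ on $(0,T)\times\mathbb R^2\times\{|v|\le R\}$ for every $R>0$, which satisfies the reflection law a.e. at the incoming velocities and such that for all $C^1$ functions $\psi$ with compact support in $\{t<T\}$ $$\int_0^T\!\!\int_\Theta f^\alpha\Big(\alpha\partial_t\psi+\underline v\cdot\nabla_\xi\psi+\underline E^\alpha\cdot\nabla_{\underline v}\psi+\tfrac1\alpha\big(v_x\partial_x-(\underline v\times B)\cdot\nabla_{\underline v}\big)\psi\Big)+\alpha\int_\Theta f_I\,\psi|_{t=0}=\tfrac1\alpha\sum_{x=0,1}\int_0^T\!\!\int_{\mathbb R^2\times\mathbb R^3}n(x)\,v_x\,\gamma\,\psi\,d\xi\,dv\,dt .$$ **Claim.**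 Let $\alpha_n>0$, $\alpha_n\to0$, and let $(f^{\alpha_n},\phi^{\alpha_n})$ be solutions for $\alpha=\alpha_n$ such that, for a.e. $t\in(0,T)$, $\nabla_\xi\phi^{\alpha_n}(t,\cdot)$ exists everywhere, is bounded uniformly in $n$ and $t$, and is globally Lipschitz with a constant that does not depend on $t$. If $f^{\alpha_n}\to f^0$ in $L^\infty(0,T;L^2(\Theta))$ weak-*, then $f^0$ depends only on $(\xi,\tfrac12|v|^2,t)$: there is a measurable function $F$ with $$f^0(t,x,\xi,v)=F\big(\xi,\tfrac12|v|^2,t\big)\qquad\text{for a.e. }(t,x,\xi,v)\in(0,T)\times\Theta .$$ -/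

import Mathlib

open MeasureTheory Filter Topology Set
open scoped NNReal ENNReal

noncomputable section

namespace SHE

/-- The plane of the parallel position variable `ξ = (y, z)`. -/
abbrev E2 := EuclideanSpace ℝ (Fin 2)

/-- Velocity space; the indices `0, 1, 2` are the directions `x, y, z`. -/
abbrev E3 := EuclideanSpace ℝ (Fin 3)

/-- Phase space points `(x, ξ, v)`. -/
abbrev Phase := ℝ × E2 × E3

/-- `Θ = [0,1] × ℝ² × ℝ³`. -/
def Theta : Set Phase := Icc (0 : ℝ) 1 ×ˢ (univ : Set (E2 × E3))

/-! ### The unit sphere and its fluxes -/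

abbrev S2 := Metric.sphere (0 : E3) 1

/-- The (unnormalized) surface measure on the unit sphere: `dv = r² dr dω`. -/
def surf : Measure S2 := (volume : Measure E3).toSphere

/-- The abscissa of the wall number `i`: `x = 0` or `x = 1`. -/
def wall (i : Fin 2) : ℝ := if i = 0 then 0 else 1

/-- The `x`-component of the outward normal of the wall number `i`. -/
def normal (i : Fin 2) : ℝ := if i = 0 then -1 else 1

/-- Velocities (or directions) leaving the slab through the wall number `i`. -/
def outgoing (i : Fin 2) : Set E3 := {v | 0 < normal i * v 0}

/-- Velocities (or directions) entering the slab from the wall number `i`. -/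
def incoming (i : Fin 2) : Set E3 := {v | normal i * v 0 < 0}

/-- The measure `|ω_x| dω` on the half sphere of outgoing directions at wall `i`. -/
def fluxOut (i : Fin 2) : Measure S2 :=
  (surf.restrict {ω | (ω : E3) ∈ outgoing i}).withDensity
    (fun ω => ENNReal.ofReal |(ω : E3) 0|)

/-- The measure `|ω_x| dω` on the half sphere of incoming directions at wall `i`. -/
def fluxIn (i : Fin 2) : Measure S2 :=
  (surf.restrict {ω | (ω : E3) ∈ incoming i}).withDensity
    (fun ω => ENNReal.ofReal |(ω : E3) 0|)

/-! ### The reflection law -/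

/-- Assumptions on the reflection kernel `K ξ ε ω' ω`, the density of the deflection
`ω' → ω` for particles hitting a wall at `ξ` with energy `ε`. The two walls are
distinguished by the sign of `ω'_x`. -/
structure IsReflectionKernel (K : E2 → ℝ → E3 → E3 → ℝ) : Prop where
  measurable : Measurable
    (fun q : E2 × ℝ × S2 × S2 => K q.1 q.2.1 (q.2.2.1 : E3) (q.2.2.2 : E3))
  flux_conservation : ∀ (ξ : E2) (ε : ℝ), 0 < ε → ∀ i : Fin 2,
    ∀ᵐ ω' : S2 ∂(fluxOut i), (∫ ω : S2, K ξ ε (ω' : E3) (ω : E3) ∂(fluxIn i)) = 1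
  reciprocity : ∀ (ξ : E2) (ε : ℝ), 0 < ε → ∀ (i : Fin 2) (ω ω' : S2),
    (ω : E3) ∈ incoming i → (ω' : E3) ∈ outgoing i →
      K ξ ε (ω' : E3) (ω : E3) = K ξ ε (-(ω : E3)) (-(ω' : E3))
  positivity : ∀ (ξ : E2) (ε : ℝ), 0 < ε → ∀ i : Fin 2,
    ∀ᵐ q : S2 × S2 ∂((fluxOut i).prod (fluxIn i)), 0 < K ξ ε (q.1 : E3) (q.2 : E3)
  compact : ∀ (ξ : E2) (ε : ℝ), 0 < ε → ∀ i : Fin 2,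
    ∃ A : Lp ℝ 2 (fluxOut i) →L[ℝ] Lp ℝ 2 (fluxIn i), IsCompactOperator A ∧
      ∀ u : Lp ℝ 2 (fluxOut i), ∀ᵐ ω : S2 ∂(fluxIn i),
        A u ω = ∫ ω' : S2, K ξ ε (ω' : E3) (ω : E3) * u ω' ∂(fluxOut i)

/-- The boundary operator: `(𝒦 g)(v) = ∫ K(ξ, |v|²/2; ω' → v/|v|) g(|v| ω') |ω'_x| dω'`,
the integral being over the outgoing directions at wall `i`. -/
def reflect (K : E2 → ℝ → E3 → E3 → ℝ) (i : Fin 2) (ξ : E2) (g : E3 → ℝ) (v : E3) : ℝ :=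
  ∫ ω' : S2, K ξ (‖v‖ ^ 2 / 2) (ω' : E3) (‖v‖⁻¹ • v) * g (‖v‖ • (ω' : E3)) ∂(fluxOut i)

/-! ### The transport operator -/

/-- The components of a velocity parallel to the walls. -/
def par (v : E3) : E2 := !₂[v 1, v 2]

/-- A vector parallel to the walls, as a vector of the full velocity space. -/
def lift (w : E2) : E3 := !₂[0, w 0, w 1]

/-- `v × B = (0, v_z B, - v_y B)` for the magnetic field `(B, 0, 0)`. -/
def crossB (v : E3) (b : ℝ) : E3 := !₂[0, v 2 * b, -(v 1 * b)]

/-- The vector field, in the variables `(t, x, ξ, v)`, of the differential operator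
`α ∂_t + v·∇_ξ + E·∇_v + α⁻¹ (v_x ∂_x - (v × B)·∇_v)`, with `E = -∇φ`. -/
def transportField (α : ℝ) (B : E2 → ℝ) (φ : ℝ → E2 → ℝ) (p : ℝ × Phase) : ℝ × Phase :=
  (α, α⁻¹ * p.2.2.2 0, par p.2.2.2,
    lift (-(gradient (φ p.1) p.2.2.1)) - α⁻¹ • crossB p.2.2.2 (B p.2.2.1))

/-! ### Function spaces -/

/-- `f ∈ L^∞(0, T; L²(Θ))`. -/
def MemLinftyL2 (T : ℝ) (f : ℝ × Phase → ℝ) : Prop :=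
  AEStronglyMeasurable f (volume.restrict (Ioo 0 T ×ˢ Theta)) ∧
    ∃ M : ℝ≥0, ∀ᵐ t ∂(volume.restrict (Ioo 0 T)),
      eLpNorm (fun p => f (t, p)) 2 (volume.restrict Theta) ≤ M

/-- `g ∈ L¹(0, T; L²(Θ))`. -/
def MemL1L2 (T : ℝ) (g : ℝ × Phase → ℝ) : Prop :=
  AEStronglyMeasurable g (volume.restrict (Ioo 0 T ×ˢ Theta)) ∧
    ∫⁻ t in Ioo 0 T, eLpNorm (fun p => g (t, p)) 2 (volume.restrict Theta) < ∞

/-- Weak-* convergence in `L^∞(0, T; L²(Θ))`, the dual of `L¹(0, T; L²(Θ))`. -/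
def WeakStarTendsto (T : ℝ) (f : ℕ → ℝ × Phase → ℝ) (f₀ : ℝ × Phase → ℝ) : Prop :=
  ∀ g : ℝ × Phase → ℝ, MemL1L2 T g →
    Tendsto (fun n => ∫ p in Ioo 0 T ×ˢ Theta, f n p * g p) atTop
      (𝓝 (∫ p in Ioo 0 T ×ˢ Theta, f₀ p * g p))

/-- The measure `|v_x| dt dξ dv` on `(0, T) × ℝ² × {|v| ≤ R}`, for traces on one wall. -/
def wallMeasure (T R : ℝ) : Measure (ℝ × E2 × E3) :=
  (volume.restrict (Ioo 0 T ×ˢ ((univ : Set E2) ×ˢ Metric.closedBall (0 : E3) R))).withDensity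
    (fun q => ENNReal.ofReal |q.2.2 0|)

/-! ### The kinetic problem -/

/-- The magnetic field is in `C¹ ∩ W^{1,∞}`. -/
def IsMagneticField (B : E2 → ℝ) : Prop :=
  ContDiff ℝ 1 B ∧ ∃ b : ℝ, ∀ ξ, |B ξ| ≤ b ∧ ‖fderiv ℝ B ξ‖ ≤ b

/-- `∇φ(t, ·)` is bounded by `M` and globally Lipschitz with constant `L`, for a.e. time. -/
def IsRegularPotential (T : ℝ) (M L : ℝ≥0) (φ : ℝ → E2 → ℝ) : Prop :=
  Measurable (fun q : ℝ × E2 => φ q.1 q.2) ∧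
    ∀ᵐ t ∂(volume.restrict (Ioo 0 T)),
      Differentiable ℝ (φ t) ∧ (∀ ξ, ‖gradient (φ t) ξ‖ ≤ M) ∧ LipschitzWith L (gradient (φ t))

/-- `f` is a weak solution, with trace `γ` on the walls and initial value `f_I`, of
`α ∂_t f + (v·∇_ξ + E·∇_v) f + α⁻¹ (v_x ∂_x - (v × B)·∇_v) f = 0`, `E = -∇φ`,
subject to the reflection law `γ⁻ = 𝒦 γ⁺`. -/
structure IsVlasovSolution (T α : ℝ) (B : E2 → ℝ) (K : E2 → ℝ → E3 → E3 → ℝ)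
    (fI : Phase → ℝ) (φ : ℝ → E2 → ℝ) (f : ℝ × Phase → ℝ)
    (γ : Fin 2 → ℝ × E2 × E3 → ℝ) : Prop where
  mem : MemLinftyL2 T f
  trace_mem : ∀ (i : Fin 2) (R : ℝ), MemLp (γ i) 2 (wallMeasure T R)
  reflection : ∀ i : Fin 2,
    ∀ᵐ q ∂(volume.restrict (Ioo 0 T ×ˢ ((univ : Set E2) ×ˢ incoming i))),
      γ i q = reflect K i q.2.1 (fun v' => γ i (q.1, q.2.1, v')) q.2.2
  green : ∀ ψ : ℝ × Phase → ℝ, ContDiff ℝ 1 ψ → HasCompactSupport ψ →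
    tsupport ψ ⊆ {p | p.1 < T} →
      (∫ p in Ioo 0 T ×ˢ Theta, f p * fderiv ℝ ψ p (transportField α B φ p))
        + α * ∫ p in Theta, fI p * ψ (0, p)
      = α⁻¹ * ∑ i : Fin 2, ∫ q in Ioo 0 T ×ˢ (univ : Set (E2 × E3)),
          normal i * q.2.2 0 * γ i q * ψ (q.1, wall i, q.2.1, q.2.2)

/-- `-Δφ = ∫∫ f dx dv - C` in the weak sense and `φ → 0` at infinity, for a.e. time. -/
structure IsPoissonSolution (T : ℝ) (C : E2 → ℝ) (f : ℝ × Phase → ℝ) (φ : ℝ → E2 → ℝ) :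
    Prop where
  density : ∀ᵐ t ∂(volume.restrict (Ioo 0 T)), ∀ k : Set E2, IsCompact k →
    IntegrableOn (fun p => f (t, p)) (Icc (0 : ℝ) 1 ×ˢ (k ×ˢ (univ : Set E3)))
  poisson : ∀ᵐ t ∂(volume.restrict (Ioo 0 T)), ∀ χ : E2 → ℝ,
    ContDiff ℝ (⊤ : ℕ∞) χ → HasCompactSupport χ →
      (∫ ξ, inner ℝ (gradient (φ t) ξ) (gradient χ ξ))
        = ∫ ξ, ((∫ x in Icc (0 : ℝ) 1, ∫ v : E3, f (t, x, ξ, v)) - C ξ) * χ ξ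
  decay : ∀ᵐ t ∂(volume.restrict (Ioo 0 T)), Tendsto (φ t) (cocompact E2) (𝓝 0)

/-- `(f, φ)` solves the rescaled Vlasov-Poisson initial boundary value problem. -/
def IsKineticSolution (T α : ℝ) (B : E2 → ℝ) (K : E2 → ℝ → E3 → E3 → ℝ) (C : E2 → ℝ)
    (fI : Phase → ℝ) (f : ℝ × Phase → ℝ) (φ : ℝ → E2 → ℝ) : Prop :=
  (∃ γ : Fin 2 → ℝ × E2 × E3 → ℝ, IsVlasovSolution T α B K fI φ f γ) ∧
    IsPoissonSolution T C f φ

end SHE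

end

/-!
Formally, the singular part of the equation forces `(v_x ∂_x - (v × B)·∇_v) f⁰ = 0` in the limit, so
that `f⁰` is determined by its traces, and the balance of energy in the slab forces the reflections
at the walls to become conservative. By positivity of the reflection kernel a conservative
reflection leaves only functions of `|v|`, and these are invariant under the rotations of `v` which
the magnetic field generates.

The energy balance has to be proved for weak solutions. A solution is extended beyond the walls by
its traces, constant in `x`; the extension solves a transport equation in the whole space whose
field is the original one in the slab and has only an `x`-component outside of it. This field is
discontinuous at the walls, but there is a renormalization theorem for it
(`integral_mul_eq_zero_of_weak_transport`), with a mollification that is anisotropic: first the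
variables `(x, v_x)`, in which the field is linear, then `t`, and finally `(ξ, v_y, v_z)`, in which
the field is Lipschitz. The commutators are those of DiPerna and Lions (`tendsto_commutator`). The
result is `energy_identity`, which relates `∫ f²` against the derivative of a weight `η²` to the
traces; near `v_x = 0` the weight has to vanish, since the traces are square integrable only with
the factor `|v_x|`.

The solutions are bounded in `L²` by the uniform boundedness principle. Weights that are cutoffs in
`(t, ξ, |v|)` give two estimates: the energy fluxes through both walls add up to `O(α)`
(`abs_sum_flux_le`), and `v_x γ` is bounded in `L²` locally (`sum_integral_sq_vx_trace_le`). At each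
wall the flux of energy out of the slab is, by conservation of flux and reciprocity, the integral of
`K(ω' → ω) (γ(|v|ω') - γ(|v|ω))²` (`IsReflected.dissipation_eq`), hence nonnegative, so both fluxes
tend to zero. As a consequence every weak limit of the traces is a function of `(t, ξ, |v|)`
(`ae_jump_eq_zero_of_tendsto`, `exists_radial_of_weak_limit`).

Finally the weak formulation is tested with `charTest`, the integral of a test function `ζ` along
the characteristics from a given point to the wall `x = 1`. It leaves `∫ f⁰ ζ` on one side and an
integral over the wall `x = 0` on the other, where the trace can be replaced by its radial limit.
Rotations preserve the Lebesgue measure and the limit, so that `f⁰` is equal to it almost everywhere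
in bounded regions that stay away from `t = 0`, `t = T` and `v_x = 0`
(`exists_radial_on_region`), and the functions obtained in these regions are glued.
-/

set_option linter.unusedSectionVars false

namespace SHE

/-! ### Correlations of square integrable functions -/

section Correlation

variable {Y : Type*} [NormedAddCommGroup Y] [NormedSpace ℝ Y] [FiniteDimensional ℝ Y]
  [MeasurableSpace Y] [BorelSpace Y] (μ : Measure Y) [μ.IsAddHaarMeasure]

/-- The correlation `z ↦ ∫ u(p) g(p - z) dp` of two functions. -/
noncomputable def corr (u g : Y → ℝ) (z : Y) : ℝ := ∫ p, u p * g (p - z) ∂μ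

variable {μ} {u g : Y → ℝ}

lemma MemLp_comp_sub (hg : MemLp g 2 μ) (z : Y) : MemLp (fun p => g (p - z)) 2 μ :=
  hg.comp_measurePreserving (measurePreserving_sub_right μ z)

lemma integrable_mul_comp_sub (hu : MemLp u 2 μ) (hg : MemLp g 2 μ) (z : Y) :
    Integrable (fun p => u p * g (p - z)) μ :=
  hu.integrable_mul (MemLp_comp_sub hg z)

lemma corr_continuous (hu : MemLp u 2 μ) (hg : MemLp g 2 μ) : Continuous (corr μ u g) := by
  have h : ∀ z, corr μ u g z
      = inner ℝ (DomAddAct.mk (-z) +ᵥ (hg.toLp g : Lp ℝ 2 μ)) (hu.toLp u : Lp ℝ 2 μ) := by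
    intro z
    rw [DomAddAct.mk_vadd_toLp, L2.inner_def]
    refine integral_congr_ae ?_
    have h2 : MemLp (fun x => g (-z +ᵥ x)) 2 μ := by
      simpa [vadd_eq_add, sub_eq_neg_add] using MemLp_comp_sub hg z
    filter_upwards [hu.coeFn_toLp, h2.coeFn_toLp] with p hp hp2
    rw [hp, hp2]
    simp [sub_eq_neg_add]
  have : corr μ u g = _ := funext h
  rw [this]
  have hc : Continuous fun z : Y => (DomAddAct.mk (-z) +ᵥ (hg.toLp g : Lp ℝ 2 μ)) := by
    have : Fact ((2 : ℝ≥0∞) ≠ ∞) := ⟨by norm_num⟩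
    exact (DomAddAct.continuous_mk.comp continuous_neg).vadd continuous_const
  exact hc.inner continuous_const

lemma corr_neg (z : Y) : corr μ u g (-z) = corr μ g u z := by
  unfold corr
  rw [← integral_sub_right_eq_self _ z]
  refine integral_congr_ae (Eventually.of_forall fun p => ?_)
  simp [mul_comm]

lemma aestronglyMeasurable_mul_comp_sub (hu : AEStronglyMeasurable u μ)
    (hg : AEStronglyMeasurable g μ) :
    AEStronglyMeasurable (fun q : Y × Y => u q.1 * g (q.1 - q.2)) (μ.prod μ) :=
  hu.comp_fst.mul (hg.comp_quasiMeasurePreserving (quasiMeasurePreserving_sub μ μ))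

/-- Integrating against a convolution is integrating the correlation. -/
lemma integral_mul_integral_mul_sub (hu : MemLp u 2 μ) (hg : MemLp g 2 μ) {k : Y → ℝ}
    (hk : Continuous k) (hkc : HasCompactSupport k) :
    ∫ p, u p * ∫ z, g (p - z) * k z ∂μ ∂μ = ∫ z, k z * corr μ u g z ∂μ := by
  have hm : AEStronglyMeasurable (fun q : Y × Y => u q.1 * (g (q.1 - q.2) * k q.2))
      (μ.prod μ) := by
    have := (aestronglyMeasurable_mul_comp_sub hu.1 hg.1).mul
      (hk.aestronglyMeasurable (μ := μ)).comp_snd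
    refine this.congr (Eventually.of_forall fun q => ?_)
    simp [mul_assoc]
  have hint : Integrable (fun q : Y × Y => u q.1 * (g (q.1 - q.2) * k q.2)) (μ.prod μ) := by
    rw [integrable_prod_iff' hm]
    constructor
    · refine Eventually.of_forall fun z => ?_
      simpa [mul_assoc] using (integrable_mul_comp_sub hu hg z).mul_const (k z)
    · have h : (fun z => ∫ p, ‖u p * (g (p - z) * k z)‖ ∂μ)
          = fun z => |k z| * corr μ (fun p => |u p|) (fun p => |g p|) z := by
        funext z
        unfold corr
        rw [← integral_const_mul]
        refine integral_congr_ae (Eventually.of_forall fun p => ?_)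
        simp only [Real.norm_eq_abs, abs_mul]
        ring
      rw [h]
      exact (hk.abs.mul (corr_continuous hu.abs hg.abs)).integrable_of_hasCompactSupport
        (hkc.abs.mul_right)
  calc ∫ p, u p * ∫ z, g (p - z) * k z ∂μ ∂μ
      = ∫ p, ∫ z, u p * (g (p - z) * k z) ∂μ ∂μ := by simp_rw [integral_const_mul]
    _ = ∫ z, ∫ p, u p * (g (p - z) * k z) ∂μ ∂μ := integral_integral_swap hint
    _ = ∫ z, k z * corr μ u g z ∂μ := by
        refine integral_congr_ae (Eventually.of_forall fun z => ?_)
        simp only [corr]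
        rw [← integral_const_mul]
        refine integral_congr_ae (Eventually.of_forall fun p => ?_)
        ring

/-- The mollification `p ↦ ∫ g(p - z) σ(z) dz`. -/
lemma exists_mollification (hg : MemLp g 2 μ) (hgc : HasCompactSupport g) {σ : Y → ℝ}
    (hσ : ContDiff ℝ 1 σ) (hσc : HasCompactSupport σ) :
    ∃ ψ : Y → ℝ, ContDiff ℝ 1 ψ ∧ HasCompactSupport ψ ∧ (∀ p, ψ p = ∫ z, g (p - z) * σ z ∂μ) ∧
      ∀ p e, fderiv ℝ ψ p e = ∫ z, g (p - z) * fderiv ℝ σ z e ∂μ := by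
  have hloc : LocallyIntegrable g μ := hg.locallyIntegrable (by norm_num)
  let Lm := ContinuousLinearMap.mul ℝ ℝ
  refine ⟨convolution g σ Lm μ, ?_, hgc.convolution Lm hσc, ?_, ?_⟩
  · exact_mod_cast hσc.contDiff_convolution_right (n := 1) Lm hloc (by exact_mod_cast hσ)
  · intro p
    rw [convolution_eq_swap]
    rfl
  · intro p e
    rw [(hσc.hasFDerivAt_convolution_right Lm hloc hσ p).fderiv, convolution_eq_swap]
    have hi : Integrable (fun t => (ContinuousLinearMap.precompR Y Lm) (g (p - t))
        (fderiv ℝ σ t)) μ := by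
      have := (hσc.fderiv (𝕜 := ℝ)).convolutionExists_right
        (ContinuousLinearMap.precompR Y Lm) hloc (hσ.continuous_fderiv (by norm_num)) p
      have h2 := this.integrable_swap
      exact h2
    rw [ContinuousLinearMap.integral_apply hi]
    rfl

/-- The Cauchy-Schwarz inequality, with the norms written as integrals. -/
lemma abs_integral_mul_le_sqrt {Z : Type*} [MeasurableSpace Z] {ν : Measure Z} {u v : Z → ℝ}
    (hu : MemLp u 2 ν) (hv : MemLp v 2 ν) :
    |∫ p, u p * v p ∂ν| ≤ Real.sqrt (∫ p, u p ^ 2 ∂ν) * Real.sqrt (∫ p, v p ^ 2 ∂ν) := by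
  have hin : ∀ {u v : Z → ℝ} (hu : MemLp u 2 ν) (hv : MemLp v 2 ν),
      inner ℝ (hu.toLp u) (hv.toLp v) = ∫ p, u p * v p ∂ν := by
    intro u v hu hv
    rw [L2.inner_def]
    refine integral_congr_ae ?_
    filter_upwards [hu.coeFn_toLp, hv.coeFn_toLp] with p h1 h2
    rw [h1, h2]
    simp [mul_comm]
  have hnorm : ∀ {u : Z → ℝ} (hu : MemLp u 2 ν), ‖hu.toLp u‖ = Real.sqrt (∫ p, u p ^ 2 ∂ν) := by
    intro u hu
    rw [← Real.sqrt_sq (norm_nonneg _), ← real_inner_self_eq_norm_sq, hin hu hu]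
    simp_rw [sq]
  rw [← hin hu hv, ← hnorm hu, ← hnorm hv]
  exact abs_real_inner_le_norm _ _

end Correlation

/-! ### Weak equations tested with mollifications -/

section Renormalization

variable {Y : Type*} [NormedAddCommGroup Y] [NormedSpace ℝ Y] [FiniteDimensional ℝ Y]
  [MeasurableSpace Y] [BorelSpace Y] {μ : Measure Y} [μ.IsAddHaarMeasure]

/-- The weak equation `∫ g Σ_j c_j ∂_{e_j} ψ = -∫ h ψ`, tested with mollifications of `g`. -/
lemma sum_integral_fderiv_mul_corr {ι : Type*} [Fintype ι] {g h : Y → ℝ} {c : ι → Y → ℝ}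
    {e : ι → Y} (hg : MemLp g 2 μ) (hgc : HasCompactSupport g) (hh : MemLp h 2 μ)
    (hc : ∀ j, MemLp (fun p => g p * c j p) 2 μ)
    (weak : ∀ ψ : Y → ℝ, ContDiff ℝ 1 ψ → HasCompactSupport ψ →
      ∫ p, g p * ∑ j, c j p * fderiv ℝ ψ p (e j) ∂μ = -∫ p, h p * ψ p ∂μ)
    {σ : Y → ℝ} (hσ : ContDiff ℝ 1 σ) (hσc : HasCompactSupport σ) :
    ∑ j, ∫ z, fderiv ℝ σ z (e j) * corr μ (fun p => g p * c j p) g z ∂μ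
      = -∫ z, σ z * corr μ h g z ∂μ := by
  obtain ⟨ψ, hψ, hψc, h0, h1⟩ := exists_mollification hg hgc hσ hσc
  have hk : ∀ j, Continuous fun z => fderiv ℝ σ z (e j) := fun j =>
    (hσ.continuous_fderiv (by norm_num)).clm_apply continuous_const
  have hkc : ∀ j, HasCompactSupport fun z => fderiv ℝ σ z (e j) := fun j =>
    hσc.fderiv_apply (𝕜 := ℝ) (e j)
  rw [← integral_mul_integral_mul_sub hh hg hσ.continuous hσc]
  simp_rw [← h0]
  rw [← weak ψ hψ hψc]
  simp_rw [← fun j => integral_mul_integral_mul_sub (hc j) hg (hk j) (hkc j), ← h1,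
    Finset.mul_sum]
  rw [integral_finsetSum]
  · simp_rw [mul_assoc]
  · intro j _
    have hb : MemLp (fun p => fderiv ℝ ψ p (e j)) 2 μ :=
      ((hψ.continuous_fderiv (by norm_num)).clm_apply continuous_const).memLp_of_hasCompactSupport
        (hψc.fderiv_apply (𝕜 := ℝ) (e j))
    have := (hc j).integrable_mul hb
    simpa [mul_assoc, Pi.mul_def] using this

/-- A linear change of variables in the identity of `sum_integral_fderiv_mul_corr`. -/
lemma sum_integral_fderiv_mul_corr_comp {ι : Type*} [Fintype ι] {u : ι → Y → ℝ} {g h : Y → ℝ}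
    {e : ι → Y}
    (key : ∀ σ : Y → ℝ, ContDiff ℝ 1 σ → HasCompactSupport σ →
      ∑ j, ∫ z, fderiv ℝ σ z (e j) * corr μ (u j) g z ∂μ = -∫ z, σ z * corr μ h g z ∂μ)
    (A : Y ≃L[ℝ] Y) {lam : ι → ℝ} (hA : ∀ j, A.symm (e j) = lam j • e j)
    {σ : Y → ℝ} (hσ : ContDiff ℝ 1 σ) (hσc : HasCompactSupport σ) :
    ∑ j, lam j * ∫ z, fderiv ℝ σ z (e j) * corr μ (u j) g (A z) ∂μ
      = -∫ z, σ z * corr μ h g (A z) ∂μ := by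
  have hσA : ContDiff ℝ 1 (fun z => σ (A.symm z)) := hσ.comp A.symm.contDiff
  have hσAc : HasCompactSupport (fun z => σ (A.symm z)) :=
    hσc.comp_homeomorph A.symm.toHomeomorph
  have hkey := key _ hσA hσAc
  have hdet : LinearMap.det (A.symm : Y →ₗ[ℝ] Y) ≠ 0 :=
    (LinearEquiv.isUnit_det' A.symm.toLinearEquiv).ne_zero
  have hmap := Measure.map_linearMap_addHaar_eq_smul_addHaar μ hdet
  set d : ℝ≥0∞ := ENNReal.ofReal |(LinearMap.det (A.symm : Y →ₗ[ℝ] Y))⁻¹| with hd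
  have hd0 : d.toReal ≠ 0 := by
    rw [hd, ENNReal.toReal_ofReal (abs_nonneg _)]
    exact abs_ne_zero.mpr (inv_ne_zero hdet)
  have hint : ∀ G : Y → ℝ, ∫ z, G (A.symm z) ∂μ = d.toReal * ∫ z, G z ∂μ := by
    intro G
    have h1 : ∫ z, G (A.symm z) ∂μ = ∫ z, G z ∂(Measure.map A.symm μ) :=
      (A.symm.toHomeomorph.measurableEmbedding.integral_map G).symm
    have h2 : Measure.map A.symm μ = d • μ := hmap
    rw [h1, h2, integral_smul_measure, smul_eq_mul]
  have hl : ∀ j, ∫ z, fderiv ℝ (fun z => σ (A.symm z)) z (e j) * corr μ (u j) g z ∂μ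
      = d.toReal * (lam j * ∫ z, fderiv ℝ σ z (e j) * corr μ (u j) g (A z) ∂μ) := by
    intro j
    rw [← integral_const_mul, ← hint]
    refine integral_congr_ae (Eventually.of_forall fun z => ?_)
    have hf : fderiv ℝ (fun z => σ (A.symm z)) z (e j) = lam j * fderiv ℝ σ (A.symm z) (e j) := by
      have h3 : HasFDerivAt (fun z => σ (A.symm z))
          ((fderiv ℝ σ (A.symm z)).comp (A.symm : Y →L[ℝ] Y)) z :=
        ((hσ.differentiable (by norm_num)) (A.symm z)).hasFDerivAt.comp z A.symm.hasFDerivAt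
      rw [h3.fderiv]
      simp [hA]
    simp only [hf, ContinuousLinearEquiv.apply_symm_apply]
    ring
  have hr : ∫ z, σ (A.symm z) * corr μ h g z ∂μ
      = d.toReal * ∫ z, σ z * corr μ h g (A z) ∂μ := by
    rw [← hint]
    simp
  rw [Finset.sum_congr rfl fun j _ => hl j, hr, ← Finset.mul_sum, ← mul_neg] at hkey
  exact mul_left_cancel₀ hd0 hkey

/-- Pairings with a continuous function that depends continuously on a parameter. -/
lemma continuous_integral_mul_of_hasCompactSupport {k : Y → ℝ} (hk : Continuous k)
    (hkc : HasCompactSupport k) {G : ℝ × ℝ × ℝ → Y → ℝ} (hG : Continuous (Function.uncurry G)) :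
    Continuous fun s => ∫ z, k z * G s z ∂μ := by
  have h : ∀ s, ∫ z, k z * G s z ∂μ = ∫ z in tsupport k, k z * G s z ∂μ := by
    intro s
    refine (setIntegral_eq_integral_of_forall_compl_eq_zero fun z hz => ?_).symm
    rw [image_eq_zero_of_notMem_tsupport hz, zero_mul]
  simp_rw [h]
  exact continuous_parametric_integral_of_continuous
    ((hk.comp continuous_snd).mul hG) hkc

/-- The integral of a derivative against a function that is constant along that direction. -/
lemma integral_fderiv_mul_eq_zero {σ : Y → ℝ} (hσ : ContDiff ℝ 1 σ) (hσc : HasCompactSupport σ)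
    {v : Y} {w : Y → ℝ} (hw : LocallyIntegrable w μ) (hinv : ∀ z (s : ℝ), w (z + s • v) = w z) :
    ∫ z, fderiv ℝ σ z v * w z ∂μ = 0 := by
  have hk : Continuous fun z => fderiv ℝ σ z v :=
    (hσ.continuous_fderiv (by norm_num)).clm_apply continuous_const
  have h := integral_bilinear_hasLineDerivAt_right_eq_neg_left_of_integrable (μ := μ)
    (B := ContinuousLinearMap.mul ℝ ℝ) (f := w) (f' := fun _ => 0) (g := σ)
    (g' := fun z => fderiv ℝ σ z v) (v := v) (by simp)
    (by simpa [mul_comm] using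
          hw.integrable_smul_left_of_hasCompactSupport hk (hσc.fderiv_apply (𝕜 := ℝ) v))
    (by simpa [mul_comm] using
          hw.integrable_smul_left_of_hasCompactSupport hσ.continuous hσc)
    (fun x _ => by
      have : (fun t : ℝ => w (x + t • v)) = fun _ => w x := funext fun t => hinv x t
      simp only [HasLineDerivAt, this]
      exact hasDerivAt_const _ _)
    (fun x _ => ((hσ.differentiable (by norm_num)) x).hasFDerivAt.hasLineDerivAt v)
  simpa [mul_comm] using h

end Renormalization

/-! ### The commutator estimate -/

section Renormalization

variable {Y : Type*} [NormedAddCommGroup Y] [NormedSpace ℝ Y] [FiniteDimensional ℝ Y]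
  [MeasurableSpace Y] [BorelSpace Y] {μ : Measure Y} [μ.IsAddHaarMeasure]

/-- The derivative of an even function is odd, so only the antisymmetric part of the correlation
counts; it is a correlation weighted with increments of the coefficient. -/
lemma integral_fderiv_mul_corr_eq_half {g c : Y → ℝ} (hg : MemLp g 2 μ)
    (hc : MemLp (fun p => g p * c p) 2 μ) {σ : Y → ℝ} (hσ : ContDiff ℝ 1 σ)
    (hσc : HasCompactSupport σ) (heven : ∀ z, σ (-z) = σ z) (A : Y →L[ℝ] Y) (e : Y) :
    ∫ z, fderiv ℝ σ z e * corr μ (fun p => g p * c p) g (A z) ∂μ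
      = 2⁻¹ * ∫ z, fderiv ℝ σ z e * ∫ p, g p * g (p - A z) * (c p - c (p - A z)) ∂μ ∂μ := by
  have hodd : ∀ z, fderiv ℝ σ (-z) e = -fderiv ℝ σ z e := by
    intro z
    have h1 : (fun y => σ (-y)) = σ := funext heven
    have h2 : HasFDerivAt (fun y => σ (-y)) ((fderiv ℝ σ (-z)).comp (-ContinuousLinearMap.id ℝ Y))
        z := ((hσ.differentiable (by norm_num)) (-z)).hasFDerivAt.comp z (hasFDerivAt_id z).neg
    rw [h1] at h2
    rw [h2.fderiv]
    simp
  have hk : Continuous fun z => fderiv ℝ σ z e :=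
    (hσ.continuous_fderiv (by norm_num)).clm_apply continuous_const
  have hkc : HasCompactSupport fun z => fderiv ℝ σ z e := hσc.fderiv_apply (𝕜 := ℝ) e
  have hi1 : Integrable (fun z => fderiv ℝ σ z e * corr μ (fun p => g p * c p) g (A z)) μ :=
    (hk.mul ((corr_continuous hc hg).comp A.continuous)).integrable_of_hasCompactSupport
      hkc.mul_right
  have hi2 : Integrable (fun z => fderiv ℝ σ z e * corr μ g (fun p => g p * c p) (A z)) μ :=
    (hk.mul ((corr_continuous hg hc).comp A.continuous)).integrable_of_hasCompactSupport
      hkc.mul_right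
  have hneg : ∫ z, fderiv ℝ σ z e * corr μ (fun p => g p * c p) g (A z) ∂μ
      = -∫ z, fderiv ℝ σ z e * corr μ g (fun p => g p * c p) (A z) ∂μ := by
    rw [← integral_neg_eq_self, ← integral_neg]
    refine integral_congr_ae (Eventually.of_forall fun z => ?_)
    simp only [hodd, map_neg, corr_neg]
    ring
  have hdiff : ∀ z, ∫ p, g p * g (p - A z) * (c p - c (p - A z)) ∂μ
      = corr μ (fun p => g p * c p) g (A z) - corr μ g (fun p => g p * c p) (A z) := by
    intro z
    unfold corr
    rw [← integral_sub (integrable_mul_comp_sub hc hg _) (integrable_mul_comp_sub hg hc _)]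
    refine integral_congr_ae (Eventually.of_forall fun p => ?_)
    ring
  simp_rw [hdiff, mul_sub]
  rw [integral_sub hi1 hi2]
  linarith

/-- The commutator estimate of DiPerna and Lions: for a coefficient that is Lipschitz along the
range of `P` on the support of `g` and independent of the direction `e` in which it
differentiates, the commutator with mollification at scale `ε` tends to zero. -/
lemma tendsto_commutator {g c : Y → ℝ} {L : ℝ} {e : Y} {P : Y →L[ℝ] Y} (hP : P e = e)
    (hg : MemLp g 2 μ) (hcm : Measurable c) (hc : MemLp (fun p => g p * c p) 2 μ)
    (hinv : ∀ p (s : ℝ), c (p + s • e) = c p)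
    (hlip : ∀ p z, g p ≠ 0 → |c p - c (p - P z)| ≤ L * ‖P z‖)
    {σ : Y → ℝ} (hσ : ContDiff ℝ 1 σ) (hσc : HasCompactSupport σ)
    (heven : ∀ z, σ (-z) = σ z) :
    Tendsto (fun ε : ℝ => ε⁻¹ * ∫ z, fderiv ℝ σ z e
      * corr μ (fun p => g p * c p) g (ε • P z) ∂μ) (𝓝[>] 0) (𝓝 0) := by
  have hk : Continuous fun z => fderiv ℝ σ z e :=
    (hσ.continuous_fderiv (by norm_num)).clm_apply continuous_const
  have hkc : HasCompactSupport fun z => fderiv ℝ σ z e := hσc.fderiv_apply (𝕜 := ℝ) e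
  have hL0 : ∀ z p, g p ≠ 0 → 0 ≤ L * ‖P z‖ := fun z p hp => (abs_nonneg _).trans (hlip p z hp)
  have hsq : Integrable (fun p => g p ^ 2) μ := hg.integrable_sq
  have hl : ∀ (ε : ℝ), 0 < ε → ∀ p z, g p ≠ 0 → |c p - c (p - ε • P z)| ≤ ε * (L * ‖P z‖) := by
    intro ε hε p z hp
    have := hlip p (ε • z) hp
    rw [map_smul, norm_smul, Real.norm_eq_abs, abs_of_pos hε] at this
    linarith
  have hcorr := corr_continuous hg hg
  -- the square distance of `g` from its translate, as a continuous function of the shift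
  set N : Y → ℝ := fun y => 2 * (corr μ g g 0 - corr μ g g y) with hN
  have hNdist : ∀ y, ∫ p, (g (p - y) - g p) ^ 2 ∂μ = N y := by
    intro y
    have i1 : Integrable (fun p => g (p - y) ^ 2) μ := (MemLp_comp_sub hg y).integrable_sq
    have i2 := integrable_mul_comp_sub hg hg y
    have e1 : ∫ p, g (p - y) ^ 2 ∂μ = corr μ g g 0 := by
      rw [integral_sub_right_eq_self (fun p => g p ^ 2) y]
      simp [corr, sq]
    have e2 : ∫ p, g p ^ 2 ∂μ = corr μ g g 0 := by simp [corr, sq]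
    have : ∀ p, (g (p - y) - g p) ^ 2 = g (p - y) ^ 2 + g p ^ 2 - 2 * (g p * g (p - y)) := by
      intro p; ring
    simp_rw [this]
    have i3 : Integrable (fun p => g (p - y) ^ 2 + g p ^ 2) μ := i1.add hsq
    rw [integral_sub i3 (i2.const_mul 2), integral_add i1 hsq, e1, e2, integral_const_mul]
    simp only [hN, corr]
    ring
  -- only the difference quotients of `g` contribute
  have main : ∀ ε : ℝ, 0 < ε →
      |ε⁻¹ * ∫ z, fderiv ℝ σ z e * corr μ (fun p => g p * c p) g (ε • P z) ∂μ|
        ≤ ∫ z, (|fderiv ℝ σ z e| * (|L| * ‖P z‖))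
          * (Real.sqrt (corr μ g g 0) * Real.sqrt (N (ε • P z))) ∂μ := by
    intro ε hε
    have hhalf := integral_fderiv_mul_corr_eq_half hg hc hσ hσc heven (ε • P) e
    simp only [smul_apply] at hhalf
    rw [hhalf]
    have hmeas : Measurable fun q : Y × Y => c q.2 - c (q.2 - ε • P q.1) := by
      have hPm : Measurable fun y : Y => P y := P.continuous.measurable
      exact (hcm.comp measurable_snd).sub
        (hcm.comp (measurable_snd.sub ((hPm.comp measurable_fst).const_smul ε)))
    -- the diagonal part vanishes
    have hdiag : Integrable (fun z => fderiv ℝ σ z e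
          * ∫ p, g p ^ 2 * (c p - c (p - ε • P z)) ∂μ) μ
        ∧ ∫ z, fderiv ℝ σ z e * ∫ p, g p ^ 2 * (c p - c (p - ε • P z)) ∂μ ∂μ = 0 := by
      have hm : AEStronglyMeasurable (fun q : Y × Y =>
          fderiv ℝ σ q.1 e * (g q.2 ^ 2 * (c q.2 - c (q.2 - ε • P q.1)))) (μ.prod μ) :=
        (hk.aestronglyMeasurable.comp_fst).mul ((hg.1.comp_snd.pow 2).mul
          hmeas.aestronglyMeasurable)
      have hint : Integrable (fun q : Y × Y =>
          fderiv ℝ σ q.1 e * (g q.2 ^ 2 * (c q.2 - c (q.2 - ε • P q.1)))) (μ.prod μ) := by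
        have hb : Integrable (fun q : Y × Y =>
            (|fderiv ℝ σ q.1 e| * (ε * (L * ‖P q.1‖))) * (g q.2 ^ 2)) (μ.prod μ) := by
          refine Integrable.mul_prod (f := fun z => |fderiv ℝ σ z e| * (ε * (L * ‖P z‖)))
            (g := fun p => g p ^ 2) ?_ hsq
          have hcont : Continuous fun z => |fderiv ℝ σ z e| * (ε * (L * ‖P z‖)) :=
            hk.abs.mul (continuous_const.mul (continuous_const.mul P.continuous.norm))
          exact hcont.integrable_of_hasCompactSupport hkc.abs.mul_right
        refine hb.mono hm (Eventually.of_forall fun q => ?_)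
        by_cases hq : g q.2 = 0
        · simp [hq]
        · simp only [Real.norm_eq_abs, abs_mul, abs_pow, abs_abs]
          have h1 := (hl ε hε q.2 q.1 hq).trans (le_abs_self _)
          simp only [abs_mul] at h1
          have : 0 ≤ |fderiv ℝ σ q.1 e| * |g q.2| ^ 2 := by positivity
          nlinarith [mul_le_mul_of_nonneg_left h1 this]
      have hsw := integral_integral_swap (f := fun z p =>
        fderiv ℝ σ z e * (g p ^ 2 * (c p - c (p - ε • P z)))) hint
      have hip := hint.integral_prod_left
      simp_rw [integral_const_mul] at hsw hip
      refine ⟨hip, ?_⟩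
      rw [hsw]
      refine (integral_congr_ae (g := fun _ => (0 : ℝ)) (Eventually.of_forall fun p => ?_)).trans
        (integral_zero _ _)
      by_cases hq : g p = 0
      · simp [hq]
      have hloc : LocallyIntegrable (fun z => c p - c (p - ε • P z)) μ := by
        have hb : LocallyIntegrable (fun z => ε * (L * ‖P z‖)) μ :=
          Continuous.locallyIntegrable
            (continuous_const.mul (continuous_const.mul P.continuous.norm))
        refine hb.mono (hmeas.comp measurable_prodMk_right).aestronglyMeasurable ?_
        exact Eventually.of_forall fun z => (hl ε hε p z hq).trans (le_abs_self _)
      have hz := integral_fderiv_mul_eq_zero (μ := μ) hσ hσc (v := e) hloc (fun z s => by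
        have : p - ε • P (z + s • e) = p - ε • P z + (-(ε * s)) • e := by
          rw [map_add, map_smul, hP]; module
        rw [this, hinv])
      calc ∫ z, fderiv ℝ σ z e * (g p ^ 2 * (c p - c (p - ε • P z))) ∂μ
          = g p ^ 2 * ∫ z, fderiv ℝ σ z e * (c p - c (p - ε • P z)) ∂μ := by
            rw [← integral_const_mul]
            exact integral_congr_ae (Eventually.of_forall fun z => by ring)
        _ = 0 := by rw [hz, mul_zero]
    obtain ⟨k2, hdiag⟩ := hdiag
    have hbase : Integrable (fun z => (|fderiv ℝ σ z e| * (|L| * ‖P z‖))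
          * (Real.sqrt (corr μ g g 0) * Real.sqrt (N (ε • P z)))) μ := by
      refine Continuous.integrable_of_hasCompactSupport ?_ hkc.abs.mul_right.mul_right
      refine (hk.abs.mul (continuous_const.mul P.continuous.norm)).mul (continuous_const.mul
        (Real.continuous_sqrt.comp (continuous_const.mul (continuous_const.sub
          (hcorr.comp (P.continuous.const_smul ε))))))
    -- what remains is small by the continuity of translations
    have hrem : ∀ z, |∫ p, g p * g (p - ε • P z) * (c p - c (p - ε • P z)) ∂μ
        - ∫ p, g p ^ 2 * (c p - c (p - ε • P z)) ∂μ|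
        ≤ ε * (|L| * ‖P z‖ * (Real.sqrt (corr μ g g 0) * Real.sqrt (N (ε • P z)))) := by
      intro z
      have j1 : Integrable (fun p => g p * g (p - ε • P z) * (c p - c (p - ε • P z))) μ := by
        refine ((integrable_mul_comp_sub hc hg (ε • P z)).sub
          (integrable_mul_comp_sub hg hc (ε • P z))).congr (Eventually.of_forall fun p => ?_)
        simp only [Pi.sub_apply]
        ring
      have hm2 : Measurable fun p => c p - c (p - ε • P z) := hmeas.comp measurable_prodMk_left
      have j2 : Integrable (fun p => g p ^ 2 * (c p - c (p - ε • P z))) μ := by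
        refine (hsq.mul_const (ε * (L * ‖P z‖))).mono
          ((hg.1.pow 2).mul hm2.aestronglyMeasurable) (Eventually.of_forall fun p => ?_)
        by_cases hq : g p = 0
        · simp [hq]
        · rw [norm_mul, norm_mul]
          exact mul_le_mul_of_nonneg_left ((hl ε hε p z hq).trans (le_abs_self _))
            (norm_nonneg _)
      have hgd : MemLp (fun p => g (p - ε • P z) - g p) 2 μ := (MemLp_comp_sub hg _).sub hg
      rw [← integral_sub j1 j2]
      have hb : ∀ p, ‖g p * g (p - ε • P z) * (c p - c (p - ε • P z))
          - g p ^ 2 * (c p - c (p - ε • P z))‖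
          ≤ (ε * (|L| * ‖P z‖)) * (|g p| * |g (p - ε • P z) - g p|) := by
        intro p
        by_cases hq : g p = 0
        · simp [hq]
        · have : g p * g (p - ε • P z) * (c p - c (p - ε • P z))
              - g p ^ 2 * (c p - c (p - ε • P z))
              = (c p - c (p - ε • P z)) * (g p * (g (p - ε • P z) - g p)) := by ring
          rw [this, norm_mul, norm_mul, Real.norm_eq_abs, Real.norm_eq_abs, Real.norm_eq_abs]
          refine mul_le_mul_of_nonneg_right ((hl ε hε p z hq).trans ?_) (by positivity)
          exact mul_le_mul_of_nonneg_left
            (mul_le_mul_of_nonneg_right (le_abs_self L) (norm_nonneg _)) hε.le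
      have hcs := abs_integral_mul_le_sqrt hg.abs hgd.abs
      have hii : Integrable (fun p => |g p| * |g (p - ε • P z) - g p|) μ :=
        hg.abs.integrable_mul hgd.abs
      have e2 : ∫ p, |g p| ^ 2 ∂μ = corr μ g g 0 := by simp [corr, sq]
      have e3 : ∫ p, |g (p - ε • P z) - g p| ^ 2 ∂μ = N (ε • P z) := by
        rw [← hNdist]; simp
      simp only [Pi.abs_apply, e2, e3] at hcs
      calc |∫ p, g p * g (p - ε • P z) * (c p - c (p - ε • P z))
            - g p ^ 2 * (c p - c (p - ε • P z)) ∂μ|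
          ≤ ∫ p, (ε * (|L| * ‖P z‖)) * (|g p| * |g (p - ε • P z) - g p|) ∂μ :=
            norm_integral_le_of_norm_le (hii.const_mul _) (Eventually.of_forall hb)
        _ = (ε * (|L| * ‖P z‖)) * ∫ p, |g p| * |g (p - ε • P z) - g p| ∂μ :=
            integral_const_mul _ _
        _ ≤ (ε * (|L| * ‖P z‖)) * (Real.sqrt (corr μ g g 0) * Real.sqrt (N (ε • P z))) :=
            mul_le_mul_of_nonneg_left ((le_abs_self _).trans hcs) (by positivity)
        _ = _ := by ring
    set D : Y → ℝ := fun z => ∫ p, g p * g (p - ε • P z) * (c p - c (p - ε • P z)) ∂μ with hD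
    set D₀ : Y → ℝ := fun z => ∫ p, g p ^ 2 * (c p - c (p - ε • P z)) ∂μ with hD₀
    have k1 : Integrable (fun z => fderiv ℝ σ z e * D z) μ := by
      have hDeq : D = fun z => corr μ (fun p => g p * c p) g (ε • P z)
          - corr μ g (fun p => g p * c p) (ε • P z) := by
        funext z
        simp only [hD, corr]
        rw [← integral_sub (integrable_mul_comp_sub hc hg _) (integrable_mul_comp_sub hg hc _)]
        exact integral_congr_ae (Eventually.of_forall fun p => by ring)
      rw [hDeq]
      exact (hk.mul (((corr_continuous hc hg).comp (P.continuous.const_smul ε)).sub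
        ((corr_continuous hg hc).comp (P.continuous.const_smul ε)))).integrable_of_hasCompactSupport
          hkc.mul_right
    have hbound : |∫ z, fderiv ℝ σ z e * D z ∂μ| ≤ ε * ∫ z, (|fderiv ℝ σ z e| * (|L| * ‖P z‖))
          * (Real.sqrt (corr μ g g 0) * Real.sqrt (N (ε • P z))) ∂μ := by
      have k3 : ∫ z, fderiv ℝ σ z e * D z ∂μ
          = ∫ z, fderiv ℝ σ z e * (D z - D₀ z) ∂μ := by
        simp_rw [mul_sub]
        rw [integral_sub k1 k2, hdiag, sub_zero]
      rw [k3, ← integral_const_mul]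
      refine norm_integral_le_of_norm_le (f := fun z => fderiv ℝ σ z e * (D z - D₀ z))
        (hbase.const_mul ε) (Eventually.of_forall fun z => ?_)
      rw [norm_mul, Real.norm_eq_abs, Real.norm_eq_abs]
      calc |fderiv ℝ σ z e| * |D z - D₀ z| ≤ |fderiv ℝ σ z e| * _ :=
            mul_le_mul_of_nonneg_left (hrem z) (abs_nonneg _)
        _ = _ := by ring
    have hb0 : 0 ≤ ∫ z, (|fderiv ℝ σ z e| * (|L| * ‖P z‖))
          * (Real.sqrt (corr μ g g 0) * Real.sqrt (N (ε • P z))) ∂μ :=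
      integral_nonneg fun z => by positivity
    rw [abs_mul, abs_mul, abs_of_pos (inv_pos.mpr hε)]
    have h2 : |(2⁻¹ : ℝ)| = 2⁻¹ := by norm_num
    rw [h2]
    calc ε⁻¹ * (2⁻¹ * |∫ z, fderiv ℝ σ z e * D z ∂μ|)
        ≤ ε⁻¹ * (2⁻¹ * (ε * ∫ z, (|fderiv ℝ σ z e| * (|L| * ‖P z‖))
          * (Real.sqrt (corr μ g g 0) * Real.sqrt (N (ε • P z))) ∂μ)) := by gcongr
      _ = 2⁻¹ * ∫ z, (|fderiv ℝ σ z e| * (|L| * ‖P z‖))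
          * (Real.sqrt (corr μ g g 0) * Real.sqrt (N (ε • P z))) ∂μ := by
          rw [mul_left_comm 2⁻¹ ε, inv_mul_cancel_left₀ hε.ne']
      _ ≤ _ := by linarith
  have hcontN : Continuous fun q : (ℝ × ℝ × ℝ) × Y =>
      Real.sqrt (corr μ g g 0) * Real.sqrt (N (q.1.1 • P q.2)) := by
    refine continuous_const.mul (Real.continuous_sqrt.comp ?_)
    refine continuous_const.mul (continuous_const.sub (hcorr.comp ?_))
    exact (continuous_fst.comp continuous_fst).smul (P.continuous.comp continuous_snd)
  have hlim : Tendsto (fun ε : ℝ => ∫ z, (|fderiv ℝ σ z e| * (|L| * ‖P z‖))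
          * (Real.sqrt (corr μ g g 0) * Real.sqrt (N (ε • P z))) ∂μ) (𝓝 0) (𝓝 0) := by
    have hcont := continuous_integral_mul_of_hasCompactSupport (μ := μ)
      (k := fun z => |fderiv ℝ σ z e| * (|L| * ‖P z‖))
      (hk.abs.mul (continuous_const.mul P.continuous.norm)) hkc.abs.mul_right
      (G := fun s z => Real.sqrt (corr μ g g 0) * Real.sqrt (N (s.1 • P z))) hcontN
    have h2 := (hcont.comp (Continuous.prodMk_left (X := ℝ) ((0 : ℝ), (0 : ℝ)))).tendsto 0
    simpa [hN, Function.comp_def] using h2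
  refine squeeze_zero_norm' ?_ (hlim.mono_left nhdsWithin_le_nhds)
  filter_upwards [self_mem_nhdsWithin] with ε hε
  exact main ε hε

end Renormalization

/-! ### Renormalization -/

section Renormalization

variable {Y : Type*} [NormedAddCommGroup Y] [NormedSpace ℝ Y] [FiniteDimensional ℝ Y]
  [MeasurableSpace Y] [BorelSpace Y] {μ : Measure Y} [μ.IsAddHaarMeasure]

/-- Renormalization for a field with three groups of variables, the ranges of `P₁`, `P₂`, `P₃`.
A weak solution `g` with compact support of `Σ_j c_j ∂_j g = h` satisfies `∫ g h = 0`, as if the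
product rule and the vanishing of the divergence could be used for `g`. The mollification is
anisotropic: the scales in the three groups of variables go to zero one after the other, so that
each coefficient need only be regular in variables that are mollified at larger or equal
scales. -/
theorem integral_mul_eq_zero_of_weak_transport {ι : Type*} [Fintype ι] {g h : Y → ℝ}
    (hg : MemLp g 2 μ) (hgc : HasCompactSupport g) (hh : MemLp h 2 μ)
    {P₁ P₂ P₃ : Y →L[ℝ] Y} (hsum : ∀ z, P₁ z + P₂ z + P₃ z = z)
    (h11 : ∀ z, P₁ (P₁ z) = P₁ z) (h12 : ∀ z, P₁ (P₂ z) = 0) (h13 : ∀ z, P₁ (P₃ z) = 0)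
    (h21 : ∀ z, P₂ (P₁ z) = 0) (h22 : ∀ z, P₂ (P₂ z) = P₂ z) (h23 : ∀ z, P₂ (P₃ z) = 0)
    {e₁ e₂ : Y} {e : ι → Y} (he₁ : P₁ e₁ = e₁) (he₂ : P₂ e₂ = e₂) (he : ∀ j, P₃ (e j) = e j)
    {c₁ c₂ : Y → ℝ} {c : ι → Y → ℝ} {ℓ : Y →L[ℝ] ℝ} {L : ℝ}
    (hc₁ : MemLp (fun p => g p * c₁ p) 2 μ) (hc₂ : MemLp (fun p => g p * c₂ p) 2 μ)
    (hc : ∀ j, MemLp (fun p => g p * c j p) 2 μ) (hcm : ∀ j, Measurable (c j))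
    (hdiff₁ : ∀ p z, c₁ p - c₁ (p - z) = ℓ (P₁ z)) (hℓ : ℓ e₁ = 0)
    (hdiff₂ : ∀ p z, P₁ z = 0 → c₂ (p - z) = c₂ p)
    (hinv : ∀ j p (s : ℝ), c j (p + s • e j) = c j p)
    (hlip : ∀ j p z, g p ≠ 0 → |c j p - c j (p - P₃ z)| ≤ L * ‖P₃ z‖)
    (weak : ∀ ψ : Y → ℝ, ContDiff ℝ 1 ψ → HasCompactSupport ψ →
      ∫ p, g p * (c₁ p * fderiv ℝ ψ p e₁ + c₂ p * fderiv ℝ ψ p e₂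
        + ∑ j, c j p * fderiv ℝ ψ p (e j)) ∂μ = -∫ p, h p * ψ p ∂μ) :
    ∫ p, g p * h p ∂μ = 0 := by
  have h32 : ∀ z, P₃ (P₂ z) = 0 := fun z => by
    have := hsum (P₂ z); rw [h12, h22] at this; simpa using this
  have h31 : ∀ z, P₃ (P₁ z) = 0 := fun z => by
    have := hsum (P₁ z); rw [h11, h21] at this; simpa using this
  have h33 : ∀ z, P₃ (P₃ z) = P₃ z := fun z => by
    have := hsum (P₃ z); rw [h13, h23] at this; simpa using this
  -- an even test function
  obtain ⟨σ, hσ, hσc, heven, hσ1⟩ : ∃ σ : Y → ℝ, ContDiff ℝ 1 σ ∧ HasCompactSupport σ ∧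
      (∀ z, σ (-z) = σ z) ∧ 0 < ∫ z, σ z ∂μ := by
    let b : ContDiffBump (0 : Y) := ⟨1, 2, by norm_num, by norm_num⟩
    exact ⟨b, b.contDiff, b.hasCompactSupport, b.neg, b.integral_pos⟩
  have hk : ∀ v, Continuous fun z => fderiv ℝ σ z v := fun v =>
    (hσ.continuous_fderiv (by norm_num)).clm_apply continuous_const
  have hkc : ∀ v, HasCompactSupport fun z => fderiv ℝ σ z v := fun v =>
    hσc.fderiv_apply (𝕜 := ℝ) v
  -- the anisotropic scaling
  let A : ℝ × ℝ × ℝ → Y →L[ℝ] Y := fun s => s.1 • P₁ + s.2.1 • P₂ + s.2.2 • P₃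
  have hA : ∀ s z, A s z = s.1 • P₁ z + s.2.1 • P₂ z + s.2.2 • P₃ z := fun s z => rfl
  have hAc : Continuous fun q : (ℝ × ℝ × ℝ) × Y => A q.1 q.2 := by
    simp only [hA]
    fun_prop
  have hcorrA : ∀ {u : Y → ℝ}, MemLp u 2 μ →
      Continuous (Function.uncurry fun (s : ℝ × ℝ × ℝ) z => corr μ u g (A s z)) := fun hu =>
    (corr_continuous hu hg).comp hAc
  have hP1A : ∀ s z, P₁ (A s z) = s.1 • P₁ z := fun s z => by
    simp [hA, h11, h12, h13]
  -- the terms of the scaled identity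
  let X : ℝ × ℝ × ℝ → ℝ := fun s => 2⁻¹ * ∫ z, (fderiv ℝ σ z e₁ * ℓ (P₁ z)) * corr μ g g (A s z) ∂μ
  let T : ℝ × ℝ × ℝ → ℝ := fun s =>
    ∫ z, fderiv ℝ σ z e₂ * corr μ (fun p => g p * c₂ p) g (A s z) ∂μ
  let U : ℝ × ℝ × ℝ → ℝ := fun s =>
    ∑ j, ∫ z, fderiv ℝ σ z (e j) * corr μ (fun p => g p * c j p) g (A s z) ∂μ
  let H : ℝ × ℝ × ℝ → ℝ := fun s => ∫ z, σ z * corr μ h g (A s z) ∂μ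
  have hℓc : Continuous fun z => ℓ (P₁ z) := ℓ.continuous.comp P₁.continuous
  have hXc : Continuous X := continuous_const.mul
    (continuous_integral_mul_of_hasCompactSupport ((hk e₁).mul hℓc) (hkc e₁).mul_right (hcorrA hg))
  have hTc : Continuous T :=
    continuous_integral_mul_of_hasCompactSupport (hk e₂) (hkc e₂) (hcorrA hc₂)
  have hUc : Continuous U := continuous_finsetSum _ fun j _ =>
    continuous_integral_mul_of_hasCompactSupport (hk (e j)) (hkc (e j)) (hcorrA (hc j))
  have hHc : Continuous H :=
    continuous_integral_mul_of_hasCompactSupport hσ.continuous hσc (hcorrA hh)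
  -- the scaled identity
  have hident : ∀ a b ε : ℝ, 0 < a → 0 < b → 0 < ε →
      X (a, b, ε) + b⁻¹ * T (a, b, ε) + ε⁻¹ * U (a, b, ε) = -H (a, b, ε) := by
    intro a b ε ha hb hε
    have hinvA : ∀ s t : ℝ × ℝ × ℝ, s.1 * t.1 = 1 → s.2.1 * t.2.1 = 1 → s.2.2 * t.2.2 = 1 →
        ∀ z, A s (A t z) = z := by
      intro s t h1 h2 h3 z
      rw [hA, hA]
      simp only [map_add, map_smul, h11, h12, h13, h21, h22, h23, h31, h32, h33, smul_zero,
        add_zero, zero_add, smul_smul, h1, h2, h3, one_smul]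
      exact hsum z
    let E : Y ≃L[ℝ] Y := ContinuousLinearEquiv.equivOfInverse (A (a, b, ε)) (A (a⁻¹, b⁻¹, ε⁻¹))
      (hinvA _ _ (inv_mul_cancel₀ ha.ne') (inv_mul_cancel₀ hb.ne') (inv_mul_cancel₀ hε.ne'))
      (hinvA _ _ (mul_inv_cancel₀ ha.ne') (mul_inv_cancel₀ hb.ne') (mul_inv_cancel₀ hε.ne'))
    have hEs : ∀ z, E.symm z = a⁻¹ • P₁ z + b⁻¹ • P₂ z + ε⁻¹ • P₃ z := fun z => rfl
    have hE : ∀ z, E z = A (a, b, ε) z := fun z => rfl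
    let cc : Option (Option ι) → Y → ℝ := fun j => j.elim c₁ fun j => j.elim c₂ c
    let ee : Option (Option ι) → Y := fun j => j.elim e₁ fun j => j.elim e₂ e
    let lam : Option (Option ι) → ℝ := fun j => j.elim a⁻¹ fun j => j.elim b⁻¹ fun _ => ε⁻¹
    have hscale := sum_integral_fderiv_mul_corr_comp (μ := μ) (u := fun j p => g p * cc j p)
      (g := g) (h := h) (e := ee)
      (fun τ hτ hτc => sum_integral_fderiv_mul_corr (c := cc) hg hgc hh (by
        rintro (_ | _ | j)
        exacts [hc₁, hc₂, hc j]) (fun ψ h1 h2 => by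
        rw [← weak ψ h1 h2]
        simp only [Fintype.sum_option, cc, ee, Option.elim, add_assoc]) hτ hτc)
      E (lam := lam) (by
        rintro (_ | _ | j)
        · simp only [hEs, ee, lam, Option.elim]
          rw [← he₁, h11, h21, h31]; simp
        · simp only [hEs, ee, lam, Option.elim]
          rw [← he₂, h12, h22, h32]; simp
        · simp only [hEs, ee, lam, Option.elim]
          rw [← he j, h13, h23, h33]; simp) hσ hσc
    simp only [Fintype.sum_option, cc, ee, lam, Option.elim, hE] at hscale
    rw [← Finset.mul_sum] at hscale
    have hX : a⁻¹ * ∫ z, fderiv ℝ σ z e₁ * corr μ (fun p => g p * c₁ p) g (A (a, b, ε) z) ∂μ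
        = X (a, b, ε) := by
      rw [integral_fderiv_mul_corr_eq_half hg hc₁ hσ hσc heven]
      simp only [X, hdiff₁, hP1A, integral_mul_const, map_smul, smul_eq_mul]
      rw [← mul_assoc, mul_comm a⁻¹, mul_assoc, ← integral_const_mul]
      congr 1
      refine integral_congr_ae (Eventually.of_forall fun z => ?_)
      simp only [corr]
      field_simp
    rw [hX, ← add_assoc] at hscale
    exact hscale
  -- the first scale goes to zero
  have hT0 : ∀ b ε, T (0, b, ε) = 0 := by
    intro b ε
    simp only [T]
    rw [integral_fderiv_mul_corr_eq_half hg hc₂ hσ hσc heven]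
    have : ∀ z p, c₂ p - c₂ (p - A (0, b, ε) z) = 0 := fun z p => by
      rw [hdiff₂ p _ (by rw [hP1A]; simp), sub_self]
    simp [this]
  have hident1 : ∀ b ε : ℝ, 0 < b → 0 < ε → X (0, b, ε) + ε⁻¹ * U (0, b, ε) = -H (0, b, ε) := by
    intro b ε hb hε
    have hc0 : Continuous fun a : ℝ => ((a, b, ε) : ℝ × ℝ × ℝ) := by fun_prop
    have hl : Tendsto (fun a : ℝ => X (a, b, ε) + b⁻¹ * T (a, b, ε) + ε⁻¹ * U (a, b, ε))
        (𝓝[>] 0) (𝓝 (X (0, b, ε) + b⁻¹ * T (0, b, ε) + ε⁻¹ * U (0, b, ε))) :=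
      ((((hXc.comp hc0).add (continuous_const.mul (hTc.comp hc0))).add
        (continuous_const.mul (hUc.comp hc0))).tendsto 0).mono_left nhdsWithin_le_nhds
    have hr : Tendsto (fun a : ℝ => -H (a, b, ε)) (𝓝[>] 0) (𝓝 (-H (0, b, ε))) :=
      ((hHc.comp hc0).neg.tendsto 0).mono_left nhdsWithin_le_nhds
    have := tendsto_nhds_unique (hl.congr' (by
      filter_upwards [self_mem_nhdsWithin] with a ha using hident a b ε ha hb hε)) hr
    rw [hT0] at this
    linarith
  -- the second scale goes to zero
  have hident2 : ∀ ε : ℝ, 0 < ε → X (0, 0, ε) + ε⁻¹ * U (0, 0, ε) = -H (0, 0, ε) := by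
    intro ε hε
    have hc0 : Continuous fun b : ℝ => (((0 : ℝ), b, ε) : ℝ × ℝ × ℝ) := by fun_prop
    have hl : Tendsto (fun b : ℝ => X (0, b, ε) + ε⁻¹ * U (0, b, ε))
        (𝓝[>] 0) (𝓝 (X (0, 0, ε) + ε⁻¹ * U (0, 0, ε))) :=
      (((hXc.comp hc0).add (continuous_const.mul (hUc.comp hc0))).tendsto 0).mono_left
        nhdsWithin_le_nhds
    have hr : Tendsto (fun b : ℝ => -H (0, b, ε)) (𝓝[>] 0) (𝓝 (-H (0, 0, ε))) :=
      ((hHc.comp hc0).neg.tendsto 0).mono_left nhdsWithin_le_nhds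
    exact tendsto_nhds_unique (hl.congr' (by
      filter_upwards [self_mem_nhdsWithin] with b hb using hident1 b ε hb hε)) hr
  -- the third scale goes to zero
  have hU0 : Tendsto (fun ε : ℝ => ε⁻¹ * U (0, 0, ε)) (𝓝[>] 0) (𝓝 0) := by
    have := tendsto_finsetSum (Finset.univ : Finset ι) fun j _ =>
      tendsto_commutator (he j) hg (hcm j) (hc j) (hinv j) (hlip j) hσ hσc heven
    simp only [Finset.sum_const_zero] at this
    refine this.congr fun ε => ?_
    simp only [U, Finset.mul_sum, hA]
    simp
  have hA0 : ∀ z, A (0, 0, 0) z = 0 := fun z => by simp [hA]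
  have hX0 : X (0, 0, 0) = 0 := by
    have : ∫ z, fderiv ℝ σ z e₁ * ℓ (P₁ z) ∂μ = 0 := by
      refine integral_fderiv_mul_eq_zero hσ hσc hℓc.locallyIntegrable fun z s => ?_
      rw [map_add, map_smul, he₁, map_add, map_smul, hℓ]; simp
    simp only [X, hA0, integral_mul_const, this]
    simp
  have hfin : H (0, 0, 0) = 0 := by
    have hc0 : Continuous fun ε : ℝ => (((0 : ℝ), (0 : ℝ), ε) : ℝ × ℝ × ℝ) := by fun_prop
    have hl : Tendsto (fun ε : ℝ => X (0, 0, ε) + ε⁻¹ * U (0, 0, ε)) (𝓝[>] 0)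
        (𝓝 (X (0, 0, 0) + 0)) :=
      (((hXc.comp hc0).tendsto 0).mono_left nhdsWithin_le_nhds).add hU0
    have hr : Tendsto (fun ε : ℝ => -H (0, 0, ε)) (𝓝[>] 0) (𝓝 (-H (0, 0, 0))) :=
      ((hHc.comp hc0).neg.tendsto 0).mono_left nhdsWithin_le_nhds
    have := tendsto_nhds_unique (hl.congr' (by
      filter_upwards [self_mem_nhdsWithin] with ε hε using hident2 ε hε)) hr
    rw [hX0] at this
    linarith
  simp only [H, hA0, integral_mul_const, corr, sub_zero] at hfin
  rcases mul_eq_zero.mp hfin with h0 | h0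
  · exact absurd h0 hσ1.ne'
  · rw [← h0]
    exact integral_congr_ae (Eventually.of_forall fun p => mul_comm _ _)

end Renormalization

/-! ### Integrability of traces -/

instance : (volume : Measure (E2 × E3)).IsAddHaarMeasure :=
  Measure.prod.instIsAddHaarMeasure (volume : Measure E2) (volume : Measure E3)

instance : (volume : Measure Phase).IsAddHaarMeasure :=
  Measure.prod.instIsAddHaarMeasure (volume : Measure ℝ) (volume : Measure (E2 × E3))

instance : (volume : Measure (ℝ × Phase)).IsAddHaarMeasure :=
  Measure.prod.instIsAddHaarMeasure (volume : Measure ℝ) (volume : Measure Phase)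

/-- The part `(0, T) × ℝ² × {|v| ≤ R}` of the phase space of a wall. -/
def wallSet (T R : ℝ) : Set (ℝ × E2 × E3) :=
  Ioo 0 T ×ˢ ((univ : Set E2) ×ˢ Metric.closedBall (0 : E3) R)

lemma measurableSet_wallSet (T R : ℝ) : MeasurableSet (wallSet T R) :=
  measurableSet_Ioo.prod (MeasurableSet.univ.prod Metric.isClosed_closedBall.measurableSet)

lemma measurable_wall_vx : Measurable fun q : ℝ × E2 × E3 => q.2.2 0 :=
  Continuous.measurable (by fun_prop)

lemma abs_coord_le (v : E3) (i : Fin 3) : |v i| ≤ ‖v‖ := PiLp.norm_apply_le v i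

lemma abs_coord_le' (v : E2) (i : Fin 2) : |v i| ≤ ‖v‖ := PiLp.norm_apply_le v i

section Trace

variable {T R : ℝ} {γ : ℝ × E2 × E3 → ℝ}

/-- A trace in `L²(|v_x|)` is measurable where `v_x` does not vanish. -/
lemma aestronglyMeasurable_vx_mul_trace (h : MemLp γ 2 (wallMeasure T R)) :
    AEStronglyMeasurable (fun q => q.2.2 0 * γ q) (volume.restrict (wallSet T R)) := by
  have h1 := h.1
  unfold wallMeasure at h1
  have h2 : AEStronglyMeasurable γ ((volume.restrict (wallSet T R)).withDensity
      fun q => ((Real.toNNReal |q.2.2 0| : ℝ≥0) : ℝ≥0∞)) := h1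
  have hm : Measurable fun q : ℝ × E2 × E3 => Real.toNNReal |q.2.2 0| :=
    measurable_wall_vx.abs.real_toNNReal
  rw [aestronglyMeasurable_withDensity_iff hm] at h2
  have hs : Measurable fun q : ℝ × E2 × E3 => (SignType.sign (q.2.2 0) : ℝ) := by
    have : Measurable fun s : ℝ => ((SignType.sign s : SignType) : ℝ) := by
      have : (fun s : ℝ => ((SignType.sign s : SignType) : ℝ))
          = fun s => if 0 < s then 1 else if s < 0 then -1 else 0 := by
        funext s
        rcases lt_trichotomy s 0 with h | h | h
        · simp [h, not_lt.mpr h.le]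
        · simp [h]
        · simp [h]
      rw [this]
      exact Measurable.ite measurableSet_Ioi measurable_const
        (Measurable.ite measurableSet_Iio measurable_const measurable_const)
    exact this.comp measurable_wall_vx
  refine (hs.aestronglyMeasurable.mul h2).congr (Eventually.of_forall fun q => ?_)
  simp only [Real.coe_toNNReal _ (abs_nonneg _), smul_eq_mul, Pi.mul_apply]
  rw [← mul_assoc, sign_mul_abs]

lemma integrableOn_abs_vx_mul_sq (h : MemLp γ 2 (wallMeasure T R)) :
    IntegrableOn (fun q => |q.2.2 0| * γ q ^ 2) (wallSet T R) := by
  have h1 := h.integrable_sq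
  unfold wallMeasure at h1
  rw [integrable_withDensity_iff_integrable_smul' (by
    exact (measurable_wall_vx.abs).ennreal_ofReal) (Eventually.of_forall fun q => by simp)] at h1
  simpa [wallSet, IntegrableOn] using h1

lemma memLp_vx_mul_trace (h : MemLp γ 2 (wallMeasure T R)) :
    MemLp (fun q => q.2.2 0 * γ q) 2 (volume.restrict (wallSet T R)) := by
  rw [memLp_two_iff_integrable_sq (aestronglyMeasurable_vx_mul_trace h)]
  refine ((integrableOn_abs_vx_mul_sq h).const_mul R).mono
    ((aestronglyMeasurable_vx_mul_trace h).pow 2) ?_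
  rw [ae_restrict_iff' (measurableSet_wallSet T R)]
  refine Eventually.of_forall fun q hq => ?_
  have hv : |q.2.2 0| ≤ R := (abs_coord_le _ _).trans (by simpa using hq.2.2)
  have h0 : 0 ≤ |q.2.2 0| * γ q ^ 2 := by positivity
  simp only [norm_mul, norm_pow, Real.norm_eq_abs, mul_pow, sq_abs, abs_abs]
  calc q.2.2 0 ^ 2 * γ q ^ 2 = |q.2.2 0| * (|q.2.2 0| * γ q ^ 2) := by
        rw [← mul_assoc, ← sq, sq_abs]
    _ ≤ |R| * (|q.2.2 0| * γ q ^ 2) := mul_le_mul_of_nonneg_right (hv.trans (le_abs_self R)) h0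

/-- A bounded function with bounded support in the velocity, times `v_x γ`. -/
lemma memLp_vx_mul_trace_mul (h : ∀ R, MemLp γ 2 (wallMeasure T R)) {w : ℝ × E2 × E3 → ℝ}
    (hw : Measurable w) {C : ℝ} (hC : ∀ q, |w q| ≤ C) (hs : ∀ q, w q ≠ 0 → q ∈ wallSet T R) :
    MemLp (fun q => q.2.2 0 * γ q * w q) 2 volume := by
  have hsupp : (fun q => q.2.2 0 * γ q * w q)
      = (wallSet T R).indicator fun q => q.2.2 0 * γ q * w q := by
    funext q
    by_cases hq : q ∈ wallSet T R
    · simp [hq]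
    · have : w q = 0 := by
        by_contra h0; exact hq (hs q h0)
      simp [this, hq]
  rw [hsupp, memLp_indicator_iff_restrict (measurableSet_wallSet T R)]
  refine (memLp_vx_mul_trace (h R)).of_le_mul (c := C)
    ((aestronglyMeasurable_vx_mul_trace (h R)).mul hw.aestronglyMeasurable)
    (Eventually.of_forall fun q => ?_)
  rw [norm_mul, mul_comm]
  exact mul_le_mul_of_nonneg_right (hC q) (norm_nonneg _)

end Trace

/-! ### Slab coordinates -/

/-- The variables with the coordinate `x` in front. -/
def xFirst : (ℝ × Phase) ≃ᵐ ℝ × (ℝ × E2 × E3) :=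
  (MeasurableEquiv.prodAssoc.symm.trans
    (MeasurableEquiv.prodCongr MeasurableEquiv.prodComm (MeasurableEquiv.refl (E2 × E3)))).trans
      MeasurableEquiv.prodAssoc

@[simp] lemma xFirst_apply (p : ℝ × Phase) : xFirst p = (p.2.1, p.1, p.2.2) := rfl

@[simp] lemma xFirst_symm_apply (q : ℝ × (ℝ × E2 × E3)) :
    xFirst.symm q = (q.2.1, q.1, q.2.2) := rfl

lemma measurePreserving_xFirst : MeasurePreserving xFirst volume volume := by
  have h1 : MeasurePreserving
      (MeasurableEquiv.prodAssoc (α := ℝ) (β := ℝ) (γ := E2 × E3)) volume volume :=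
    volume_preserving_prodAssoc
  have h2 : MeasurePreserving (Prod.map (Prod.swap : ℝ × ℝ → ℝ × ℝ) (id : E2 × E3 → E2 × E3))
      ((volume.prod volume).prod volume) ((volume.prod volume).prod volume) :=
    Measure.measurePreserving_swap.prod (MeasurePreserving.id _)
  exact h1.comp (h2.comp (h1.symm _))

/-- Integration over a region bounded by planes `x = const`, with `x` integrated first. -/
lemma setIntegral_x_mem {S : Set ℝ} {G : ℝ × Phase → ℝ}
    (hG : IntegrableOn G {p | p.2.1 ∈ S}) :
    ∫ p in {p : ℝ × Phase | p.2.1 ∈ S}, G p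
      = ∫ q : ℝ × E2 × E3, ∫ x in S, G (q.1, x, q.2) := by
  have hpre : {p : ℝ × Phase | p.2.1 ∈ S} = xFirst ⁻¹' (S ×ˢ univ) := by
    ext p; simp
  have hmp := measurePreserving_xFirst
  have hG' : IntegrableOn (fun q => G (xFirst.symm q)) (S ×ˢ univ) := by
    rw [← hmp.integrableOn_comp_preimage xFirst.measurableEmbedding, ← hpre]
    simpa [Function.comp_def] using hG
  have h1 := hmp.setIntegral_preimage_emb xFirst.measurableEmbedding
    (fun q => G (xFirst.symm q)) (S ×ˢ univ)
  rw [← hpre] at h1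
  simp only [MeasurableEquiv.symm_apply_apply] at h1
  rw [h1]
  have hvol : (volume : Measure (ℝ × (ℝ × E2 × E3))).restrict (S ×ˢ univ)
      = (volume.restrict S).prod volume := by
    rw [Measure.volume_eq_prod, Measure.restrict_prod_eq_prod_univ]
  unfold IntegrableOn at hG'
  rw [hvol] at hG' ⊢
  rw [integral_prod_symm _ hG']
  rfl

/-- A square integrable function of the other variables, cut off in `x`. -/
lemma memLp_comp_drop_x {u : ℝ × E2 × E3 → ℝ} (hu : MemLp u 2 volume) (R : ℝ) :
    MemLp (fun p : ℝ × Phase => (Icc (-R) R).indicator 1 p.2.1 * u (p.1, p.2.2)) 2 volume := by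
  have h1 : MemLp (fun q : ℝ × (ℝ × E2 × E3) => u q.2) 2
      ((volume.restrict (Icc (-R) R)).prod volume) := hu.comp_snd _
  rw [Measure.restrict_prod_eq_prod_univ,
    ← memLp_indicator_iff_restrict (measurableSet_Icc.prod MeasurableSet.univ)] at h1
  have h2 := h1.comp_measurePreserving measurePreserving_xFirst
  convert h2 using 2 with p
  by_cases hp : p.2.1 ∈ Icc (-R) R <;> simp [hp, Set.indicator]

/-! ### Extension beyond the walls -/

/-- The transport field with a given electric field `E` in the place of `-∇φ`. -/
noncomputable def field (α : ℝ) (B : E2 → ℝ) (E : ℝ → E2 → E2) (p : ℝ × Phase) : ℝ × Phase :=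
  (α, α⁻¹ * p.2.2.2 0, par p.2.2.2, lift (E p.1 p.2.2.1) - α⁻¹ • crossB p.2.2.2 (B p.2.2.1))

/-- A measurable electric field that is bounded and Lipschitz in space at every time. -/
structure IsRegularField (M L : ℝ) (E : ℝ → E2 → E2) : Prop where
  measurable : Measurable fun q : ℝ × E2 => E q.1 q.2
  bound : ∀ t ξ, ‖E t ξ‖ ≤ M
  lip : ∀ t ξ ξ', ‖E t ξ - E t ξ'‖ ≤ L * ‖ξ - ξ'‖

/-- Square integrable weak solutions, with traces, of the transport equation; the test functions
vanish near the initial and the final time. -/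
structure IsWeakTransport (T α : ℝ) (B : E2 → ℝ) (E : ℝ → E2 → E2) (f : ℝ × Phase → ℝ)
    (γ : Fin 2 → ℝ × E2 × E3 → ℝ) : Prop where
  memLp : MemLp f 2 (volume.restrict (Ioo 0 T ×ˢ Theta))
  trace : ∀ i R, MemLp (γ i) 2 (wallMeasure T R)
  green : ∀ ψ : ℝ × Phase → ℝ, ContDiff ℝ 1 ψ → HasCompactSupport ψ →
    tsupport ψ ⊆ {p | p.1 ∈ Ioo 0 T} →
      ∫ p in Ioo 0 T ×ˢ Theta, f p * fderiv ℝ ψ p (field α B E p)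
      = α⁻¹ * ∑ i : Fin 2, ∫ q in Ioo 0 T ×ˢ (univ : Set (E2 × E3)),
          normal i * q.2.2 0 * γ i q * ψ (q.1, wall i, q.2.1, q.2.2)

/-- A function in the slab `0 < x < 1`, extended beyond the walls by its traces, constant
in `x`. -/
noncomputable def extend (f : ℝ × Phase → ℝ) (γ : Fin 2 → ℝ × E2 × E3 → ℝ) (p : ℝ × Phase) : ℝ :=
  if p.2.1 ≤ 0 then γ 0 (p.1, p.2.2) else if p.2.1 < 1 then f p else γ 1 (p.1, p.2.2)

/-- The unit vector of the `x`-axis. -/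
def ex : ℝ × Phase := (0, 1, 0, 0)

open Classical in
/-- The transport field, of which only the `x`-component is kept outside of the slab. -/
noncomputable def extField (α : ℝ) (B : E2 → ℝ) (E : ℝ → E2 → E2) (p : ℝ × Phase) : ℝ × Phase :=
  if p.2.1 ∈ Ioo (0 : ℝ) 1 then field α B E p else (α⁻¹ * p.2.2.2 0) • ex

lemma continuous_par : Continuous par := by
  unfold par
  fun_prop

lemma continuous_lift : Continuous lift := by
  unfold lift
  fun_prop

lemma continuous_crossB : Continuous fun q : E3 × ℝ => crossB q.1 q.2 := by
  unfold crossB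
  fun_prop

lemma measurable_field {α : ℝ} {B : E2 → ℝ} (hB : Continuous B) {E : ℝ → E2 → E2} {M L : ℝ}
    (hE : IsRegularField M L E) : Measurable (field α B E) := by
  have h1 : Measurable fun p : ℝ × Phase => E p.1 p.2.2.1 :=
    hE.measurable.comp (Continuous.measurable
      (f := fun p : ℝ × Phase => (p.1, p.2.2.1)) (by fun_prop))
  have h2 : Continuous fun p : ℝ × Phase => crossB p.2.2.2 (B p.2.2.1) :=
    continuous_crossB.comp (f := fun p : ℝ × Phase => (p.2.2.2, B p.2.2.1)) (by fun_prop)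
  unfold field
  refine measurable_const.prodMk (Measurable.prodMk (Continuous.measurable (by fun_prop))
    (Measurable.prodMk (continuous_par.measurable.comp (Continuous.measurable (by fun_prop))) ?_))
  exact (continuous_lift.measurable.comp h1).sub (h2.const_smul α⁻¹).measurable

lemma measurableSet_x {S : Set ℝ} (hS : MeasurableSet S) :
    MeasurableSet {p : ℝ × Phase | p.2.1 ∈ S} :=
  measurable_fst.comp measurable_snd hS

lemma measurable_extField {α : ℝ} {B : E2 → ℝ} (hB : Continuous B) {E : ℝ → E2 → E2} {M L : ℝ}
    (hE : IsRegularField M L E) : Measurable (extField α B E) := by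
  unfold extField
  exact Measurable.ite (measurableSet_x measurableSet_Ioo) (measurable_field hB hE)
    (Continuous.measurable (by fun_prop))

lemma norm_lift_eq (w : E2) : ‖lift w‖ = ‖w‖ := by
  simp [lift, EuclideanSpace.norm_eq, Fin.sum_univ_three]

lemma norm_par_le (v : E3) : ‖par v‖ ≤ ‖v‖ := by
  rw [par, EuclideanSpace.norm_eq, EuclideanSpace.norm_eq]
  refine Real.sqrt_le_sqrt ?_
  simp only [Fin.sum_univ_three, Fin.sum_univ_two, Real.norm_eq_abs, sq_abs]
  simp only [Matrix.cons_val_zero, Matrix.cons_val_one]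
  nlinarith [sq_nonneg (v 0)]

lemma norm_crossB_le (v : E3) (b : ℝ) : ‖crossB v b‖ ≤ |b| * ‖v‖ := by
  rw [crossB, EuclideanSpace.norm_eq, EuclideanSpace.norm_eq, ← Real.sqrt_sq_eq_abs,
    ← Real.sqrt_mul (sq_nonneg b)]
  refine Real.sqrt_le_sqrt ?_
  simp only [Fin.sum_univ_three, Real.norm_eq_abs, sq_abs]
  simp
  nlinarith [mul_nonneg (sq_nonneg b) (sq_nonneg (v 0))]

/-- The field is bounded where the velocity is. -/
lemma norm_field_le {α b M L R : ℝ} {B : E2 → ℝ} {E : ℝ → E2 → E2} (hb : ∀ ξ, |B ξ| ≤ b)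
    (hE : IsRegularField M L E) {p : ℝ × Phase} (hp : ‖p.2.2.2‖ ≤ R) :
    ‖field α B E p‖ ≤ |α| + |α⁻¹| * R + R + (M + |α⁻¹| * (b * R)) := by
  have hR : 0 ≤ R := (norm_nonneg _).trans hp
  have hM : 0 ≤ M := (norm_nonneg _).trans (hE.bound 0 0)
  have hb0 : 0 ≤ b := (abs_nonneg _).trans (hb 0)
  have h1 : 0 ≤ |α⁻¹| * R := by positivity
  have h2 : 0 ≤ |α⁻¹| * (b * R) := by positivity
  have h3 := abs_nonneg α
  have k1 : ‖α⁻¹ * p.2.2.2 0‖ ≤ |α⁻¹| * R := by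
    rw [norm_mul]
    exact mul_le_mul_of_nonneg_left ((abs_coord_le _ _).trans hp) (abs_nonneg _)
  have k2 : ‖par p.2.2.2‖ ≤ R := (norm_par_le _).trans hp
  have k3 : ‖lift (E p.1 p.2.2.1) - α⁻¹ • crossB p.2.2.2 (B p.2.2.1)‖ ≤ M + |α⁻¹| * (b * R) := by
    refine (norm_sub_le _ _).trans (add_le_add ?_ ?_)
    · rw [norm_lift_eq]; exact hE.bound _ _
    · rw [norm_smul]
      refine mul_le_mul_of_nonneg_left ((norm_crossB_le _ _).trans ?_) (norm_nonneg _)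
      exact mul_le_mul (hb _) hp (norm_nonneg _) hb0
  simp only [field, Prod.norm_def, Real.norm_eq_abs] at k1 ⊢
  refine max_le ?_ (max_le ?_ (max_le ?_ ?_)) <;> linarith

/-- Splitting of an integral at the two walls. -/
lemma integral_eq_add_walls {G : ℝ × Phase → ℝ} (hG : Integrable G) :
    ∫ p, G p = (∫ p in {p : ℝ × Phase | p.2.1 ∈ Iic (0 : ℝ)}, G p)
      + (∫ p in {p : ℝ × Phase | p.2.1 ∈ Ioo (0 : ℝ) 1}, G p)
      + ∫ p in {p : ℝ × Phase | p.2.1 ∈ Ici (1 : ℝ)}, G p := by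
  have hd1 : Disjoint {p : ℝ × Phase | p.2.1 ∈ Iic (0 : ℝ)}
      {p : ℝ × Phase | p.2.1 ∈ Ioo (0 : ℝ) 1} := by
    rw [Set.disjoint_left]
    intro p h1 h2
    exact not_lt.mpr h1 h2.1
  have hd2 : Disjoint ({p : ℝ × Phase | p.2.1 ∈ Iic (0 : ℝ)} ∪
      {p : ℝ × Phase | p.2.1 ∈ Ioo (0 : ℝ) 1}) {p : ℝ × Phase | p.2.1 ∈ Ici (1 : ℝ)} := by
    rw [Set.disjoint_left]
    rintro p (h1 | h1) h2
    · have a : p.2.1 ≤ 0 := h1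
      have b : 1 ≤ p.2.1 := h2
      linarith
    · exact not_lt.mpr h2 h1.2
  have hu : ({p : ℝ × Phase | p.2.1 ∈ Iic (0 : ℝ)} ∪ {p : ℝ × Phase | p.2.1 ∈ Ioo (0 : ℝ) 1})
      ∪ {p : ℝ × Phase | p.2.1 ∈ Ici (1 : ℝ)} = univ := by
    ext p
    simp only [mem_union, mem_ofPred_eq, mem_Iic, mem_Ioo, mem_Ici, mem_univ, iff_true]
    rcases le_or_gt p.2.1 0 with h | h
    · exact Or.inl (Or.inl h)
    · rcases lt_or_ge p.2.1 1 with h' | h'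
      · exact Or.inl (Or.inr ⟨h, h'⟩)
      · exact Or.inr h'
  rw [← setIntegral_univ, ← hu,
    setIntegral_union hd2 (measurableSet_x measurableSet_Ici) hG.integrableOn hG.integrableOn,
    setIntegral_union hd1 (measurableSet_x measurableSet_Ioo) hG.integrableOn hG.integrableOn]

section OneDim

variable {Ψ : ℝ × Phase → ℝ}

lemma line_x (hΨ : ContDiff ℝ 1 Ψ) (hΨc : HasCompactSupport Ψ)
    (q : ℝ × E2 × E3) :
    ContDiff ℝ 1 (fun x : ℝ => Ψ (q.1, x, q.2)) ∧ HasCompactSupport (fun x : ℝ => Ψ (q.1, x, q.2))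
      ∧ ∀ x, deriv (fun x : ℝ => Ψ (q.1, x, q.2)) x = fderiv ℝ Ψ (q.1, x, q.2) ex := by
  refine ⟨hΨ.comp (by fun_prop), ?_, fun x => ?_⟩
  · have hemb : IsClosedEmbedding fun x : ℝ => ((q.1, x, q.2) : ℝ × Phase) := by
      refine IsClosedEmbedding.of_continuous_injective_isClosedMap (by fun_prop) ?_ ?_
      · intro x y h
        simpa using h
      · have : (fun x : ℝ => ((q.1, x, q.2) : ℝ × Phase))
            = fun x : ℝ => Homeomorph.prodAssoc ℝ ℝ (E2 × E3) ((q.1, x), q.2) := rfl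
        rw [this]
        exact (Homeomorph.isClosedMap _).comp ((isClosedMap_prodMk_right q.2).comp
          (isClosedMap_prodMk_left q.1))
    exact hΨc.comp_isClosedEmbedding hemb
  · have h1 : HasDerivAt (fun x : ℝ => ((q.1, x, q.2) : ℝ × Phase)) ex x := by
      have := (hasDerivAt_const x q.1).prodMk ((hasDerivAt_id x).prodMk (hasDerivAt_const x q.2))
      exact this
    exact (((hΨ.differentiable (by norm_num)) _).hasFDerivAt.comp_hasDerivAt x h1).deriv

lemma setIntegral_Iic_mul_fderiv_ex (hΨ : ContDiff ℝ 1 Ψ) (hΨc : HasCompactSupport Ψ)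
    {A : ℝ × E2 × E3 → ℝ} {G : ℝ × Phase → ℝ}
    (hG : Integrable G) (hGA : ∀ p : ℝ × Phase, p.2.1 ≤ 0 →
      G p = A (p.1, p.2.2) * fderiv ℝ Ψ p ex) :
    ∫ p in {p : ℝ × Phase | p.2.1 ∈ Iic (0 : ℝ)}, G p = ∫ q, A q * Ψ (q.1, 0, q.2) := by
  rw [setIntegral_x_mem hG.integrableOn]
  refine integral_congr_ae (Eventually.of_forall fun q => ?_)
  obtain ⟨h1, h2, h3⟩ := line_x hΨ hΨc q
  have : ∀ x ∈ Iic (0 : ℝ), G (q.1, x, q.2)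
      = A q * deriv (fun x : ℝ => Ψ (q.1, x, q.2)) x := fun x hx => by
    rw [hGA (q.1, x, q.2) hx, h3]
  simp only
  rw [setIntegral_congr_fun measurableSet_Iic this, integral_const_mul,
    h2.integral_Iic_deriv_eq h1]

lemma setIntegral_Ici_mul_fderiv_ex (hΨ : ContDiff ℝ 1 Ψ) (hΨc : HasCompactSupport Ψ)
    {A : ℝ × E2 × E3 → ℝ} {G : ℝ × Phase → ℝ}
    (hG : Integrable G) (hGA : ∀ p : ℝ × Phase, 1 ≤ p.2.1 →
      G p = A (p.1, p.2.2) * fderiv ℝ Ψ p ex) :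
    ∫ p in {p : ℝ × Phase | p.2.1 ∈ Ici (1 : ℝ)}, G p = -∫ q, A q * Ψ (q.1, 1, q.2) := by
  rw [setIntegral_x_mem hG.integrableOn, ← integral_neg]
  refine integral_congr_ae (Eventually.of_forall fun q => ?_)
  obtain ⟨h1, h2, h3⟩ := line_x hΨ hΨc q
  have : ∀ x ∈ Ici (1 : ℝ), G (q.1, x, q.2)
      = A q * deriv (fun x : ℝ => Ψ (q.1, x, q.2)) x := fun x hx => by
    rw [hGA (q.1, x, q.2) hx, h3]
  simp only
  rw [setIntegral_congr_fun measurableSet_Ici this, integral_const_mul,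
    integral_Ici_eq_integral_Ioi, h2.integral_Ioi_deriv_eq h1, mul_neg]

end OneDim

lemma setIntegral_slab {T : ℝ} {G : ℝ × Phase → ℝ} (hG : ∀ p, p.1 ∉ Ioo 0 T → G p = 0) :
    ∫ p in {p : ℝ × Phase | p.2.1 ∈ Ioo (0 : ℝ) 1}, G p = ∫ p in Ioo 0 T ×ˢ Theta, G p := by
  have h1 : (Ioo 0 T ×ˢ (Ioo (0 : ℝ) 1 ×ˢ (univ : Set (E2 × E3))) : Set (ℝ × Phase))
      =ᵐ[volume] (Ioo 0 T ×ˢ Theta : Set (ℝ × Phase)) := by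
    refine Measure.set_prod_ae_eq (ae_eq_refl _) ?_
    exact Measure.set_prod_ae_eq Ioo_ae_eq_Icc (ae_eq_refl _)
  rw [← setIntegral_congr_set h1]
  refine setIntegral_eq_of_subset_of_forall_sdiff_eq_zero (f := G)
    (measurableSet_x measurableSet_Ioo) ?_ ?_
  · rintro p ⟨_, h, _⟩
    exact h
  · rintro p ⟨h2, h3⟩
    refine hG p fun h4 => h3 ⟨h4, h2, mem_univ _⟩

/-! ### The weak formulation in the whole space -/

section Energy

variable {T α : ℝ} {B : E2 → ℝ} {E : ℝ → E2 → E2} {f : ℝ × Phase → ℝ}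
  {γ : Fin 2 → ℝ × E2 × E3 → ℝ}

/-- Beyond the walls, a trace times a weight that is controlled by `v_x` is square integrable. -/
lemma memLp_trace_mul {γ : ℝ × E2 × E3 → ℝ} (hγ : ∀ R, MemLp γ 2 (wallMeasure T R))
    {S : Set ℝ} (hS : MeasurableSet S) {w : ℝ × Phase → ℝ} (hw : Measurable w) {C R : ℝ}
    (hs : ∀ p, w p ≠ 0 → ‖p‖ ≤ R ∧ p.1 ∈ Ioo 0 T)
    (hout : ∀ p : ℝ × Phase, p.2.1 ∈ S → |w p| ≤ C * |p.2.2.2 0|) :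
    MemLp ({p : ℝ × Phase | p.2.1 ∈ S}.indicator fun p => γ (p.1, p.2.2) * w p) 2 volume := by
  have hu := memLp_vx_mul_trace_mul (T := T) (R := R) hγ (w := (wallSet T R).indicator 1)
    (measurable_one.indicator (measurableSet_wallSet T R)) (C := 1)
    (fun q => by by_cases hq : q ∈ wallSet T R <;> simp [hq])
    (fun q hq => by by_contra h; simp [h] at hq)
  have hu2 := memLp_comp_drop_x hu R
  have hvx : Measurable fun p : ℝ × Phase => p.2.2.2 0 := Continuous.measurable (by fun_prop)
  have heq : ({p : ℝ × Phase | p.2.1 ∈ S}.indicator fun p => γ (p.1, p.2.2) * w p)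
      = fun p => ((Icc (-R) R).indicator 1 p.2.1 * (p.2.2.2 0 * γ (p.1, p.2.2)
        * (wallSet T R).indicator 1 (p.1, p.2.2)))
        * ({p : ℝ × Phase | p.2.1 ∈ S}.indicator (fun p => w p / p.2.2.2 0) p) := by
    funext p
    by_cases hp : p.2.1 ∈ S
    · by_cases h0 : w p = 0
      · simp [h0, Set.indicator]
      · obtain ⟨h1, h2⟩ := hs p h0
        have hx : p.2.1 ∈ Icc (-R) R := by
          exact abs_le.mp (((norm_fst_le p.2).trans (norm_snd_le p)).trans h1)
        have hv : (p.1, p.2.2) ∈ wallSet T R := by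
          refine ⟨h2, mem_univ _, ?_⟩
          rw [mem_closedBall_zero_iff]
          exact (norm_snd_le p.2.2).trans (((norm_snd_le p.2).trans (norm_snd_le p)).trans h1)
        have hv0 : p.2.2.2 0 ≠ 0 := by
          intro h
          have := hout p hp
          rw [h] at this
          simp at this
          exact h0 this
        simp only [Set.indicator, mem_ofPred_eq, hp, if_true, hx, hv, Pi.one_apply]
        field_simp
    · simp [Set.indicator, hp]
  rw [heq]
  refine hu2.of_le_mul (c := |C|) (hu2.1.mul ((hw.div hvx).indicator
    (measurableSet_x hS)).aestronglyMeasurable) (Eventually.of_forall fun p => ?_)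
  rw [norm_mul, mul_comm]
  refine mul_le_mul_of_nonneg_right ?_ (norm_nonneg _)
  by_cases hp : p.2.1 ∈ S
  · by_cases hv0 : p.2.2.2 0 = 0
    · simp [Set.indicator, hv0]
    · simp only [Set.indicator, mem_ofPred_eq, hp, if_true, norm_div, Real.norm_eq_abs]
      rw [div_le_iff₀ (abs_pos.mpr hv0)]
      exact (hout p hp).trans (mul_le_mul_of_nonneg_right (le_abs_self C) (abs_nonneg _))
  · simp [Set.indicator, hp]

lemma memLp_extend_mul (hf : IsWeakTransport T α B E f γ) {w : ℝ × Phase → ℝ} (hw : Measurable w)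
    {C R : ℝ} (hC : ∀ p, |w p| ≤ C) (hs : ∀ p, w p ≠ 0 → ‖p‖ ≤ R ∧ p.1 ∈ Ioo 0 T)
    (hout : ∀ p : ℝ × Phase, p.2.1 ∉ Ioo (0 : ℝ) 1 → |w p| ≤ C * |p.2.2.2 0|) :
    MemLp (fun p => extend f γ p * w p) 2 volume := by
  have h0 := memLp_trace_mul (hf.trace 0) measurableSet_Iic hw hs
    (fun p (hp : p.2.1 ∈ Iic 0) => hout p fun h => not_lt.mpr hp h.1)
  have h1 := memLp_trace_mul (hf.trace 1) measurableSet_Ici hw hs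
    (fun p (hp : p.2.1 ∈ Ici 1) => hout p fun h => not_lt.mpr hp h.2)
  have hm : MeasurableSet (Ioo 0 T ×ˢ (Ioo (0 : ℝ) 1 ×ˢ (univ : Set (E2 × E3)))) :=
    measurableSet_Ioo.prod (measurableSet_Ioo.prod MeasurableSet.univ)
  have h2 : MemLp ((Ioo 0 T ×ˢ (Ioo (0 : ℝ) 1 ×ˢ (univ : Set (E2 × E3)))).indicator
      fun p => f p * w p) 2 volume := by
    rw [memLp_indicator_iff_restrict hm]
    have h3 : MemLp f 2 (volume.restrict (Ioo 0 T ×ˢ (Ioo (0 : ℝ) 1 ×ˢ univ))) :=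
      hf.memLp.mono_measure (Measure.restrict_mono
        (Set.prod_mono_right (Set.prod_mono_left Ioo_subset_Icc_self)) le_rfl)
    refine h3.of_le_mul (c := C) (h3.1.mul hw.aestronglyMeasurable)
      (Eventually.of_forall fun p => ?_)
    rw [norm_mul, mul_comm]
    exact mul_le_mul_of_nonneg_right (hC p) (norm_nonneg _)
  convert (h0.add h2).add h1 using 1
  funext p
  simp only [Pi.add_apply, Set.indicator, mem_ofPred_eq, mem_Iic, mem_Ici, extend, mem_prod,
    mem_univ, and_true]
  by_cases ha : p.2.1 ≤ 0
  · have hb : ¬ 1 ≤ p.2.1 := by linarith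
    have hc : p.2.1 ∉ Ioo (0 : ℝ) 1 := fun h => not_lt.mpr ha h.1
    simp [ha, hb, hc]
  · by_cases hb : p.2.1 < 1
    · have hc : p.2.1 ∈ Ioo (0 : ℝ) 1 := ⟨not_le.mp ha, hb⟩
      have hb' : ¬ 1 ≤ p.2.1 := not_le.mpr hb
      by_cases hw0 : w p = 0
      · simp [hw0]
      · simp [ha, hb, hb', hc, (hs p hw0).2]
    · have hc : p.2.1 ∉ Ioo (0 : ℝ) 1 := fun h => hb h.2
      simp [ha, hb, hc, not_lt.mp hb]

lemma extField_of_mem {p : ℝ × Phase} (hp : p.2.1 ∈ Ioo (0 : ℝ) 1) :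
    extField α B E p = field α B E p := by simp only [extField, hp, if_true]

lemma extField_of_notMem {p : ℝ × Phase} (hp : p.2.1 ∉ Ioo (0 : ℝ) 1) :
    extField α B E p = (α⁻¹ * p.2.2.2 0) • ex := by simp only [extField, hp, if_false]

/-- The derivative of a test function along the extended field is a weight to which
`memLp_extend_mul` applies. -/
lemma fderiv_extField_bounds {b M L : ℝ} (hB : Continuous B) (hb : ∀ ξ, |B ξ| ≤ b)
    (hE : IsRegularField M L E) {Ψ : ℝ × Phase → ℝ} (hΨ : ContDiff ℝ 1 Ψ)
    (hΨc : HasCompactSupport Ψ) (hΨt : tsupport Ψ ⊆ {p | p.1 ∈ Ioo 0 T}) (α : ℝ) :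
    Measurable (fun p => fderiv ℝ Ψ p (extField α B E p)) ∧
    ∃ C R : ℝ, (∀ p, |fderiv ℝ Ψ p (extField α B E p)| ≤ C) ∧
      (∀ p, fderiv ℝ Ψ p (extField α B E p) ≠ 0 → ‖p‖ ≤ R ∧ p.1 ∈ Ioo 0 T) ∧
      ∀ p : ℝ × Phase, p.2.1 ∉ Ioo (0 : ℝ) 1 →
        |fderiv ℝ Ψ p (extField α B E p)| ≤ C * |p.2.2.2 0| := by
  have hcont : Continuous (fderiv ℝ Ψ) := hΨ.continuous_fderiv (by norm_num)
  refine ⟨?_, ?_⟩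
  · exact (ContinuousLinearMap.measurable_apply₂ (𝕜 := ℝ)).comp
      (hcont.measurable.prodMk (measurable_extField hB hE))
  obtain ⟨D, hD⟩ := (hΨc.fderiv (𝕜 := ℝ)).exists_bound_of_continuous hcont
  have hD0 : 0 ≤ D := (norm_nonneg _).trans (hD 0)
  obtain ⟨R, hR⟩ := hΨc.isCompact.isBounded.exists_norm_le
  have hsupp : ∀ p, fderiv ℝ Ψ p ≠ 0 → p ∈ tsupport Ψ := fun p hp =>
    support_fderiv_subset ℝ hp
  set Q : ℝ := |α| + |α⁻¹| * R + R + (M + |α⁻¹| * (b * R)) with hQ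
  have hexn : ‖ex‖ ≤ 1 := by simp [ex, Prod.norm_def]
  have key : ∀ p, p.2.1 ∉ Ioo (0 : ℝ) 1 →
      |fderiv ℝ Ψ p (extField α B E p)| ≤ (D * |α⁻¹|) * |p.2.2.2 0| := by
    intro p hp
    rw [extField_of_notMem hp, map_smul, smul_eq_mul, abs_mul, abs_mul]
    have : |fderiv ℝ Ψ p ex| ≤ D := by
      refine ((fderiv ℝ Ψ p).le_opNorm _).trans ?_
      calc ‖fderiv ℝ Ψ p‖ * ‖ex‖ ≤ D * 1 := mul_le_mul (hD p) hexn (norm_nonneg _) hD0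
        _ = D := mul_one D
    nlinarith [mul_le_mul_of_nonneg_left this (mul_nonneg (abs_nonneg α⁻¹)
      (abs_nonneg (p.2.2.2 0)))]
  have hzero : ∀ p, fderiv ℝ Ψ p (extField α B E p) ≠ 0 → p ∈ tsupport Ψ := fun p hp =>
    hsupp p fun h => hp (by rw [h]; simp)
  refine ⟨max (D * Q) (max (D * |α⁻¹|) (D * |α⁻¹| * R)), R, ?_, ?_, ?_⟩
  · intro p
    by_cases h0 : fderiv ℝ Ψ p (extField α B E p) = 0
    · rw [h0, abs_zero]
      exact le_max_of_le_right (le_max_of_le_left (by positivity))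
    have hn := hR p (hzero p h0)
    have hv : ‖p.2.2.2‖ ≤ R := (norm_snd_le p.2.2).trans
      (((norm_snd_le p.2).trans (norm_snd_le p)).trans hn)
    by_cases hp : p.2.1 ∈ Ioo (0 : ℝ) 1
    · refine le_max_of_le_left ?_
      rw [extField_of_mem hp, ← Real.norm_eq_abs]
      refine ((fderiv ℝ Ψ p).le_opNorm _).trans ?_
      exact mul_le_mul (hD p) (norm_field_le hb hE hv) (norm_nonneg _) hD0
    · refine le_max_of_le_right (le_max_of_le_right ((key p hp).trans ?_))
      exact mul_le_mul_of_nonneg_left ((abs_coord_le _ _).trans hv) (by positivity)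
  · exact fun p hp => ⟨hR p (hzero p hp), hΨt (hzero p hp)⟩
  · intro p hp
    exact (key p hp).trans (mul_le_mul_of_nonneg_right
      (le_max_of_le_right (le_max_left _ _)) (abs_nonneg _))

/-- Square integrable functions that vanish off a ball are integrable. -/
lemma integrable_of_memLp_of_norm_le {u : ℝ × Phase → ℝ} (hu : MemLp u 2 volume) {R : ℝ}
    (hR : ∀ p, u p ≠ 0 → ‖p‖ ≤ R) : Integrable u := by
  have h1 : IntegrableOn u (Metric.closedBall 0 R) := by
    have : IsFiniteMeasure (volume.restrict (Metric.closedBall (0 : ℝ × Phase) R)) :=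
      isFiniteMeasure_restrict.mpr (isCompact_closedBall _ _).measure_lt_top.ne
    exact (hu.mono_measure Measure.restrict_le_self).integrable (by norm_num)
  refine (integrableOn_iff_integrable_of_support_subset fun p hp => ?_).mp h1
  rw [mem_closedBall_zero_iff]
  exact hR p hp

/-- The extended function is a weak solution in the whole space, without boundary terms: the
contributions of the regions beyond the walls are those of the traces. -/
lemma integral_extend_mul_fderiv_eq_zero {b M L : ℝ} (hB : Continuous B) (hb : ∀ ξ, |B ξ| ≤ b)
    (hE : IsRegularField M L E) (hf : IsWeakTransport T α B E f γ) {Ψ : ℝ × Phase → ℝ}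
    (hΨ : ContDiff ℝ 1 Ψ) (hΨc : HasCompactSupport Ψ)
    (hΨt : tsupport Ψ ⊆ {p | p.1 ∈ Ioo 0 T}) :
    ∫ p, extend f γ p * fderiv ℝ Ψ p (extField α B E p) = 0 := by
  obtain ⟨hm, C, R, h1, h2, h3⟩ := fderiv_extField_bounds hB hb hE hΨ hΨc hΨt α
  have hG : Integrable fun p => extend f γ p * fderiv ℝ Ψ p (extField α B E p) :=
    integrable_of_memLp_of_norm_le (memLp_extend_mul hf hm h1 h2 h3)
      (fun p hp => (h2 p (right_ne_zero_of_mul hp)).1)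
  have hwall : ∀ i : Fin 2, ∫ q in Ioo 0 T ×ˢ (univ : Set (E2 × E3)),
      normal i * q.2.2 0 * γ i q * Ψ (q.1, wall i, q.2.1, q.2.2)
      = normal i * ∫ q : ℝ × E2 × E3, q.2.2 0 * γ i q * Ψ (q.1, wall i, q.2) := by
    intro i
    rw [← integral_const_mul, setIntegral_eq_integral_of_forall_compl_eq_zero]
    · exact integral_congr_ae (Eventually.of_forall fun q => by simp only; ring)
    · intro q hq
      have : Ψ (q.1, wall i, q.2.1, q.2.2) = 0 := by
        refine image_eq_zero_of_notMem_tsupport fun h => hq ⟨hΨt h, mem_univ _⟩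
      rw [this, mul_zero]
  have hgreen := hf.green Ψ hΨ hΨc hΨt
  rw [Fin.sum_univ_two, hwall, hwall] at hgreen
  rw [integral_eq_add_walls hG,
    setIntegral_Iic_mul_fderiv_ex hΨ hΨc (A := fun q => α⁻¹ * (q.2.2 0 * γ 0 q)) hG (by
      intro p hp
      have hp' : p.2.1 ∉ Ioo (0 : ℝ) 1 := fun h => not_lt.mpr hp h.1
      simp only [extend, hp, if_true]
      rw [extField_of_notMem hp', map_smul, smul_eq_mul]
      ring),
    setIntegral_Ici_mul_fderiv_ex hΨ hΨc (A := fun q => α⁻¹ * (q.2.2 0 * γ 1 q)) hG (by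
      intro p hp
      have hp' : p.2.1 ∉ Ioo (0 : ℝ) 1 := fun h => not_lt.mpr hp h.2
      have h0 : ¬ p.2.1 ≤ 0 := by linarith
      simp only [extend, h0, if_false, not_lt.mpr hp]
      rw [extField_of_notMem hp', map_smul, smul_eq_mul]
      ring)]
  have hslab : ∫ p in {p : ℝ × Phase | p.2.1 ∈ Ioo (0 : ℝ) 1},
      extend f γ p * fderiv ℝ Ψ p (extField α B E p)
      = ∫ p in Ioo 0 T ×ˢ Theta, f p * fderiv ℝ Ψ p (field α B E p) := by
    rw [← setIntegral_slab (T := T) (G := fun p => f p * fderiv ℝ Ψ p (field α B E p))]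
    · refine setIntegral_congr_fun (measurableSet_x measurableSet_Ioo) fun p hp => ?_
      have h1 : ¬ p.2.1 ≤ 0 := not_le.mpr hp.1
      have h2 : p.2.1 < 1 := hp.2
      simp only [extend, h1, h2, if_true, if_false]
      rw [extField_of_mem hp]
    · intro p hp
      have : fderiv ℝ Ψ p = 0 := by
        by_contra h
        exact hp (hΨt (support_fderiv_subset ℝ h))
      simp [this]
  rw [hslab, hgreen]
  have hw0 : wall 0 = 0 := rfl
  have hw1 : wall 1 = 1 := rfl
  have hn0 : normal 0 = -1 := rfl
  have hn1 : normal 1 = 1 := rfl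
  simp only [hw0, hw1, hn0, hn1, mul_assoc, integral_const_mul]
  ring

end Energy

/-! ### Coefficients of the extended field -/

/-- `par` as a continuous linear map. -/
noncomputable def parL : E3 →L[ℝ] E2 := LinearMap.toContinuousLinearMap
  { toFun := par
    map_add' := fun v w => by ext i; fin_cases i <;> simp [par]
    map_smul' := fun c v => by ext i; fin_cases i <;> simp [par] }

/-- `lift` as a continuous linear map. -/
noncomputable def liftL : E2 →L[ℝ] E3 := LinearMap.toContinuousLinearMap
  { toFun := lift
    map_add' := fun v w => by ext i; fin_cases i <;> simp [lift]
    map_smul' := fun c v => by ext i; fin_cases i <;> simp [lift] }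

@[simp] lemma par_zero_apply (v : E3) : par v 0 = v 1 := rfl
@[simp] lemma par_one_apply (v : E3) : par v 1 = v 2 := rfl
@[simp] lemma lift_zero_apply (w : E2) : lift w 0 = 0 := rfl
@[simp] lemma lift_one_apply (w : E2) : lift w 1 = w 0 := rfl
@[simp] lemma lift_two_apply (w : E2) : lift w 2 = w 1 := rfl
@[simp] lemma crossB_zero_apply (v : E3) (b : ℝ) : crossB v b 0 = 0 := rfl
@[simp] lemma crossB_one_apply (v : E3) (b : ℝ) : crossB v b 1 = v 2 * b := rfl
@[simp] lemma crossB_two_apply (v : E3) (b : ℝ) : crossB v b 2 = -(v 1 * b) := rfl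

@[simp] lemma par_lift (w : E2) : par (lift w) = w := by
  ext i; fin_cases i <;> simp

lemma par_sub (v w : E3) : par (v - w) = par v - par w := map_sub parL v w

@[simp] lemma par_zero : par 0 = 0 := map_zero parL

@[simp] lemma lift_zero : lift 0 = 0 := map_zero liftL

/-- The variables `x` and `v_x`. -/
noncomputable def projX : ℝ × Phase →L[ℝ] ℝ × Phase :=
  (0 : ℝ × Phase →L[ℝ] ℝ).prod
    (((ContinuousLinearMap.fst ℝ ℝ (E2 × E3)).comp (ContinuousLinearMap.snd ℝ ℝ Phase)).prod
      ((0 : ℝ × Phase →L[ℝ] E2).prod ((ContinuousLinearMap.id ℝ E3 - liftL.comp parL).comp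
        ((ContinuousLinearMap.snd ℝ E2 E3).comp ((ContinuousLinearMap.snd ℝ ℝ (E2 × E3)).comp
          (ContinuousLinearMap.snd ℝ ℝ Phase))))))

/-- The variable `t`. -/
noncomputable def projT : ℝ × Phase →L[ℝ] ℝ × Phase :=
  (ContinuousLinearMap.fst ℝ ℝ Phase).prod 0

/-- The variables `ξ` and `(v_y, v_z)`. -/
noncomputable def projXi : ℝ × Phase →L[ℝ] ℝ × Phase :=
  (0 : ℝ × Phase →L[ℝ] ℝ).prod
    ((0 : ℝ × Phase →L[ℝ] ℝ).prod
      (((ContinuousLinearMap.fst ℝ E2 E3).comp ((ContinuousLinearMap.snd ℝ ℝ (E2 × E3)).comp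
          (ContinuousLinearMap.snd ℝ ℝ Phase))).prod ((liftL.comp parL).comp
        ((ContinuousLinearMap.snd ℝ E2 E3).comp ((ContinuousLinearMap.snd ℝ ℝ (E2 × E3)).comp
          (ContinuousLinearMap.snd ℝ ℝ Phase))))))

lemma projX_apply (z : ℝ × Phase) :
    projX z = (0, z.2.1, 0, z.2.2.2 - lift (par z.2.2.2)) := rfl

lemma projT_apply (z : ℝ × Phase) : projT z = (z.1, 0) := rfl

lemma projXi_apply (z : ℝ × Phase) : projXi z = (0, 0, z.2.2.1, lift (par z.2.2.2)) := rfl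

/-- The unit vector of the time axis. -/
def et : ℝ × Phase := (1, 0, 0, 0)

/-- The unit vectors of the axes of `ξ` and of `(v_y, v_z)`. -/
noncomputable def ePar : Fin 2 ⊕ Fin 2 → ℝ × Phase
  | .inl i => (0, 0, EuclideanSpace.single i 1, 0)
  | .inr i => (0, 0, 0, lift (EuclideanSpace.single i 1))

/-- The components of the extended field along `ePar`. -/
noncomputable def coefPar (α : ℝ) (B : E2 → ℝ) (E : ℝ → E2 → E2) :
    Fin 2 ⊕ Fin 2 → ℝ × Phase → ℝ
  | .inl i, p => (Ioo (0 : ℝ) 1).indicator 1 p.2.1 * par p.2.2.2 i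
  | .inr i, p => (Ioo (0 : ℝ) 1).indicator 1 p.2.1
      * (E p.1 p.2.2.1 i - α⁻¹ * par (crossB p.2.2.2 (B p.2.2.1)) i)

lemma extField_eq_sum (α : ℝ) (B : E2 → ℝ) (E : ℝ → E2 → E2) (p : ℝ × Phase) :
    extField α B E p = (α⁻¹ * p.2.2.2 0) • ex
      + ((Ioo (0 : ℝ) 1).indicator 1 p.2.1 * α) • et + ∑ j, coefPar α B E j p • ePar j := by
  by_cases hp : p.2.1 ∈ Ioo (0 : ℝ) 1
  · rw [extField_of_mem hp]
    simp only [Fintype.sum_sum_type, Fin.sum_univ_two, coefPar, ePar, ex, et, field,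
      Set.indicator_of_mem hp, Pi.one_apply, one_mul]
    refine Prod.ext (by simp) (Prod.ext (by simp) (Prod.ext ?_ ?_))
    · ext i; fin_cases i <;> simp
    · ext i; fin_cases i <;> simp
  · rw [extField_of_notMem hp]
    simp [Fintype.sum_sum_type, coefPar, Set.indicator_of_notMem hp]

lemma coefPar_add_smul (α : ℝ) (B : E2 → ℝ) (E : ℝ → E2 → E2) (j : Fin 2 ⊕ Fin 2)
    (p : ℝ × Phase) (s : ℝ) : coefPar α B E j (p + s • ePar j) = coefPar α B E j p := by
  rcases j with i | i
  · simp [coefPar, ePar]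
  · fin_cases i <;> simp [coefPar, ePar]

lemma measurable_coefPar {α : ℝ} {B : E2 → ℝ} (hB : Continuous B) {E : ℝ → E2 → E2} {M L : ℝ}
    (hE : IsRegularField M L E) (j : Fin 2 ⊕ Fin 2) : Measurable (coefPar α B E j) := by
  have hi : Measurable fun p : ℝ × Phase => (Ioo (0 : ℝ) 1).indicator (1 : ℝ → ℝ) p.2.1 :=
    (measurable_one.indicator measurableSet_Ioo).comp (measurable_fst.comp measurable_snd)
  rcases j with i | i
  · have h1 : Continuous fun p : ℝ × Phase => par p.2.2.2 :=
      continuous_par.comp (by fun_prop)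
    exact hi.mul (Continuous.measurable (f := fun p : ℝ × Phase => par p.2.2.2 i) (by fun_prop))
  · have h1 : Measurable fun p : ℝ × Phase => E p.1 p.2.2.1 :=
      hE.measurable.comp (Continuous.measurable
        (f := fun p : ℝ × Phase => (p.1, p.2.2.1)) (by fun_prop))
    have h2 : Continuous fun p : ℝ × Phase => par (crossB p.2.2.2 (B p.2.2.1)) :=
      continuous_par.comp (continuous_crossB.comp
        (f := fun p : ℝ × Phase => (p.2.2.2, B p.2.2.1)) (by fun_prop))
    have h3 : Measurable fun p : ℝ × Phase => E p.1 p.2.2.1 i :=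
      (Continuous.measurable (f := fun w : E2 => w i) (by fun_prop)).comp h1
    have h4 : Measurable fun p : ℝ × Phase => par (crossB p.2.2.2 (B p.2.2.1)) i :=
      Continuous.measurable (by fun_prop)
    exact hi.mul (h3.sub (h4.const_mul _))

lemma abs_indicator_one_le (S : Set ℝ) (x : ℝ) : |S.indicator (1 : ℝ → ℝ) x| ≤ 1 := by
  by_cases h : x ∈ S <;> simp [h]

lemma abs_coefPar_le {α b M L R : ℝ} {B : E2 → ℝ} {E : ℝ → E2 → E2} (hb : ∀ ξ, |B ξ| ≤ b)
    (hE : IsRegularField M L E) (j : Fin 2 ⊕ Fin 2) {p : ℝ × Phase} (hp : ‖p.2.2.2‖ ≤ R) :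
    |coefPar α B E j p| ≤ R + (M + |α⁻¹| * (b * R)) := by
  have hR : 0 ≤ R := (norm_nonneg _).trans hp
  have hM : 0 ≤ M := (norm_nonneg _).trans (hE.bound 0 0)
  have hb0 : 0 ≤ b := (abs_nonneg _).trans (hb 0)
  have h2 : 0 ≤ |α⁻¹| * (b * R) := by positivity
  rcases j with i | i
  · simp only [coefPar, abs_mul]
    calc _ ≤ 1 * R := mul_le_mul (abs_indicator_one_le _ _)
          ((abs_coord_le' _ _).trans ((norm_par_le _).trans hp)) (abs_nonneg _) zero_le_one
      _ ≤ _ := by linarith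
  · simp only [coefPar, abs_mul]
    have h3 : |E p.1 p.2.2.1 i - α⁻¹ * par (crossB p.2.2.2 (B p.2.2.1)) i|
        ≤ M + |α⁻¹| * (b * R) := by
      refine (abs_sub _ _).trans (add_le_add ((abs_coord_le' _ _).trans (hE.bound _ _)) ?_)
      rw [abs_mul]
      refine mul_le_mul_of_nonneg_left ((abs_coord_le' _ _).trans ((norm_par_le _).trans
        ((norm_crossB_le _ _).trans ?_))) (abs_nonneg _)
      exact mul_le_mul (hb _) hp (norm_nonneg _) hb0
    calc _ ≤ 1 * (M + |α⁻¹| * (b * R)) := mul_le_mul (abs_indicator_one_le _ _) h3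
          (abs_nonneg _) zero_le_one
      _ ≤ _ := by linarith

lemma abs_coefPar_sub_le {α b M L R : ℝ} {B : E2 → ℝ} {E : ℝ → E2 → E2} (hb : ∀ ξ, |B ξ| ≤ b)
    (hbL : ∀ ξ ξ', |B ξ - B ξ'| ≤ b * ‖ξ - ξ'‖) (hE : IsRegularField M L E) (hL : 0 ≤ L)
    (j : Fin 2 ⊕ Fin 2) {p : ℝ × Phase} (hp : ‖p.2.2.2‖ ≤ R) (z : ℝ × Phase) :
    |coefPar α B E j p - coefPar α B E j (p - projXi z)|
      ≤ (1 + L + |α⁻¹| * (R * b + b)) * ‖projXi z‖ := by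
  have hR : 0 ≤ R := (norm_nonneg _).trans hp
  have hb0 : 0 ≤ b := (abs_nonneg _).trans (hb 0)
  have hx : (p - projXi z).2.1 = p.2.1 := by simp [projXi_apply]
  have ht : (p - projXi z).1 = p.1 := by simp [projXi_apply]
  have hξ : (p - projXi z).2.2.1 = p.2.2.1 - z.2.2.1 := by simp [projXi_apply]
  have hv : (p - projXi z).2.2.2 = p.2.2.2 - lift (par z.2.2.2) := by simp [projXi_apply]
  set N := ‖projXi z‖ with hN
  have hN0 : 0 ≤ N := norm_nonneg _
  have hn1 : ‖z.2.2.1‖ ≤ N := by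
    exact (norm_fst_le (projXi z).2.2).trans ((norm_snd_le _).trans (norm_snd_le (projXi z)))
  have hn2 : ‖par z.2.2.2‖ ≤ N := by
    have := (norm_snd_le (projXi z).2.2).trans ((norm_snd_le _).trans (norm_snd_le (projXi z)))
    rw [projXi_apply] at this
    simpa only [norm_lift_eq, ← projXi_apply] using this
  have hpl : par (p.2.2.2 - lift (par z.2.2.2)) = par p.2.2.2 - par z.2.2.2 := by
    rw [par_sub, par_lift]
  have hq : 0 ≤ |α⁻¹| * (R * b + b) * N := by positivity
  have hq2 : 0 ≤ L * N := by positivity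
  rcases j with i | i
  · simp only [coefPar, hx, hv, hpl]
    rw [← mul_sub, abs_mul]
    calc _ ≤ 1 * N := by
          refine mul_le_mul (abs_indicator_one_le _ _) ?_ (abs_nonneg _) zero_le_one
          simpa using (abs_coord_le' (par z.2.2.2) i).trans hn2
      _ ≤ _ := by linarith
  · simp only [coefPar, hx, hv, ht, hξ]
    rw [← mul_sub, abs_mul]
    have hE1 : |E p.1 p.2.2.1 i - E p.1 (p.2.2.1 - z.2.2.1) i| ≤ L * N := by
      have h1 := abs_coord_le' (E p.1 p.2.2.1 - E p.1 (p.2.2.1 - z.2.2.1)) i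
      have h2 := hE.lip p.1 p.2.2.1 (p.2.2.1 - z.2.2.1)
      rw [sub_sub_cancel] at h2
      exact h1.trans (h2.trans (mul_le_mul_of_nonneg_left hn1 hL))
    have hB1 : ∀ s s' : ℝ, |s| ≤ R → |s - s'| ≤ N →
        |s * B p.2.2.1 - s' * B (p.2.2.1 - z.2.2.1)| ≤ (R * b + b) * N := by
      intro s s' hs hss
      have h2 := hbL p.2.2.1 (p.2.2.1 - z.2.2.1)
      rw [sub_sub_cancel] at h2
      have h3 : s * B p.2.2.1 - s' * B (p.2.2.1 - z.2.2.1)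
          = s * (B p.2.2.1 - B (p.2.2.1 - z.2.2.1)) + (s - s') * B (p.2.2.1 - z.2.2.1) := by ring
      rw [h3]
      refine (abs_add_le _ _).trans ?_
      rw [abs_mul, abs_mul]
      have h4 : |s| * |B p.2.2.1 - B (p.2.2.1 - z.2.2.1)| ≤ R * (b * N) :=
        mul_le_mul hs (h2.trans (mul_le_mul_of_nonneg_left hn1 hb0)) (abs_nonneg _) hR
      have h5 : |s - s'| * |B (p.2.2.1 - z.2.2.1)| ≤ N * b :=
        mul_le_mul hss (hb _) (abs_nonneg _) hN0
      nlinarith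
    have hc : |par (crossB p.2.2.2 (B p.2.2.1)) i
        - par (crossB (p.2.2.2 - lift (par z.2.2.2)) (B (p.2.2.1 - z.2.2.1))) i|
        ≤ (R * b + b) * N := by
      have k1 := hB1 (p.2.2.2 1) ((p.2.2.2 - lift (par z.2.2.2)) 1)
        ((abs_coord_le _ _).trans hp) (by
          simpa using (abs_coord_le' (par z.2.2.2) 0).trans hn2)
      have k2 := hB1 (p.2.2.2 2) ((p.2.2.2 - lift (par z.2.2.2)) 2)
        ((abs_coord_le _ _).trans hp) (by
          simpa using (abs_coord_le' (par z.2.2.2) 1).trans hn2)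
      fin_cases i
      · simpa using k2
      · rw [← abs_neg, neg_sub] at k1
        simpa [neg_add_eq_sub] using k1
    calc _ ≤ 1 * (L * N + |α⁻¹| * ((R * b + b) * N)) := by
          refine mul_le_mul (abs_indicator_one_le _ _) ?_ (abs_nonneg _) zero_le_one
          rw [sub_sub_sub_comm, ← mul_sub]
          refine (abs_sub _ _).trans (add_le_add hE1 ?_)
          rw [abs_mul]
          exact mul_le_mul_of_nonneg_left hc (abs_nonneg _)
      _ ≤ _ := by nlinarith

/-! ### The energy identity -/

section Energy

variable {T α b M L : ℝ} {B : E2 → ℝ} {E : ℝ → E2 → E2} {f : ℝ × Phase → ℝ}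
  {γ : Fin 2 → ℝ × E2 × E3 → ℝ}

/-- A renormalized weak formulation: the extended function `F` satisfies `∫ F² X(η²) = 0` for the
extended field `X`, by the renormalization theorem for `g = η F`. The weight vanishes at `v_x = 0`,
where the traces need not be square integrable. The groups of variables are `(x, v_x)`, in which
the coefficients are linear, `t`, and `(ξ, v_y, v_z)`, in which they are Lipschitz. -/
lemma integral_extend_sq_mul_fderiv_eq_zero (hB : Continuous B) (hb : ∀ ξ, |B ξ| ≤ b)
    (hbL : ∀ ξ ξ', |B ξ - B ξ'| ≤ b * ‖ξ - ξ'‖) (hE : IsRegularField M L E) (hL : 0 ≤ L)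
    (hf : IsWeakTransport T α B E f γ) {η : ℝ × Phase → ℝ}
    (hη : ContDiff ℝ 1 η) (hηc : HasCompactSupport η) (hηt : tsupport η ⊆ {p | p.1 ∈ Ioo 0 T})
    {Cη : ℝ} (hηv : ∀ p, |η p| ≤ Cη * |p.2.2.2 0|) :
    (Integrable fun p => extend f γ p * η p * (extend f γ p * fderiv ℝ η p (extField α B E p))) ∧
    ∫ p, extend f γ p * η p * (extend f γ p * fderiv ℝ η p (extField α B E p)) = 0 := by
  obtain ⟨R, hR⟩ := hηc.isCompact.isBounded.exists_norm_le
  obtain ⟨D, hD⟩ := hηc.exists_bound_of_continuous hη.continuous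
  have hD0 : 0 ≤ D := (norm_nonneg _).trans (hD 0)
  have hsupp : ∀ p, η p ≠ 0 → ‖p‖ ≤ R ∧ p.1 ∈ Ioo 0 T := fun p hp =>
    ⟨hR p (subset_tsupport _ hp), hηt (subset_tsupport _ hp)⟩
  have hvR : ∀ p, η p ≠ 0 → ‖p.2.2.2‖ ≤ R := fun p hp => (norm_snd_le p.2.2).trans
      (((norm_snd_le p.2).trans (norm_snd_le p)).trans (hsupp p hp).1)
  -- weights `η c` with a coefficient `c` that is bounded on the support of `η`
  have hmul : ∀ {c : ℝ × Phase → ℝ}, Measurable c → (∃ Q, ∀ p, ‖p.2.2.2‖ ≤ R → |c p| ≤ Q) →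
      MemLp (fun p => extend f γ p * η p * c p) 2 volume := by
    rintro c hc ⟨Q, hQ⟩
    have hb1 : ∀ p, |η p * c p| ≤ |η p| * |Q| := by
      intro p
      by_cases h0 : η p = 0
      · simp [h0]
      · rw [abs_mul]
        exact mul_le_mul_of_nonneg_left ((hQ p (hvR p h0)).trans (le_abs_self Q)) (abs_nonneg _)
    have := memLp_extend_mul hf (w := fun p => η p * c p) (hη.continuous.measurable.mul hc)
      (C := max (D * |Q|) (Cη * |Q|)) (R := R)
      (fun p => (hb1 p).trans (le_max_of_le_left
        (mul_le_mul_of_nonneg_right (hD p) (abs_nonneg _))))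
      (fun p hp => hsupp p (left_ne_zero_of_mul hp))
      (fun p _ => by
        refine (hb1 p).trans ((mul_le_mul_of_nonneg_right (hηv p) (abs_nonneg Q)).trans ?_)
        rw [mul_right_comm]
        exact mul_le_mul_of_nonneg_right (le_max_right _ _) (abs_nonneg _))
    simpa only [mul_assoc] using this
  have hg : MemLp (fun p => extend f γ p * η p) 2 volume := by
    simpa using hmul measurable_const (c := fun _ => 1) ⟨1, by simp⟩
  obtain ⟨hm, C', R', h1, h2, h3⟩ := fderiv_extField_bounds hB hb hE hη hηc hηt α
  have hh : MemLp (fun p => extend f γ p * fderiv ℝ η p (extField α B E p)) 2 volume :=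
    memLp_extend_mul hf hm h1 h2 h3
  have hi : Measurable fun p : ℝ × Phase => (Ioo (0 : ℝ) 1).indicator (1 : ℝ → ℝ) p.2.1 :=
    (measurable_one.indicator measurableSet_Ioo).comp (measurable_fst.comp measurable_snd)
  refine ⟨hg.integrable_mul hh, ?_⟩
  refine integral_mul_eq_zero_of_weak_transport (μ := volume) (P₁ := projX) (P₂ := projT)
    (P₃ := projXi) (e₁ := ex) (e₂ := et) (e := ePar) (c₁ := fun p => α⁻¹ * p.2.2.2 0)
    (c₂ := fun p => (Ioo (0 : ℝ) 1).indicator 1 p.2.1 * α) (c := coefPar α B E)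
    (ℓ := α⁻¹ • ((EuclideanSpace.proj (0 : Fin 3)).comp ((ContinuousLinearMap.snd ℝ E2 E3).comp
      ((ContinuousLinearMap.snd ℝ ℝ (E2 × E3)).comp (ContinuousLinearMap.snd ℝ ℝ Phase)))))
    (L := 1 + L + |α⁻¹| * (R * b + b))
    hg hηc.mul_left hh ?_ ?_ ?_ ?_ ?_ ?_ ?_ ?_ ?_ ?_ ?_ ?_
    (fun j => hmul (measurable_coefPar hB hE j)
      ⟨R + (M + |α⁻¹| * (b * R)), fun p hp => abs_coefPar_le hb hE j hp⟩)
    (measurable_coefPar hB hE) ?_ ?_ ?_ (coefPar_add_smul α B E) ?_ ?_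
  · intro z
    simp [projX_apply, projT_apply, projXi_apply]
  · intro z
    simp [projX_apply, par_sub]
  · intro z
    simp [projX_apply, projT_apply]
  · intro z
    simp [projX_apply, projXi_apply]
  · intro z
    simp [projX_apply, projT_apply]
  · intro z
    simp [projT_apply]
  · intro z
    simp [projXi_apply, projT_apply]
  · simp [projX_apply, ex]
  · rw [projT_apply, et]
    rfl
  · rintro (i | i)
    · simp [projXi_apply, ePar]
    · simp [projXi_apply, ePar]
  · refine hmul (Continuous.measurable (by fun_prop)) ⟨|α⁻¹| * R, fun p hp => ?_⟩
    rw [abs_mul]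
    exact mul_le_mul_of_nonneg_left ((abs_coord_le _ _).trans hp) (abs_nonneg _)
  · refine hmul (hi.mul_const α) ⟨1 * |α|, fun p _ => ?_⟩
    rw [abs_mul]
    exact mul_le_mul_of_nonneg_right (abs_indicator_one_le _ _) (abs_nonneg _)
  · intro p z
    simp [projX_apply]
    ring
  · simp [ex]
  · intro p z hz
    have : z.2.1 = 0 := by
      have := congrArg (fun q => q.2.1) hz
      simpa [projX_apply] using this
    simp [this]
  · intro j p z hp
    exact abs_coefPar_sub_le hb hbL hE hL j (hvR p (right_ne_zero_of_mul hp)) z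
  · intro ψ hψ hψc
    have hηψ : ContDiff ℝ 1 fun p => η p * ψ p := hη.mul hψ
    have hz := integral_extend_mul_fderiv_eq_zero hB hb hE hf hηψ hηc.mul_right
      ((tsupport_mul_subset_left).trans hηt)
    have hfd : ∀ p v, fderiv ℝ (fun p => η p * ψ p) p v
        = η p * fderiv ℝ ψ p v + ψ p * fderiv ℝ η p v := by
      intro p v
      have := ((hη.differentiable (by norm_num)) p).hasFDerivAt.mul
        ((hψ.differentiable (by norm_num)) p).hasFDerivAt
      have h4 : fderiv ℝ (fun p => η p * ψ p) p = _ := this.fderiv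
      rw [h4]
      simp
    have hψL : MemLp ψ 2 volume := hψ.continuous.memLp_of_hasCompactSupport hψc
    have i2 : Integrable fun p => extend f γ p * fderiv ℝ η p (extField α B E p) * ψ p :=
      hh.integrable_mul hψL
    have hηψt : tsupport (fun p => η p * ψ p) ⊆ {p | p.1 ∈ Ioo 0 T} :=
      (tsupport_mul_subset_left).trans hηt
    obtain ⟨hm', C'', R'', k1, k2, k3⟩ :=
      fderiv_extField_bounds hB hb hE hηψ hηc.mul_right hηψt α
    have i1 : Integrable fun p =>
        extend f γ p * fderiv ℝ (fun p => η p * ψ p) p (extField α B E p) :=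
      integrable_of_memLp_of_norm_le (memLp_extend_mul hf hm' k1 k2 k3)
        (fun p hp => (k2 p (right_ne_zero_of_mul hp)).1)
    have heq : ∀ p, extend f γ p * η p * (α⁻¹ * p.2.2.2 0 * fderiv ℝ ψ p ex
        + (Ioo (0 : ℝ) 1).indicator 1 p.2.1 * α * fderiv ℝ ψ p et
        + ∑ j, coefPar α B E j p * fderiv ℝ ψ p (ePar j))
        = extend f γ p * fderiv ℝ (fun p => η p * ψ p) p (extField α B E p)
          - extend f γ p * fderiv ℝ η p (extField α B E p) * ψ p := by
      intro p
      have : fderiv ℝ ψ p (extField α B E p) = α⁻¹ * p.2.2.2 0 * fderiv ℝ ψ p ex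
          + (Ioo (0 : ℝ) 1).indicator 1 p.2.1 * α * fderiv ℝ ψ p et
          + ∑ j, coefPar α B E j p * fderiv ℝ ψ p (ePar j) := by
        rw [extField_eq_sum]
        simp only [map_add, map_smul, map_sum, smul_eq_mul]
      rw [← this, hfd]
      ring
    simp_rw [heq]
    rw [integral_sub i1 i2, hz, zero_sub]

/-- The energy identity for a weight `η²`: beyond the walls the extended function does not depend
on `x`, so that the integrals over these regions reduce to integrals over the walls. -/
lemma energy_identity (hB : Continuous B) (hb : ∀ ξ, |B ξ| ≤ b)
    (hbL : ∀ ξ ξ', |B ξ - B ξ'| ≤ b * ‖ξ - ξ'‖) (hE : IsRegularField M L E) (hL : 0 ≤ L)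
    (hα : α ≠ 0) (hf : IsWeakTransport T α B E f γ) {η : ℝ × Phase → ℝ}
    (hη : ContDiff ℝ 1 η) (hηc : HasCompactSupport η) (hηt : tsupport η ⊆ {p | p.1 ∈ Ioo 0 T})
    {Cη : ℝ} (hηv : ∀ p, |η p| ≤ Cη * |p.2.2.2 0|) :
    2 * α * ∫ p in Ioo 0 T ×ˢ Theta, f p ^ 2 * (η p * fderiv ℝ η p (field α B E p))
      = ∑ i, normal i * ∫ q : ℝ × E2 × E3, q.2.2 0 * γ i q ^ 2 * η (q.1, wall i, q.2) ^ 2 := by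
  obtain ⟨hG, hz⟩ := integral_extend_sq_mul_fderiv_eq_zero hB hb hbL hE hL hf hη hηc hηt hηv
  have hη2 : ContDiff ℝ 1 fun p => η p ^ 2 := hη.pow 2
  have hη2c : HasCompactSupport fun p => η p ^ 2 := by
    have h : (fun p => η p ^ 2) = η * η := funext fun p => sq (η p)
    rw [h]
    exact hηc.mul_right
  have hfd : ∀ p v, fderiv ℝ (fun p => η p ^ 2) p v = 2 * η p * fderiv ℝ η p v := by
    intro p v
    have h4 := ((hη.differentiable (by norm_num)) p).hasFDerivAt.pow 2
    rw [h4.fderiv]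
    simp
  rw [integral_eq_add_walls hG,
    setIntegral_Iic_mul_fderiv_ex hη2 hη2c (A := fun q => 2⁻¹ * α⁻¹ * (q.2.2 0 * γ 0 q ^ 2)) hG (by
      intro p hp
      have hp' : p.2.1 ∉ Ioo (0 : ℝ) 1 := fun h => not_lt.mpr hp h.1
      simp only [extend, hp, if_true]
      rw [extField_of_notMem hp', map_smul, smul_eq_mul, hfd]
      ring),
    setIntegral_Ici_mul_fderiv_ex hη2 hη2c (A := fun q => 2⁻¹ * α⁻¹ * (q.2.2 0 * γ 1 q ^ 2)) hG (by
      intro p hp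
      have hp' : p.2.1 ∉ Ioo (0 : ℝ) 1 := fun h => not_lt.mpr hp h.2
      have h0 : ¬ p.2.1 ≤ 0 := by linarith
      simp only [extend, h0, if_false, not_lt.mpr hp]
      rw [extField_of_notMem hp', map_smul, smul_eq_mul, hfd]
      ring)] at hz
  have hslab : ∫ p in {p : ℝ × Phase | p.2.1 ∈ Ioo (0 : ℝ) 1},
      extend f γ p * η p * (extend f γ p * fderiv ℝ η p (extField α B E p))
      = ∫ p in Ioo 0 T ×ˢ Theta, f p ^ 2 * (η p * fderiv ℝ η p (field α B E p)) := by
    rw [← setIntegral_slab (T := T)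
      (G := fun p => f p ^ 2 * (η p * fderiv ℝ η p (field α B E p)))]
    · refine setIntegral_congr_fun (measurableSet_x measurableSet_Ioo) fun p hp => ?_
      have h1 : ¬ p.2.1 ≤ 0 := not_le.mpr hp.1
      have h2 : p.2.1 < 1 := hp.2
      simp only [extend, h1, h2, if_true, if_false]
      rw [extField_of_mem hp]
      ring
    · intro p hp
      have : η p = 0 := image_eq_zero_of_notMem_tsupport fun h => hp (hηt h)
      simp [this]
  rw [hslab] at hz
  have hw0 : wall 0 = 0 := rfl
  have hw1 : wall 1 = 1 := rfl
  have hn0 : normal 0 = -1 := rfl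
  have hn1 : normal 1 = 1 := rfl
  rw [Fin.sum_univ_two, hw0, hw1, hn0, hn1]
  simp only [mul_assoc, integral_const_mul] at hz ⊢
  have h5 : α * α⁻¹ = 1 := mul_inv_cancel₀ hα
  linear_combination 2 * α * hz - (∫ q : ℝ × E2 × E3, q.2.2 0 * (γ 0 q ^ 2
    * η (q.1, 0, q.2) ^ 2)) * h5 + (∫ q : ℝ × E2 × E3, q.2.2 0 * (γ 1 q ^ 2
    * η (q.1, 1, q.2) ^ 2)) * h5

end Energy

/-! ### Uniform bounds for the traces -/

/-- A cutoff in `(t, ξ, v)`, supported in `0 < t < T`, that depends on `v` only through `|v|²`. -/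
structure IsRadialCutoff (T : ℝ) (χ : ℝ × E2 × E3 → ℝ) : Prop where
  contDiff : ContDiff ℝ 1 χ
  compact : HasCompactSupport χ
  time : tsupport χ ⊆ {q | q.1 ∈ Ioo 0 T}
  le_one : ∀ q, |χ q| ≤ 1
  radial : ∃ h : ℝ × E2 × ℝ → ℝ, ContDiff ℝ 1 h ∧ ∀ q, χ q = h (q.1, q.2.1, ‖q.2.2‖ ^ 2)

/-- The magnetic field rotates the velocity, so it does not change a radial function. -/
lemma IsRadialCutoff.fderiv_crossB {T : ℝ} {χ : ℝ × E2 × E3 → ℝ} (hχ : IsRadialCutoff T χ)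
    (q : ℝ × E2 × E3) (b : ℝ) : fderiv ℝ χ q (0, 0, crossB q.2.2 b) = 0 := by
  obtain ⟨h, hh, hq⟩ := hχ.radial
  have heq : χ = fun q => h (q.1, q.2.1, ‖q.2.2‖ ^ 2) := funext hq
  have h1 : HasFDerivAt (fun q : ℝ × E2 × E3 => ((q.1, q.2.1, ‖q.2.2‖ ^ 2) : ℝ × E2 × ℝ)) _ q :=
    (ContinuousLinearMap.fst ℝ ℝ (E2 × E3)).hasFDerivAt.prodMk
      (((ContinuousLinearMap.fst ℝ E2 E3).comp
        (ContinuousLinearMap.snd ℝ ℝ (E2 × E3))).hasFDerivAt.prodMk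
        (((ContinuousLinearMap.snd ℝ E2 E3).comp
          (ContinuousLinearMap.snd ℝ ℝ (E2 × E3))).hasFDerivAt.norm_sq))
  have h2 := ((hh.differentiable (by norm_num)) (q.1, q.2.1, ‖q.2.2‖ ^ 2)).hasFDerivAt.comp q h1
  rw [heq, show (fun q : ℝ × E2 × E3 => h (q.1, q.2.1, ‖q.2.2‖ ^ 2))
    = h ∘ fun q => (q.1, q.2.1, ‖q.2.2‖ ^ 2) from rfl, h2.fderiv]
  have h4 : inner ℝ q.2.2 (crossB q.2.2 b) = 0 := by
    simp only [PiLp.inner_apply, Fin.sum_univ_three, crossB_zero_apply, crossB_one_apply,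
      crossB_two_apply]
    simp
    ring
  simp only [ContinuousLinearMap.comp_apply, ContinuousLinearMap.prod_apply, smul_apply]
  simp only [ContinuousLinearMap.coe_fst', ContinuousLinearMap.coe_snd', innerSL_apply_apply, h4,
    smul_zero]
  exact map_zero _

/-- A smooth cutoff in `x` that is one near the slab. -/
noncomputable def xCut (x : ℝ) : ℝ := Real.smoothTransition (2 + x) * Real.smoothTransition (3 - x)

lemma xCut_contDiff : ContDiff ℝ 1 xCut := by
  unfold xCut
  exact (Real.smoothTransition.contDiff.comp (by fun_prop)).mul
    (Real.smoothTransition.contDiff.comp (by fun_prop))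

lemma xCut_eq_one {x : ℝ} (h : x ∈ Icc (-1 : ℝ) 2) : xCut x = 1 := by
  rw [xCut, Real.smoothTransition.one_of_one_le (by linarith [h.1]),
    Real.smoothTransition.one_of_one_le (by linarith [h.2]), one_mul]

lemma xCut_eq_zero {x : ℝ} (h : x ∉ Icc (-2 : ℝ) 3) : xCut x = 0 := by
  rw [xCut]
  by_cases h1 : -2 ≤ x
  · have : 3 < x := by
      by_contra h2
      exact h ⟨h1, not_lt.mp h2⟩
    rw [Real.smoothTransition.zero_of_nonpos (x := 3 - x) (by linarith), mul_zero]
  · rw [Real.smoothTransition.zero_of_nonpos (x := 2 + x) (by linarith), zero_mul]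

/-- The test function `χ(t,ξ,v) a(x,v_x)`, cut off in `x` away from the slab. -/
noncomputable def slabTest (χ : ℝ × E2 × E3 → ℝ) (a : ℝ × ℝ → ℝ) (p : ℝ × Phase) : ℝ :=
  xCut p.2.1 * (χ (p.1, p.2.2) * a (p.2.1, p.2.2.2 0))

section SlabTest

variable {T : ℝ} {χ : ℝ × E2 × E3 → ℝ} {a : ℝ × ℝ → ℝ}

lemma slabTest_contDiff (hχ : ContDiff ℝ 1 χ) (ha : ContDiff ℝ 1 a) :
    ContDiff ℝ 1 (slabTest χ a) := by
  have h1 : ContDiff ℝ 1 fun p : ℝ × Phase => p.2.2.2 0 :=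
    (EuclideanSpace.proj (0 : Fin 3) : E3 →L[ℝ] ℝ).contDiff.comp (by fun_prop)
  exact (xCut_contDiff.comp (by fun_prop)).mul
    ((hχ.comp (by fun_prop)).mul (ha.comp (ContDiff.prodMk (by fun_prop) h1)))

lemma slabTest_support {p : ℝ × Phase} (hp : slabTest χ a p ≠ 0) :
    p.2.1 ∈ Icc (-2 : ℝ) 3 ∧ (p.1, p.2.2) ∈ tsupport χ := by
  constructor
  · by_contra h
    exact hp (by rw [slabTest, xCut_eq_zero h, zero_mul])
  · by_contra h
    exact hp (by rw [slabTest, image_eq_zero_of_notMem_tsupport h]; simp)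

lemma tsupport_slabTest :
    tsupport (slabTest χ a) ⊆ {p | p.2.1 ∈ Icc (-2 : ℝ) 3 ∧ (p.1, p.2.2) ∈ tsupport χ} := by
  refine closure_minimal (fun p hp => slabTest_support hp) ?_
  exact (isClosed_Icc.preimage (by fun_prop : Continuous fun p : ℝ × Phase => p.2.1)).inter
    ((isClosed_tsupport χ).preimage (by fun_prop : Continuous fun p : ℝ × Phase => (p.1, p.2.2)))

lemma slabTest_compact (hχ : HasCompactSupport χ) : HasCompactSupport (slabTest χ a) := by
  have h1 : IsCompact ((fun q : ℝ × (ℝ × E2 × E3) => ((q.2.1, q.1, q.2.2) : ℝ × Phase)) ''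
      (Icc (-2 : ℝ) 3 ×ˢ tsupport χ)) := (isCompact_Icc.prod hχ).image (by fun_prop)
  refine h1.of_isClosed_subset (isClosed_tsupport _) (tsupport_slabTest.trans ?_)
  rintro p ⟨h2, h3⟩
  exact ⟨(p.2.1, (p.1, p.2.2)), ⟨h2, h3⟩, rfl⟩

lemma slabTest_time (hχ : tsupport χ ⊆ {q | q.1 ∈ Ioo 0 T}) :
    tsupport (slabTest χ a) ⊆ {p | p.1 ∈ Ioo 0 T} := fun _ hp => hχ (tsupport_slabTest hp).2

lemma slabTest_wall (i : Fin 2) (q : ℝ × E2 × E3) :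
    slabTest χ a (q.1, wall i, q.2) = χ q * a (wall i, q.2.2 0) := by
  have : xCut (wall i) = 1 := xCut_eq_one (by fin_cases i <;> simp [wall])
  simp [slabTest, this]

/-- In the slab, the derivative along the field; the magnetic force drops out. -/
lemma fderiv_slabTest (hχ : IsRadialCutoff T χ) (ha : ContDiff ℝ 1 a) (α : ℝ) (B : E2 → ℝ)
    (E : ℝ → E2 → E2) {p : ℝ × Phase} (hp : p.2.1 ∈ Icc (0 : ℝ) 1) :
    fderiv ℝ (slabTest χ a) p (field α B E p)
      = a (p.2.1, p.2.2.2 0) * fderiv ℝ χ (p.1, p.2.2) (α, par p.2.2.2, lift (E p.1 p.2.2.1))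
        + χ (p.1, p.2.2) * (fderiv ℝ a (p.2.1, p.2.2.2 0) (1, 0) * (α⁻¹ * p.2.2.2 0)) := by
  have hev : slabTest χ a =ᶠ[𝓝 p] fun p => χ (p.1, p.2.2) * a (p.2.1, p.2.2.2 0) := by
    have : {p : ℝ × Phase | p.2.1 ∈ Ioo (-1 : ℝ) 2} ∈ 𝓝 p :=
      (isOpen_Ioo.preimage (by fun_prop : Continuous fun p : ℝ × Phase => p.2.1)).mem_nhds
        ⟨by linarith [hp.1], by linarith [hp.2]⟩
    filter_upwards [this] with p' hp'
    rw [slabTest, xCut_eq_one ⟨hp'.1.le, hp'.2.le⟩, one_mul]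
  rw [hev.fderiv_eq]
  have h1 : HasFDerivAt (fun p : ℝ × Phase => (p.1, p.2.2)) _ p :=
    ((ContinuousLinearMap.fst ℝ ℝ Phase).prod
      ((ContinuousLinearMap.snd ℝ ℝ (E2 × E3)).comp
        (ContinuousLinearMap.snd ℝ ℝ Phase))).hasFDerivAt
  have h2 : HasFDerivAt (fun p : ℝ × Phase => (p.2.1, p.2.2.2 0)) _ p :=
    (((ContinuousLinearMap.fst ℝ ℝ (E2 × E3)).comp (ContinuousLinearMap.snd ℝ ℝ Phase)).prod
      ((EuclideanSpace.proj (0 : Fin 3) : E3 →L[ℝ] ℝ).comp ((ContinuousLinearMap.snd ℝ E2 E3).comp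
      ((ContinuousLinearMap.snd ℝ ℝ (E2 × E3)).comp
        (ContinuousLinearMap.snd ℝ ℝ Phase))))).hasFDerivAt
  have h3 := ((hχ.contDiff.differentiable (by norm_num)) (p.1, p.2.2)).hasFDerivAt.comp p h1
  have h4 := ((ha.differentiable (by norm_num)) (p.2.1, p.2.2.2 0)).hasFDerivAt.comp p h2
  have h5 : fderiv ℝ (fun p : ℝ × Phase => χ (p.1, p.2.2) * a (p.2.1, p.2.2.2 0)) p = _ :=
    (h3.mul h4).fderiv
  rw [h5]
  have e1 : fderiv ℝ χ (p.1, p.2.2) (α, par p.2.2.2,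
      lift (E p.1 p.2.2.1) - α⁻¹ • crossB p.2.2.2 (B p.2.2.1))
      = fderiv ℝ χ (p.1, p.2.2) (α, par p.2.2.2, lift (E p.1 p.2.2.1)) := by
    have : ((α, par p.2.2.2, lift (E p.1 p.2.2.1) - α⁻¹ • crossB p.2.2.2 (B p.2.2.1))
        : ℝ × E2 × E3) = (α, par p.2.2.2, lift (E p.1 p.2.2.1))
          - α⁻¹ • ((0, 0, crossB p.2.2.2 (B p.2.2.1)) : ℝ × E2 × E3) := by
      simp
    rw [this, map_sub, map_smul, hχ.fderiv_crossB (p.1, p.2.2), smul_zero, sub_zero]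
  have e2 : fderiv ℝ a (p.2.1, p.2.2.2 0) (α⁻¹ * p.2.2.2 0, 0)
      = fderiv ℝ a (p.2.1, p.2.2.2 0) (1, 0) * (α⁻¹ * p.2.2.2 0) := by
    have : ((α⁻¹ * p.2.2.2 0, 0) : ℝ × ℝ) = (α⁻¹ * p.2.2.2 0) • ((1, 0) : ℝ × ℝ) := by simp
    rw [this, map_smul, smul_eq_mul, mul_comm]
  have e3 : (EuclideanSpace.proj (0 : Fin 3) : E3 →L[ℝ] ℝ)
      (lift (E p.1 p.2.2.1) - α⁻¹ • crossB p.2.2.2 (B p.2.2.1)) = 0 := by simp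
  simp only [field, add_apply, smul_apply,
    ContinuousLinearMap.comp_apply, smul_eq_mul, Function.comp]
  simp only [ContinuousLinearMap.prod_apply, ContinuousLinearMap.coe_fst',
    ContinuousLinearMap.coe_snd', ContinuousLinearMap.comp_apply, e1, e3, e2]
  ring

end SlabTest

/-- Smooth approximations of the sign function, vanishing linearly at the origin. -/
noncomputable def smoothSign (m s : ℝ) : ℝ := m * s / √(1 + (m * s) ^ 2)

lemma smoothSign_sq (m s : ℝ) : smoothSign m s ^ 2 = (m * s) ^ 2 / (1 + (m * s) ^ 2) := by
  rw [smoothSign, div_pow, Real.sq_sqrt (by positivity)]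

lemma smoothSign_sq_le_one (m s : ℝ) : smoothSign m s ^ 2 ≤ 1 := by
  rw [smoothSign_sq, div_le_one (by positivity)]
  linarith

lemma abs_smoothSign_le_one (m s : ℝ) : |smoothSign m s| ≤ 1 :=
  abs_le_one_iff_mul_self_le_one.mpr (by simpa [sq] using smoothSign_sq_le_one m s)

lemma abs_smoothSign_le (m s : ℝ) : |smoothSign m s| ≤ |m| * |s| := by
  rw [smoothSign, abs_div, abs_mul]
  refine div_le_self (by positivity) ?_
  rw [abs_of_nonneg (Real.sqrt_nonneg _)]
  exact Real.one_le_sqrt.mpr (by nlinarith [sq_nonneg (m * s)])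

lemma smoothSign_contDiff (m : ℝ) : ContDiff ℝ 1 (smoothSign m) := by
  unfold smoothSign
  refine ContDiff.div (by fun_prop) (ContDiff.sqrt (by fun_prop) fun s => by positivity)
    fun s => by positivity

lemma tendsto_smoothSign_sq {s : ℝ} (hs : s ≠ 0) :
    Tendsto (fun m : ℕ => smoothSign m s ^ 2) atTop (𝓝 1) := by
  have h1 : Tendsto (fun m : ℕ => ((m : ℝ) * s) ^ 2) atTop atTop := by
    have : Tendsto (fun m : ℕ => (m : ℝ) ^ 2) atTop atTop :=
      (tendsto_pow_atTop two_ne_zero).comp tendsto_natCast_atTop_atTop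
    have := this.atTop_mul_const (sq_pos_of_ne_zero hs)
    simpa [mul_pow] using this
  have h2 : Tendsto (fun m : ℕ => 1 - (1 + ((m : ℝ) * s) ^ 2)⁻¹) atTop (𝓝 (1 - 0)) :=
    tendsto_const_nhds.sub (tendsto_atTop_add_const_left _ 1 h1).inv_tendsto_atTop
  rw [sub_zero] at h2
  refine h2.congr fun m => ?_
  rw [smoothSign_sq]
  have : 1 + ((m : ℝ) * s) ^ 2 ≠ 0 := by positivity
  field_simp
  ring

section TraceBounds

variable {T α b M L : ℝ} {B : E2 → ℝ} {E : ℝ → E2 → E2} {f : ℝ × Phase → ℝ}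
  {γ : Fin 2 → ℝ × E2 × E3 → ℝ} {χ : ℝ × E2 × E3 → ℝ} {R D N : ℝ}

lemma IsRadialCutoff.exists_bounds (hχ : IsRadialCutoff T χ) :
    ∃ R D : ℝ, 0 ≤ R ∧ 0 ≤ D ∧ (∀ q, χ q ≠ 0 → q ∈ wallSet T R) ∧ ∀ q, ‖fderiv ℝ χ q‖ ≤ D := by
  obtain ⟨R, hR⟩ := (hχ.compact.image
    (by fun_prop : Continuous fun q : ℝ × E2 × E3 => q.2.2)).isBounded.subset_closedBall 0
  obtain ⟨D, hD⟩ := (hχ.contDiff.continuous_fderiv (by norm_num)).bounded_above_of_compact_support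
    (hχ.compact.fderiv (𝕜 := ℝ))
  refine ⟨max R 0, D, le_max_right _ _, (norm_nonneg _).trans (hD 0), fun q hq => ?_, hD⟩
  have h1 : q ∈ tsupport χ := subset_tsupport _ hq
  exact ⟨hχ.time h1, mem_univ _, Metric.closedBall_subset_closedBall (le_max_left _ _)
    (hR ⟨q, h1, rfl⟩)⟩

/-- Products of a trace squared with `|v_x|` and a bounded, localized weight are integrable. -/
lemma integrable_abs_vx_mul_sq_mul {γ : ℝ × E2 × E3 → ℝ} (h : MemLp γ 2 (wallMeasure T R))
    {w : ℝ × E2 × E3 → ℝ} (hw : Measurable w) {C : ℝ} (hC : ∀ q, |w q| ≤ C)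
    (hs : ∀ q, w q ≠ 0 → q ∈ wallSet T R) :
    Integrable fun q => |q.2.2 0| * γ q ^ 2 * w q := by
  have h1 : Integrable ((wallSet T R).indicator fun q : ℝ × E2 × E3 => |q.2.2 0| * γ q ^ 2) :=
    (integrable_indicator_iff (measurableSet_wallSet T R)).mpr (integrableOn_abs_vx_mul_sq h)
  refine (h1.mul_bdd hw.aestronglyMeasurable (Eventually.of_forall hC)).congr
    (Eventually.of_forall fun q => ?_)
  by_cases hq : q ∈ wallSet T R
  · simp [hq]
  · have : w q = 0 := by
      by_contra h2
      exact hq (hs q h2)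
    simp [this]

lemma integrable_vx_mul_sq_mul {γ : ℝ × E2 × E3 → ℝ} (h : MemLp γ 2 (wallMeasure T R))
    {w : ℝ × E2 × E3 → ℝ} (hw : Measurable w) {C : ℝ} (hC : ∀ q, |w q| ≤ C)
    (hs : ∀ q, w q ≠ 0 → q ∈ wallSet T R) :
    Integrable fun q => q.2.2 0 * γ q ^ 2 * w q := by
  have hs1 : Measurable fun q : ℝ × E2 × E3 => if 0 ≤ q.2.2 0 then (1 : ℝ) else -1 :=
    Measurable.ite (measurableSet_le measurable_const measurable_wall_vx) measurable_const
      measurable_const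
  refine (integrable_abs_vx_mul_sq_mul h (hs1.mul hw) (C := C) (fun q => ?_) fun q hq =>
    hs q (right_ne_zero_of_mul hq)).congr (Eventually.of_forall fun q => ?_)
  · simp only [Pi.mul_apply]
    split_ifs <;> simpa using hC q
  · simp only [Pi.mul_apply]
    split_ifs with h0
    · rw [abs_of_nonneg h0]
      ring
    · rw [abs_of_neg (not_le.mp h0)]
      ring

/-- The energy identity for the weight `χ a`. The interior term is of order `α`, apart from the
derivative of `a` in `x`, which enters with the velocity `v_x / α` and is of order one. The bound
`haC` is needed only qualitatively: `Ca` does not enter the estimate. -/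
lemma abs_wall_energy_le (hB : Continuous B) (hb : ∀ ξ, |B ξ| ≤ b)
    (hbL : ∀ ξ ξ', |B ξ - B ξ'| ≤ b * ‖ξ - ξ'‖) (hE : IsRegularField M L E) (hL : 0 ≤ L)
    (hα : 0 < α) (hf : IsWeakTransport T α B E f γ)
    (hN : ∫ p in Ioo 0 T ×ˢ Theta, f p ^ 2 ≤ N) (hχ : IsRadialCutoff T χ)
    (hR : ∀ q, χ q ≠ 0 → q ∈ wallSet T R) (hR0 : 0 ≤ R) (hD : ∀ q, ‖fderiv ℝ χ q‖ ≤ D)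
    {a : ℝ × ℝ → ℝ} (ha : ContDiff ℝ 1 a) {a0 a1 Ca : ℝ} (h0 : 0 ≤ a0) (h1 : 0 ≤ a1)
    (ha0 : ∀ x ∈ Icc (0 : ℝ) 1, ∀ s, |s| ≤ R → |a (x, s)| ≤ a0)
    (ha1 : ∀ x ∈ Icc (0 : ℝ) 1, ∀ s, |s| ≤ R → |fderiv ℝ a (x, s) (1, 0)| ≤ a1)
    (hCa : 0 ≤ Ca) (haC : ∀ x ∈ Icc (-2 : ℝ) 3, ∀ s, |s| ≤ R → |a (x, s)| ≤ Ca * |s|) :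
    |∑ i, normal i * ∫ q : ℝ × E2 × E3, q.2.2 0 * γ i q ^ 2 * (χ q * a (wall i, q.2.2 0)) ^ 2|
      ≤ (2 * a0 ^ 2 * D * (α + R + M) * α + 2 * a0 * a1 * R) * N := by
  have hM : 0 ≤ M := (norm_nonneg _).trans (hE.bound 0 0)
  have hD0 : 0 ≤ D := (norm_nonneg _).trans (hD 0)
  have hvR : ∀ q, χ q ≠ 0 → ‖q.2.2‖ ≤ R := fun q hq => by simpa using (hR q hq).2.2
  have hxc : ∀ x, |xCut x| ≤ 1 := fun x => by
    rw [xCut, abs_mul, abs_of_nonneg (Real.smoothTransition.nonneg _),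
      abs_of_nonneg (Real.smoothTransition.nonneg _)]
    exact mul_le_one₀ (Real.smoothTransition.le_one _) (Real.smoothTransition.nonneg _)
      (Real.smoothTransition.le_one _)
  -- `haC` makes the weight vanish linearly in `v_x`, as the energy identity requires
  have hen := energy_identity hB hb hbL hE hL hα.ne' hf (slabTest_contDiff hχ.contDiff ha)
    (slabTest_compact hχ.compact) (slabTest_time hχ.time) (Cη := Ca) (by
      intro p
      by_cases hp : slabTest χ a p = 0
      · rw [hp, abs_zero]
        positivity
      · have hx := (slabTest_support hp).1
        have hχ0 : χ (p.1, p.2.2) ≠ 0 := fun h => hp (by simp [slabTest, h])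
        have hv := (abs_coord_le p.2.2.2 0).trans (hvR (p.1, p.2.2) hχ0)
        rw [slabTest, abs_mul, abs_mul]
        calc _ ≤ 1 * (1 * |a (p.2.1, p.2.2.2 0)|) := by
              gcongr
              · exact hxc _
              · exact hχ.le_one _
          _ ≤ _ := by
              rw [one_mul, one_mul]
              exact haC _ hx _ hv)
  simp only [slabTest_wall] at hen
  rw [← hen]
  have hbound : ∀ p ∈ Ioo 0 T ×ˢ Theta,
      ‖f p ^ 2 * (slabTest χ a p * fderiv ℝ (slabTest χ a) p (field α B E p))‖
        ≤ (a0 ^ 2 * D * (α + R + M) + a0 * a1 * (α⁻¹ * R)) * f p ^ 2 := by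
    intro p hp
    have hx : p.2.1 ∈ Icc (0 : ℝ) 1 := hp.2.1
    rw [fderiv_slabTest hχ ha α B E hx, norm_mul, Real.norm_eq_abs, abs_of_nonneg (sq_nonneg _),
      mul_comm]
    refine mul_le_mul_of_nonneg_right ?_ (sq_nonneg _)
    by_cases hχ0 : χ (p.1, p.2.2) = 0
    · simp only [slabTest, hχ0, zero_mul, mul_zero, norm_zero]
      positivity
    have hv' : ‖p.2.2.2‖ ≤ R := hvR (p.1, p.2.2) hχ0
    have hv := (abs_coord_le p.2.2.2 0).trans hv'
    have e1 := ha0 _ hx _ hv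
    have e2 := ha1 _ hx _ hv
    have e3 : |fderiv ℝ χ (p.1, p.2.2) (α, par p.2.2.2, lift (E p.1 p.2.2.1))| ≤
        D * (α + R + M) := by
      refine (ContinuousLinearMap.le_opNorm (fderiv ℝ χ (p.1, p.2.2)) _).trans ?_
      refine mul_le_mul (hD _) ?_ (norm_nonneg _) hD0
      rw [Prod.norm_def, Prod.norm_def, norm_lift_eq, Real.norm_eq_abs, abs_of_pos hα]
      have k1 := (norm_par_le p.2.2.2).trans hv'
      have k2 := hE.bound p.1 p.2.2.1
      simp only
      refine max_le (by linarith) (max_le (by linarith) (by linarith))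
    have e4 : |slabTest χ a p| ≤ a0 := by
      rw [slabTest, abs_mul, abs_mul]
      calc _ ≤ 1 * (1 * a0) := by
            gcongr
            · exact hxc _
            · exact hχ.le_one _
        _ = _ := by ring
    have e5 : |α⁻¹ * p.2.2.2 0| ≤ α⁻¹ * R := by
      rw [abs_mul, abs_of_pos (inv_pos.mpr hα)]
      gcongr
    rw [Real.norm_eq_abs, abs_mul]
    calc _ ≤ a0 * (a0 * (D * (α + R + M)) + 1 * (a1 * (α⁻¹ * R))) := by
          refine mul_le_mul e4 ?_ (abs_nonneg _) h0
          refine (abs_add_le _ _).trans (add_le_add ?_ ?_)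
          · rw [abs_mul]
            exact mul_le_mul e1 e3 (abs_nonneg _) h0
          · rw [abs_mul, abs_mul]
            exact mul_le_mul (hχ.le_one _) (mul_le_mul e2 e5 (abs_nonneg _) h1)
              (by positivity) zero_le_one
      _ = _ := by ring
  have hint : Integrable (fun p => f p ^ 2) (volume.restrict (Ioo 0 T ×ˢ Theta)) :=
    hf.memLp.integrable_sq
  have hmeas : MeasurableSet (Ioo 0 T ×ˢ Theta) :=
    measurableSet_Ioo.prod (measurableSet_Icc.prod MeasurableSet.univ)
  have hle := norm_integral_le_of_norm_le (hint.const_mul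
    (a0 ^ 2 * D * (α + R + M) + a0 * a1 * (α⁻¹ * R))) ((ae_restrict_iff' hmeas).mpr
      (Eventually.of_forall hbound))
  rw [integral_const_mul] at hle
  rw [abs_mul, abs_of_pos (by positivity : 0 < 2 * α)]
  calc _ ≤ 2 * α * ((a0 ^ 2 * D * (α + R + M) + a0 * a1 * (α⁻¹ * R)) * N) := by
        refine mul_le_mul_of_nonneg_left (hle.trans ?_) (by positivity)
        exact mul_le_mul_of_nonneg_left hN (by positivity)
    _ = _ := by
        field_simp

end TraceBounds

section TraceBounds

variable {T α b M L : ℝ} {B : E2 → ℝ} {E : ℝ → E2 → E2} {f : ℝ × Phase → ℝ}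
  {γ : Fin 2 → ℝ × E2 × E3 → ℝ} {χ : ℝ × E2 × E3 → ℝ} {R D N : ℝ}

/-- The smoothed sign, used as a cutoff near `v_x = 0`, can be removed in wall integrals. -/
lemma tendsto_integral_smoothSign {γ : ℝ × E2 × E3 → ℝ} (h : MemLp γ 2 (wallMeasure T R))
    {w : ℝ × E2 × E3 → ℝ} (hw : Measurable w) {C : ℝ} (hC : ∀ q, |w q| ≤ C)
    (hs : ∀ q, w q ≠ 0 → q ∈ wallSet T R) :
    Tendsto (fun m : ℕ => ∫ q, q.2.2 0 * γ q ^ 2 * (w q * smoothSign m (q.2.2 0) ^ 2)) atTop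
      (𝓝 (∫ q, q.2.2 0 * γ q ^ 2 * w q)) := by
  have hi := integrable_vx_mul_sq_mul h hw hC hs
  have hth : ∀ m : ℕ, Measurable fun q : ℝ × E2 × E3 => smoothSign m (q.2.2 0) ^ 2 := fun m =>
    ((smoothSign_contDiff m).continuous.measurable.comp measurable_wall_vx).pow_const 2
  refine tendsto_integral_of_dominated_convergence
    (fun q => ‖q.2.2 0 * γ q ^ 2 * w q‖) (fun m => ?_) hi.norm (fun m => ?_) ?_
  · refine (hi.aestronglyMeasurable.mul (hth m).aestronglyMeasurable).congr ?_
    refine Eventually.of_forall fun q => ?_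
    simp only [Pi.mul_apply]
    ring
  · refine Eventually.of_forall fun q => ?_
    rw [← mul_assoc, norm_mul]
    refine mul_le_of_le_one_right (norm_nonneg _) ?_
    rw [Real.norm_eq_abs, abs_of_nonneg (sq_nonneg _)]
    exact smoothSign_sq_le_one _ _
  · refine Eventually.of_forall fun q => ?_
    by_cases h0 : q.2.2 0 = 0
    · simp [h0]
    · have := (tendsto_smoothSign_sq h0).const_mul (q.2.2 0 * γ q ^ 2 * w q)
      rw [mul_one] at this
      exact this.congr fun m => by ring

/-- The fluxes of energy through the walls nearly compensate: for a weight that does not depend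
on `x`, the interior term of the energy identity is of order `α`. -/
lemma abs_sum_flux_le (hB : Continuous B) (hb : ∀ ξ, |B ξ| ≤ b)
    (hbL : ∀ ξ ξ', |B ξ - B ξ'| ≤ b * ‖ξ - ξ'‖) (hE : IsRegularField M L E) (hL : 0 ≤ L)
    (hα : 0 < α) (hf : IsWeakTransport T α B E f γ)
    (hN : ∫ p in Ioo 0 T ×ˢ Theta, f p ^ 2 ≤ N) (hχ : IsRadialCutoff T χ)
    (hR : ∀ q, χ q ≠ 0 → q ∈ wallSet T R) (hR0 : 0 ≤ R) (hD : ∀ q, ‖fderiv ℝ χ q‖ ≤ D) :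
    |∑ i, normal i * ∫ q : ℝ × E2 × E3, q.2.2 0 * γ i q ^ 2 * χ q ^ 2|
      ≤ 2 * D * (α + R + M) * N * α := by
  have hχm : Measurable fun q => χ q ^ 2 := hχ.contDiff.continuous.measurable.pow_const 2
  have hlim : Tendsto (fun m : ℕ => |∑ i, normal i * ∫ q : ℝ × E2 × E3,
      q.2.2 0 * γ i q ^ 2 * (χ q * smoothSign m (q.2.2 0)) ^ 2|) atTop
      (𝓝 |∑ i, normal i * ∫ q : ℝ × E2 × E3, q.2.2 0 * γ i q ^ 2 * χ q ^ 2|) := by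
    refine (tendsto_finsetSum _ fun i _ => Tendsto.const_mul _ ?_).abs
    have := tendsto_integral_smoothSign (hf.trace i R) hχm (C := 1)
      (fun q => by
        rw [abs_of_nonneg (sq_nonneg _)]
        exact (sq_le_one_iff_abs_le_one _).mpr (hχ.le_one q))
      fun q hq => hR q (fun h => hq (by simp [h]))
    simpa only [mul_pow] using this
  refine le_of_tendsto hlim (Eventually.of_forall fun m => ?_)
  have := abs_wall_energy_le hB hb hbL hE hL hα hf hN hχ hR hR0 hD
    (a := fun z => smoothSign m z.2) (a0 := 1) (a1 := 0) (Ca := |(m : ℝ)|)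
    ((smoothSign_contDiff m).comp (by fun_prop)) zero_le_one le_rfl
    (fun x _ s _ => abs_smoothSign_le_one m s)
    (fun x _ s _ => by
      have h2 := ((smoothSign_contDiff m).differentiable (by norm_num) s).hasFDerivAt.comp
        (x, s) (ContinuousLinearMap.snd ℝ ℝ ℝ).hasFDerivAt
      rw [show (fun z : ℝ × ℝ => smoothSign m z.2)
        = smoothSign m ∘ (ContinuousLinearMap.snd ℝ ℝ ℝ) from rfl, h2.fderiv]
      simp)
    (abs_nonneg _)
    (fun x _ s _ => abs_smoothSign_le m s)
  refine this.trans (le_of_eq (by ring))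

/-- The function `v_x γ χ` is bounded in `L²`: the weight `(±1 + (2x-1) v_x)²` has the same energy
estimate for both signs, and the difference of the wall terms is `4 v_x²`. -/
lemma sum_integral_sq_vx_trace_le (hB : Continuous B) (hb : ∀ ξ, |B ξ| ≤ b)
    (hbL : ∀ ξ ξ', |B ξ - B ξ'| ≤ b * ‖ξ - ξ'‖) (hE : IsRegularField M L E) (hL : 0 ≤ L)
    (hα : 0 < α) (hf : IsWeakTransport T α B E f γ)
    (hN : ∫ p in Ioo 0 T ×ˢ Theta, f p ^ 2 ≤ N) (hχ : IsRadialCutoff T χ)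
    (hR : ∀ q, χ q ≠ 0 → q ∈ wallSet T R) (hR0 : 0 ≤ R) (hD : ∀ q, ‖fderiv ℝ χ q‖ ≤ D) :
    ∑ i, ∫ q : ℝ × E2 × E3, (q.2.2 0 * γ i q * χ q) ^ 2
      ≤ ((1 + R) ^ 2 * D * (α + R + M) * α + 2 * (1 + R) * R ^ 2) * N := by
  have hχm : Measurable fun q => χ q := hχ.contDiff.continuous.measurable
  have hbd : ∀ (σ : ℝ), |σ| = 1 → ∀ m : ℕ, |∑ i, normal i * ∫ q : ℝ × E2 × E3,
      q.2.2 0 * γ i q ^ 2 * (χ q * (smoothSign m (q.2.2 0)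
        * (σ + (2 * wall i - 1) * q.2.2 0))) ^ 2|
      ≤ (2 * (1 + R) ^ 2 * D * (α + R + M) * α + 2 * (1 + R) * (2 * R) * R) * N := by
    intro σ hσ m
    have hx1 : ∀ x ∈ Icc (0 : ℝ) 1, |2 * x - 1| ≤ 1 := fun x hx =>
      abs_le.mpr ⟨by linarith [hx.1], by linarith [hx.2]⟩
    have hx2 : ∀ x ∈ Icc (-2 : ℝ) 3, |2 * x - 1| ≤ 5 := fun x hx =>
      abs_le.mpr ⟨by linarith [hx.1], by linarith [hx.2]⟩
    refine abs_wall_energy_le hB hb hbL hE hL hα hf hN hχ hR hR0 hD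
      (a := fun z => smoothSign m z.2 * (σ + (2 * z.1 - 1) * z.2)) (a0 := 1 + R) (a1 := 2 * R)
      (Ca := |(m : ℝ)| * (1 + 5 * R))
      (((smoothSign_contDiff m).comp (by fun_prop)).mul (by fun_prop)) (by positivity)
      (by positivity) ?_ ?_ (by positivity) ?_
    · intro x hx s hs
      rw [abs_mul]
      refine (mul_le_of_le_one_left (abs_nonneg _) (abs_smoothSign_le_one _ _)).trans ?_
      refine (abs_add_le _ _).trans ?_
      rw [hσ, abs_mul]
      have := mul_le_mul (hx1 x hx) hs (abs_nonneg _) zero_le_one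
      linarith
    · intro x _ s hs
      have h1 := ((smoothSign_contDiff m).differentiable (by norm_num) s).hasFDerivAt.comp
        (x, s) (ContinuousLinearMap.snd ℝ ℝ ℝ).hasFDerivAt
      have h2 : HasFDerivAt (fun z : ℝ × ℝ => σ + (2 * z.1 - 1) * z.2) _ (x, s) :=
        ((((ContinuousLinearMap.fst ℝ ℝ ℝ).hasFDerivAt.const_mul 2).sub_const 1).mul
          (ContinuousLinearMap.snd ℝ ℝ ℝ).hasFDerivAt).const_add σ
      have h3 := h1.mul h2
      have h4 : fderiv ℝ (fun z : ℝ × ℝ => smoothSign m z.2 * (σ + (2 * z.1 - 1) * z.2)) (x, s)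
          (1, 0) = smoothSign m s * (s * 2) := by
        have := h3.fderiv
        simp only [Function.comp_def] at this
        simp only [Pi.mul_def] at this
        erw [this]
        simp
      rw [h4, abs_mul, abs_mul, abs_two]
      calc _ ≤ 1 * (|s| * 2) := by
            gcongr
            exact abs_smoothSign_le_one _ _
        _ ≤ _ := by linarith
    · intro x hx s hs
      rw [abs_mul]
      have h1 : |σ + (2 * x - 1) * s| ≤ 1 + 5 * R := by
        refine (abs_add_le _ _).trans ?_
        rw [hσ, abs_mul]
        have := mul_le_mul (hx2 x hx) hs (abs_nonneg _) (by norm_num)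
        linarith
      calc _ ≤ |(m : ℝ)| * |s| * (1 + 5 * R) :=
            mul_le_mul (abs_smoothSign_le _ _) h1 (abs_nonneg _) (by positivity)
        _ = _ := by ring
  have hv : ∀ q, χ q ≠ 0 → |q.2.2 0| ≤ R := fun q hq =>
    (abs_coord_le _ _).trans (by simpa using (hR q hq).2.2)
  have hwb : ∀ (σ : ℝ), |σ| = 1 → ∀ (i : Fin 2) (q : ℝ × E2 × E3),
      |(χ q * (σ + (2 * wall i - 1) * q.2.2 0)) ^ 2| ≤ (1 + R) ^ 2 := by
    intro σ hσ i q
    rw [abs_of_nonneg (sq_nonneg _)]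
    by_cases hq : χ q = 0
    · rw [hq, zero_mul, zero_pow two_ne_zero]
      positivity
    · refine sq_le_sq' ?_ ?_ <;> [refine neg_le_of_abs_le ?_; refine le_of_abs_le ?_] <;>
      · rw [abs_mul]
        refine (mul_le_of_le_one_left (abs_nonneg _) (hχ.le_one q)).trans ?_
        refine (abs_add_le _ _).trans ?_
        have : |2 * wall i - 1| = 1 := by fin_cases i <;> norm_num [wall]
        rw [hσ, abs_mul, this, one_mul]
        linarith [hv q hq]
  have hws : ∀ (σ : ℝ) (i : Fin 2) (q : ℝ × E2 × E3),
      (χ q * (σ + (2 * wall i - 1) * q.2.2 0)) ^ 2 ≠ 0 → q ∈ wallSet T R :=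
    fun σ i q hq => hR q fun h => hq (by simp [h])
  have hwm : ∀ (σ : ℝ) (i : Fin 2), Measurable fun q : ℝ × E2 × E3 =>
      (χ q * (σ + (2 * wall i - 1) * q.2.2 0)) ^ 2 := fun σ i =>
    (hχm.mul ((measurable_wall_vx.const_mul _).const_add _)).pow_const 2
  have hlim : ∀ (σ : ℝ), |σ| = 1 → |∑ i, normal i * ∫ q : ℝ × E2 × E3,
      q.2.2 0 * γ i q ^ 2 * (χ q * (σ + (2 * wall i - 1) * q.2.2 0)) ^ 2|
      ≤ (2 * (1 + R) ^ 2 * D * (α + R + M) * α + 2 * (1 + R) * (2 * R) * R) * N := by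
    intro σ hσ
    refine le_of_tendsto ((tendsto_finsetSum Finset.univ fun i _ => Tendsto.const_mul _
      (tendsto_integral_smoothSign (hf.trace i R) (hwm σ i) (hwb σ hσ i) (hws σ i))).abs)
      (Eventually.of_forall fun m => le_trans (le_of_eq ?_) (hbd σ hσ m))
    congr 1
    refine Finset.sum_congr rfl fun i _ => ?_
    congr 1
    refine integral_congr_ae (Eventually.of_forall fun q => ?_)
    simp only
    ring
  -- `(1 + s)² - (-1 + s)² = 4 s` with `s = (2x - 1) v_x`, and `2x - 1` is the normal at the walls
  have hsum : 4 * ∑ i, ∫ q : ℝ × E2 × E3, (q.2.2 0 * γ i q * χ q) ^ 2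
      = (∑ i, normal i * ∫ q : ℝ × E2 × E3,
          q.2.2 0 * γ i q ^ 2 * (χ q * (1 + (2 * wall i - 1) * q.2.2 0)) ^ 2)
        - ∑ i, normal i * ∫ q : ℝ × E2 × E3,
          q.2.2 0 * γ i q ^ 2 * (χ q * (-1 + (2 * wall i - 1) * q.2.2 0)) ^ 2 := by
    rw [← Finset.sum_sub_distrib, Finset.mul_sum]
    refine Finset.sum_congr rfl fun i _ => ?_
    rw [← mul_sub, ← integral_sub
      (integrable_vx_mul_sq_mul (hf.trace i R) (hwm 1 i) (hwb 1 (by simp) i) (hws 1 i))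
      (integrable_vx_mul_sq_mul (hf.trace i R) (hwm (-1) i) (hwb (-1) (by simp) i) (hws (-1) i)),
      ← integral_const_mul, ← integral_const_mul]
    refine integral_congr_ae (Eventually.of_forall fun q => ?_)
    have : normal i * (2 * wall i - 1) = 1 := by fin_cases i <;> norm_num [wall, normal]
    simp only
    linear_combination (-4 * (q.2.2 0 * γ i q * χ q) ^ 2) * this
  have k1 := (abs_le.mp (hlim 1 (by simp))).2
  have k2 := (abs_le.mp (hlim (-1) (by simp))).1
  linarith

end TraceBounds

/-! ### Polar coordinates in velocity space -/

lemma _root_.MeasureTheory.MeasurePreserving.withDensity_comp {X Y : Type*} [MeasurableSpace X]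
    [MeasurableSpace Y] {μ : Measure X} {ν : Measure Y} {P : X → Y} (hP : MeasurePreserving P μ ν)
    {g : Y → ℝ≥0∞} (hg : Measurable g) :
    MeasurePreserving P (μ.withDensity (g ∘ P)) (ν.withDensity g) := by
  refine ⟨hP.measurable, ?_⟩
  ext s hs
  rw [Measure.map_apply hP.measurable hs, withDensity_apply _ (hP.measurable hs),
    withDensity_apply _ hs]
  exact hP.setLIntegral_comp_preimage hs hg

/-- Polar coordinates `(r, ω) ↦ r ω`. -/
def polarVec (p : Ioi (0 : ℝ) × S2) : E3 := (p.1 : ℝ) • (p.2 : E3)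

instance : IsFiniteMeasure surf := by
  unfold surf
  infer_instance

lemma measurePreserving_polarVec :
    MeasurePreserving polarVec ((Measure.volumeIoiPow 2).prod surf) volume := by
  have h1 := (Measure.measurePreserving_homeomorphUnitSphereProd (volume : Measure E3))
  have hd : Module.finrank ℝ E3 - 1 = 2 := by simp
  rw [hd] at h1
  have h2 : MeasurePreserving (homeomorphUnitSphereProd E3).toMeasurableEquiv.symm
      (surf.prod (Measure.volumeIoiPow 2)) ((volume : Measure E3).comap (↑)) :=
    MeasurePreserving.symm _ h1
  have h3 : MeasurePreserving ((↑) : ({0}ᶜ : Set E3) → E3) ((volume : Measure E3).comap (↑))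
      volume := by
    refine ⟨measurable_subtype_coe, ?_⟩
    rw [map_comap_subtype_coe (measurableSet_singleton _).compl]
    exact Measure.restrict_eq_self_of_ae_mem (compl_mem_ae_iff.mpr (by simp))
  exact h3.comp (h2.comp Measure.measurePreserving_swap)

/-- The density `|v_x|` on the outgoing velocities. -/
noncomputable def outDensity (i : Fin 2) : E3 → ℝ≥0∞ :=
  {v | v ∈ outgoing i}.indicator fun v => ENNReal.ofReal |v 0|

/-- The density `|v_x|` on the incoming velocities. -/
noncomputable def inDensity (i : Fin 2) : E3 → ℝ≥0∞ :=
  {v | v ∈ incoming i}.indicator fun v => ENNReal.ofReal |v 0|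

lemma measurable_coord (j : Fin 3) : Measurable fun v : E3 => v j :=
  Continuous.measurable (by fun_prop)

lemma measurableSet_outgoing (i : Fin 2) : MeasurableSet (outgoing i) :=
  measurableSet_lt measurable_const ((measurable_coord 0).const_mul _)

lemma measurableSet_incoming (i : Fin 2) : MeasurableSet (incoming i) :=
  measurableSet_lt ((measurable_coord 0).const_mul _) measurable_const

lemma measurable_outDensity (i : Fin 2) : Measurable (outDensity i) :=
  (measurable_coord 0).abs.ennreal_ofReal.indicator (measurableSet_outgoing i)

lemma measurable_inDensity (i : Fin 2) : Measurable (inDensity i) :=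
  (measurable_coord 0).abs.ennreal_ofReal.indicator (measurableSet_incoming i)

lemma fluxOut_eq (i : Fin 2) : fluxOut i = surf.withDensity fun ω => outDensity i (ω : E3) := by
  exact (withDensity_indicator
    (s := {ω : S2 | (ω : E3) ∈ outgoing i})
    (measurable_subtype_coe (measurableSet_outgoing i)) _).symm

lemma fluxIn_eq (i : Fin 2) : fluxIn i = surf.withDensity fun ω => inDensity i (ω : E3) := by
  exact (withDensity_indicator
    (s := {ω : S2 | (ω : E3) ∈ incoming i})
    (measurable_subtype_coe (measurableSet_incoming i)) _).symm

lemma abs_coord_sphere_le (ω : S2) : |(ω : E3) 0| ≤ 1 :=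
  (abs_coord_le _ _).trans (by simp)

instance (i : Fin 2) : IsFiniteMeasure (fluxOut i) := by
  unfold fluxOut
  refine isFiniteMeasure_withDensity (ne_of_lt ?_)
  refine (lintegral_mono (g := fun _ => 1) fun ω => ?_).trans_lt (by simp)
  exact ENNReal.ofReal_le_one.mpr (abs_coord_sphere_le ω)

instance (i : Fin 2) : IsFiniteMeasure (fluxIn i) := by
  unfold fluxIn
  refine isFiniteMeasure_withDensity (ne_of_lt ?_)
  refine (lintegral_mono (g := fun _ => 1) fun ω => ?_).trans_lt (by simp)
  exact ENNReal.ofReal_le_one.mpr (abs_coord_sphere_le ω)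

lemma volumeIoiPow_three :
    Measure.volumeIoiPow 3
      = (Measure.volumeIoiPow 2).withDensity fun r => ENNReal.ofReal (r : ℝ) := by
  unfold Measure.volumeIoiPow
  rw [← withDensity_mul _ (by fun_prop) (by fun_prop)]
  congr 1
  funext r
  rw [Pi.mul_apply, ← ENNReal.ofReal_mul (by have := r.2.out; positivity)]
  ring_nf

lemma outDensity_smul (i : Fin 2) (r : Ioi (0 : ℝ)) (v : E3) :
    outDensity i ((r : ℝ) • v) = ENNReal.ofReal (r : ℝ) * outDensity i v := by
  have hr : (0 : ℝ) < r := r.2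
  have h1 : (r : ℝ) • v ∈ outgoing i ↔ v ∈ outgoing i := by
    simp only [outgoing, mem_ofPred_eq, PiLp.smul_apply, smul_eq_mul]
    rw [show normal i * ((r : ℝ) * v 0) = r * (normal i * v 0) by ring]
    exact mul_pos_iff_of_pos_left hr
  unfold outDensity
  by_cases h : v ∈ outgoing i
  · rw [indicator_of_mem (by exact h1.mpr h), indicator_of_mem (by exact h),
      ← ENNReal.ofReal_mul hr.le]
    simp [abs_mul, abs_of_pos hr]
  · rw [indicator_of_notMem (by exact fun h2 => h (h1.mp h2)), indicator_of_notMem (by exact h),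
      mul_zero]

lemma inDensity_smul (i : Fin 2) (r : Ioi (0 : ℝ)) (v : E3) :
    inDensity i ((r : ℝ) • v) = ENNReal.ofReal (r : ℝ) * inDensity i v := by
  have hr : (0 : ℝ) < r := r.2
  have h1 : (r : ℝ) • v ∈ incoming i ↔ v ∈ incoming i := by
    simp only [incoming, mem_ofPred_eq, PiLp.smul_apply, smul_eq_mul]
    rw [show normal i * ((r : ℝ) * v 0) = r * (normal i * v 0) by ring]
    exact ⟨fun h => by nlinarith, fun h => mul_neg_of_pos_of_neg hr h⟩
  unfold inDensity
  by_cases h : v ∈ incoming i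
  · rw [indicator_of_mem (by exact h1.mpr h), indicator_of_mem (by exact h),
      ← ENNReal.ofReal_mul hr.le]
    simp [abs_mul, abs_of_pos hr]
  · rw [indicator_of_notMem (by exact fun h2 => h (h1.mp h2)), indicator_of_notMem (by exact h),
      mul_zero]

lemma measurePreserving_polarVec_fluxOut (i : Fin 2) :
    MeasurePreserving polarVec ((Measure.volumeIoiPow 3).prod (fluxOut i))
      (volume.withDensity (outDensity i)) := by
  have h := measurePreserving_polarVec.withDensity_comp (measurable_outDensity i)
  rw [volumeIoiPow_three, fluxOut_eq, prod_withDensity (by fun_prop)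
    (show Measurable fun ω : S2 => outDensity i (ω : E3) from
      (measurable_outDensity i).comp measurable_subtype_coe)]
  convert h using 3 with p
  exact (outDensity_smul i p.1 (p.2 : E3)).symm

lemma measurePreserving_polarVec_fluxIn (i : Fin 2) :
    MeasurePreserving polarVec ((Measure.volumeIoiPow 3).prod (fluxIn i))
      (volume.withDensity (inDensity i)) := by
  have h := measurePreserving_polarVec.withDensity_comp (measurable_inDensity i)
  rw [volumeIoiPow_three, fluxIn_eq, prod_withDensity (by fun_prop)
    (show Measurable fun ω : S2 => inDensity i (ω : E3) from
      (measurable_inDensity i).comp measurable_subtype_coe)]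
  convert h using 3 with p
  exact (inDensity_smul i p.1 (p.2 : E3)).symm

/-- Time, position and speed at a wall. -/
abbrev Base := ℝ × E2 × Ioi (0 : ℝ)

/-- The measure `r³ dt dξ dr`; the Jacobian of polar coordinates is `r²`, and the density `|v_x|`
contributes one more factor `r`. -/
noncomputable def baseMeasure : Measure Base :=
  volume.prod (volume.prod (Measure.volumeIoiPow 3))

instance : SigmaFinite baseMeasure := by
  unfold baseMeasure
  infer_instance

/-- Polar coordinates at a wall. -/
def polar (p : Base × S2) : ℝ × E2 × E3 := (p.1.1, p.1.2.1, (p.1.2.2 : ℝ) • (p.2 : E3))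

lemma measurable_polar : Measurable polar :=
  Continuous.measurable (by unfold polar; fun_prop)

/-- The measure `|v_x| dt dξ dv` on the outgoing velocities. -/
noncomputable def wallOut (i : Fin 2) : Measure (ℝ × E2 × E3) :=
  volume.withDensity fun q => outDensity i q.2.2

/-- The measure `|v_x| dt dξ dv` on the incoming velocities. -/
noncomputable def wallIn (i : Fin 2) : Measure (ℝ × E2 × E3) :=
  volume.withDensity fun q => inDensity i q.2.2

lemma measurePreserving_reassoc {μ : Measure S2} [SFinite μ] {ν : Measure E3} [SFinite ν]
    (h : MeasurePreserving polarVec ((Measure.volumeIoiPow 3).prod μ) ν) :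
    MeasurePreserving polar (baseMeasure.prod μ)
      ((volume : Measure ℝ).prod ((volume : Measure E2).prod ν)) := by
  have h1 : MeasurePreserving (Prod.map id (Prod.map id polarVec))
      ((volume : Measure ℝ).prod ((volume : Measure E2).prod ((Measure.volumeIoiPow 3).prod μ)))
      ((volume : Measure ℝ).prod ((volume : Measure E2).prod ν)) :=
    (MeasurePreserving.id _).prod ((MeasurePreserving.id _).prod h)
  have h2 := measurePreserving_prodAssoc (volume : Measure ℝ)
    ((volume : Measure E2).prod (Measure.volumeIoiPow 3)) μ
  have h3 := (MeasurePreserving.id (volume : Measure ℝ)).prod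
    (measurePreserving_prodAssoc (volume : Measure E2) (Measure.volumeIoiPow 3) μ)
  exact h1.comp (h3.comp h2)

lemma measurePreserving_polar_out (i : Fin 2) :
    MeasurePreserving polar (baseMeasure.prod (fluxOut i)) (wallOut i) := by
  have h := measurePreserving_reassoc (measurePreserving_polarVec_fluxOut i)
  rw [prod_withDensity_right (measurable_outDensity i), prod_withDensity_right
    (show Measurable fun z : E2 × E3 => outDensity i z.2 from
      (measurable_outDensity i).comp measurable_snd)] at h
  exact h

lemma measurePreserving_polar_in (i : Fin 2) :
    MeasurePreserving polar (baseMeasure.prod (fluxIn i)) (wallIn i) := by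
  have h := measurePreserving_reassoc (measurePreserving_polarVec_fluxIn i)
  rw [prod_withDensity_right (measurable_inDensity i), prod_withDensity_right
    (show Measurable fun z : E2 × E3 => inDensity i z.2 from
      (measurable_inDensity i).comp measurable_snd)] at h
  exact h

lemma wallOut_absolutelyContinuous (i : Fin 2) : wallOut i ≪ volume :=
  withDensity_absolutelyContinuous _ _

lemma wallIn_absolutelyContinuous (i : Fin 2) : wallIn i ≪ volume :=
  withDensity_absolutelyContinuous _ _

/-- The surface measure is invariant under the antipodal map. -/
lemma measurePreserving_neg_surf : MeasurePreserving (fun ω : S2 => -ω) surf surf := by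
  refine ⟨Continuous.measurable (by fun_prop), ?_⟩
  ext s hs
  have hneg : Measurable fun ω : S2 => -ω := Continuous.measurable (by fun_prop)
  rw [Measure.map_apply hneg hs, surf, Measure.toSphere_apply' _ (hneg hs),
    Measure.toSphere_apply' _ hs]
  congr 1
  rw [← Measure.measure_neg]
  congr 1
  ext v
  simp only [Set.mem_neg, Set.mem_smul, Set.mem_image]
  constructor
  · rintro ⟨r, hr, _, ⟨ω, hω, rfl⟩, h⟩
    refine ⟨r, hr, _, ⟨-ω, hω, rfl⟩, ?_⟩
    simp [h]
  · rintro ⟨r, hr, _, ⟨ω, hω, rfl⟩, h⟩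
    refine ⟨r, hr, _, ⟨-ω, by simpa using hω, rfl⟩, ?_⟩
    simp [← h]

lemma inDensity_neg (i : Fin 2) (v : E3) : inDensity i (-v) = outDensity i v := by
  have h : -v ∈ incoming i ↔ v ∈ outgoing i := by
    simp [incoming, outgoing]
  by_cases hv : v ∈ outgoing i
  · rw [inDensity, outDensity, indicator_of_mem (by exact h.mpr hv), indicator_of_mem (by exact hv)]
    simp
  · rw [inDensity, outDensity, indicator_of_notMem (by exact fun h2 => hv (h.mp h2)),
      indicator_of_notMem (by exact hv)]

lemma measurePreserving_neg_fluxOut (i : Fin 2) :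
    MeasurePreserving (fun ω : S2 => -ω) (fluxOut i) (fluxIn i) := by
  have h := measurePreserving_neg_surf.withDensity_comp (g := fun ω : S2 => inDensity i (ω : E3))
    ((measurable_inDensity i).comp measurable_subtype_coe)
  rw [fluxOut_eq, fluxIn_eq]
  have e : (fun ω : S2 => outDensity i (ω : E3))
      = (fun ω : S2 => inDensity i (ω : E3)) ∘ fun ω : S2 => -ω :=
    funext fun ω => (inDensity_neg i ω).symm
  rw [e]
  exact h

lemma measurePreserving_neg_fluxIn (i : Fin 2) :
    MeasurePreserving (fun ω : S2 => -ω) (fluxIn i) (fluxOut i) := by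
  have h := measurePreserving_neg_surf.withDensity_comp (g := fun ω : S2 => outDensity i (ω : E3))
    ((measurable_outDensity i).comp measurable_subtype_coe)
  rw [fluxOut_eq, fluxIn_eq]
  have e : (fun ω : S2 => inDensity i (ω : E3))
      = (fun ω : S2 => outDensity i (ω : E3)) ∘ fun ω : S2 => -ω :=
    funext fun ω => by
      simp only [Function.comp, coe_neg_sphere]
      rw [← inDensity_neg, neg_neg]
  rw [e]
  exact h

/-! ### Dissipation at the walls -/

section Abstract

variable {X Y : Type*} [MeasurableSpace X] [MeasurableSpace Y] {μ : Measure X} {ν : Measure Y}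
  [SFinite μ] [SFinite ν] {k : X × Y → ℝ} {u : X → ℝ} {w : Y → ℝ}

/-- If a nonnegative kernel has total mass one in its second variable, it maps functions of the
first variable isometrically to functions on the product. -/
lemma integrable_kernel_mul_fst (hk : Measurable k) (hk0 : ∀ᵐ p ∂(μ.prod ν), 0 ≤ k p)
    (hk1 : ∀ᵐ x ∂μ, ∫ y, k (x, y) ∂ν = 1) (hu : Integrable u μ) :
    Integrable (fun p : X × Y => k p * u p.1) (μ.prod ν)
      ∧ ∫ p, k p * u p.1 ∂(μ.prod ν) = ∫ x, u x ∂μ := by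
  have hm : AEStronglyMeasurable (fun p : X × Y => k p * u p.1) (μ.prod ν) :=
    hk.aestronglyMeasurable.mul hu.1.comp_fst
  have hk0' := Measure.ae_ae_of_ae_prod hk0
  have hi : Integrable (fun p : X × Y => k p * u p.1) (μ.prod ν) := by
    rw [integrable_prod_iff hm]
    constructor
    · filter_upwards [hk1] with x hx
      have : Integrable (fun y => k (x, y)) ν := by
        by_contra h
        rw [integral_undef h] at hx
        exact zero_ne_one hx
      exact this.mul_const _
    · refine hu.norm.congr ?_
      filter_upwards [hk1, hk0'] with x hx hx0
      have : ∫ y, ‖k (x, y) * u x‖ ∂ν = ∫ y, k (x, y) * ‖u x‖ ∂ν := by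
        refine integral_congr_ae ?_
        filter_upwards [hx0] with y hy
        rw [norm_mul, Real.norm_of_nonneg hy]
      rw [this, integral_mul_const, hx, one_mul]
  refine ⟨hi, ?_⟩
  rw [integral_prod _ hi]
  refine integral_congr_ae ?_
  filter_upwards [hk1] with x hx
  rw [integral_mul_const, hx, one_mul]

lemma integrable_kernel_mul_snd (hk : Measurable k) (hk0 : ∀ᵐ p ∂(μ.prod ν), 0 ≤ k p)
    (hk1 : ∀ᵐ y ∂ν, ∫ x, k (x, y) ∂μ = 1) (hw : Integrable w ν) :
    Integrable (fun p : X × Y => k p * w p.2) (μ.prod ν)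
      ∧ ∫ p, k p * w p.2 ∂(μ.prod ν) = ∫ y, w y ∂ν := by
  have hk0' : ∀ᵐ p ∂(ν.prod μ), 0 ≤ k p.swap :=
    (Measure.measurePreserving_swap (μ := ν) (ν := μ)).quasiMeasurePreserving.ae hk0
  obtain ⟨h1, h2⟩ := integrable_kernel_mul_fst (k := k ∘ Prod.swap) (hk.comp measurable_swap)
    hk0' hk1 hw
  refine ⟨h1.swap, ?_⟩
  rw [← h2]
  exact (integral_prod_swap (fun p : X × Y => k p * w p.2)).symm

/-- A doubly stochastic kernel decreases the `L²` norm, and the loss is a quadratic form in the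
differences. -/
lemma integral_kernel_mul_sub_sq (hk : Measurable k) (hk0 : ∀ᵐ p ∂(μ.prod ν), 0 ≤ k p)
    (hk1 : ∀ᵐ x ∂μ, ∫ y, k (x, y) ∂ν = 1) (hk2 : ∀ᵐ y ∂ν, ∫ x, k (x, y) ∂μ = 1)
    (hu : MemLp u 2 μ) (hw : MemLp w 2 ν) (huw : ∀ᵐ y ∂ν, w y = ∫ x, k (x, y) * u x ∂μ) :
    Integrable (fun p : X × Y => k p * (u p.1 - w p.2) ^ 2) (μ.prod ν)
      ∧ ∫ p, k p * (u p.1 - w p.2) ^ 2 ∂(μ.prod ν) = ∫ x, u x ^ 2 ∂μ - ∫ y, w y ^ 2 ∂ν := by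
  obtain ⟨i1, e1⟩ := integrable_kernel_mul_fst hk hk0 hk1 hu.integrable_sq
  obtain ⟨i2, e2⟩ := integrable_kernel_mul_snd hk hk0 hk2 hw.integrable_sq
  have i3 : Integrable (fun p : X × Y => k p * (u p.1 * w p.2)) (μ.prod ν) := by
    refine (i1.add i2).mono (hk.aestronglyMeasurable.mul (hu.1.comp_fst.mul hw.1.comp_snd)) ?_
    filter_upwards [hk0] with p hp
    simp only [Pi.add_apply]
    rw [← mul_add, norm_mul, norm_mul (k p)]
    refine mul_le_mul_of_nonneg_left ?_ (norm_nonneg (k p))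
    rw [Real.norm_eq_abs, Real.norm_of_nonneg (by positivity), abs_mul]
    nlinarith [sq_nonneg (|u p.1| - |w p.2|), sq_abs (u p.1), sq_abs (w p.2)]
  have e3 : ∫ p, k p * (u p.1 * w p.2) ∂(μ.prod ν) = ∫ y, w y ^ 2 ∂ν := by
    rw [integral_prod_symm _ i3]
    refine integral_congr_ae ?_
    filter_upwards [huw] with y hy
    rw [sq]
    nth_rewrite 2 [hy]
    rw [← integral_mul_const]
    refine integral_congr_ae (Eventually.of_forall fun x => ?_)
    simp only
    ring
  have heq : (fun p : X × Y => k p * (u p.1 - w p.2) ^ 2)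
      = fun p => k p * u p.1 ^ 2 - 2 * (k p * (u p.1 * w p.2)) + k p * w p.2 ^ 2 := by
    funext p
    ring
  have i4 := i1.sub (i3.const_mul 2)
  refine ⟨?_, ?_⟩
  · rw [heq]
    exact i4.add i2
  · rw [heq]
    have := integral_add i4 i2
    simp only [Pi.sub_apply] at this
    rw [this, integral_sub i1 (i3.const_mul 2), integral_const_mul, e1, e2, e3]
    ring

end Abstract

section Reflection

variable {K : E2 → ℝ → E3 → E3 → ℝ} {T : ℝ}

/-- Reciprocity turns the conservation of flux into the preservation of constants. -/
lemma IsReflectionKernel.integral_fluxOut (hK : IsReflectionKernel K) (ξ : E2) {ε : ℝ}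
    (hε : 0 < ε) (i : Fin 2) :
    ∀ᵐ ω : S2 ∂(fluxIn i), ∫ ω' : S2, K ξ ε (ω' : E3) (ω : E3) ∂(fluxOut i) = 1 := by
  have h1 := (measurePreserving_neg_fluxIn i).quasiMeasurePreserving.ae
    (hK.flux_conservation ξ ε hε i)
  have hin : ∀ᵐ ω : S2 ∂(fluxIn i), (ω : E3) ∈ incoming i :=
    (withDensity_absolutelyContinuous _ _).ae_le
      (ae_restrict_mem (measurable_subtype_coe (measurableSet_incoming i)))
  have hout : ∀ᵐ ω : S2 ∂(fluxOut i), (ω : E3) ∈ outgoing i :=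
    (withDensity_absolutelyContinuous _ _).ae_le
      (ae_restrict_mem (measurable_subtype_coe (measurableSet_outgoing i)))
  filter_upwards [h1, hin] with ω hω hω'
  rw [← hω, ← (measurePreserving_neg_fluxOut i).integral_comp
    (Homeomorph.neg S2).toMeasurableEquiv.measurableEmbedding]
  refine integral_congr_ae ?_
  filter_upwards [hout] with ω' h'
  exact hK.reciprocity ξ ε hε i ω ω' hω' h'

end Reflection

section Dissipation

variable {K : E2 → ℝ → E3 → E3 → ℝ} {i : Fin 2} {w : ℝ × E2 × E3 → ℝ}

/-- The reflection kernel in the variables `(b, ω', ω)`. -/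
noncomputable def baseKernel (K : E2 → ℝ → E3 → E3 → ℝ) (z : Base × S2 × S2) : ℝ :=
  K z.1.2.1 ((z.1.2.2 : ℝ) ^ 2 / 2) (z.2.1 : E3) (z.2.2 : E3)

lemma IsReflectionKernel.measurable_baseKernel (hK : IsReflectionKernel K) :
    Measurable (baseKernel K) := by
  have h : Measurable fun z : Base × S2 × S2 =>
      ((z.1.2.1, (z.1.2.2 : ℝ) ^ 2 / 2, z.2.1, z.2.2) : E2 × ℝ × S2 × S2) :=
    Continuous.measurable (by fun_prop)
  exact hK.measurable.comp h

lemma base_energy_pos (b : Base) : 0 < (b.2.2 : ℝ) ^ 2 / 2 := by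
  have : (0 : ℝ) < b.2.2 := b.2.2.2
  positivity

lemma IsReflectionKernel.ae_baseKernel_pos (hK : IsReflectionKernel K) (i : Fin 2) :
    ∀ᵐ z ∂(baseMeasure.prod ((fluxOut i).prod (fluxIn i))), 0 < baseKernel K z := by
  rw [Measure.ae_prod_iff_ae_ae (measurableSet_lt measurable_const hK.measurable_baseKernel)]
  exact Eventually.of_forall fun b => hK.positivity b.2.1 _ (base_energy_pos b) i

/-- A function near the wall `i` that is square integrable for `|v_x| dt dξ dv` and satisfies the
reflection law. -/
structure IsReflected (K : E2 → ℝ → E3 → E3 → ℝ) (i : Fin 2) (w : ℝ × E2 × E3 → ℝ) : Prop where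
  measurable : Measurable w
  memOut : MemLp w 2 (wallOut i)
  memIn : MemLp w 2 (wallIn i)
  reflection : ∀ᵐ p ∂(baseMeasure.prod (fluxIn i)),
    w (polar p) = ∫ ω' : S2, baseKernel K (p.1, ω', p.2) * w (polar (p.1, ω')) ∂(fluxOut i)

/-- The energy loss at the wall `i`. -/
noncomputable def dissipation (i : Fin 2) (w : ℝ × E2 × E3 → ℝ) : ℝ :=
  ∫ q, w q ^ 2 ∂(wallOut i) - ∫ q, w q ^ 2 ∂(wallIn i)

lemma integral_wallOut (i : Fin 2) {g : ℝ × E2 × E3 → ℝ} (hg : Measurable g) :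
    ∫ q, g q ∂(wallOut i) = ∫ p, g (polar p) ∂(baseMeasure.prod (fluxOut i)) := by
  rw [← (measurePreserving_polar_out i).map_eq,
    integral_map measurable_polar.aemeasurable hg.aestronglyMeasurable]

lemma integral_wallIn (i : Fin 2) {g : ℝ × E2 × E3 → ℝ} (hg : Measurable g) :
    ∫ q, g q ∂(wallIn i) = ∫ p, g (polar p) ∂(baseMeasure.prod (fluxIn i)) := by
  rw [← (measurePreserving_polar_in i).map_eq,
    integral_map measurable_polar.aemeasurable hg.aestronglyMeasurable]

/-- The difference of the values of `w` at the outgoing and at the incoming direction. -/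
def jump (w : ℝ × E2 × E3 → ℝ) (z : Base × S2 × S2) : ℝ :=
  w (polar (z.1, z.2.1)) - w (polar (z.1, z.2.2))

lemma measurable_jump (hw : Measurable w) : Measurable (jump w) := by
  have h1 : Measurable fun z : Base × S2 × S2 => (z.1, z.2.1) := by fun_prop
  have h2 : Measurable fun z : Base × S2 × S2 => (z.1, z.2.2) := by fun_prop
  exact (hw.comp (measurable_polar.comp h1)).sub (hw.comp (measurable_polar.comp h2))

/-- The energy loss at a wall is a quadratic form in the jumps. -/
lemma IsReflected.dissipation_eq (hK : IsReflectionKernel K) (hw : IsReflected K i w) :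
    Integrable (fun z => baseKernel K z * jump w z ^ 2)
        (baseMeasure.prod ((fluxOut i).prod (fluxIn i)))
      ∧ ∫ z, baseKernel K z * jump w z ^ 2 ∂(baseMeasure.prod ((fluxOut i).prod (fluxIn i)))
        = dissipation i w := by
  have ho : Integrable (fun p => w (polar p) ^ 2) (baseMeasure.prod (fluxOut i)) :=
    (hw.memOut.comp_measurePreserving (measurePreserving_polar_out i)).integrable_sq
  have hi : Integrable (fun p => w (polar p) ^ 2) (baseMeasure.prod (fluxIn i)) :=
    (hw.memIn.comp_measurePreserving (measurePreserving_polar_in i)).integrable_sq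
  have hsec : ∀ b : Base, Measurable fun ω : S2 => w (polar (b, ω)) := fun b =>
    hw.measurable.comp (measurable_polar.comp measurable_prodMk_left)
  have hkpos := hK.ae_baseKernel_pos i
  have hfib : ∀ᵐ b ∂baseMeasure,
      Integrable (fun p : S2 × S2 => baseKernel K (b, p) * jump w (b, p) ^ 2)
        ((fluxOut i).prod (fluxIn i))
      ∧ ∫ p : S2 × S2, baseKernel K (b, p) * jump w (b, p) ^ 2 ∂((fluxOut i).prod (fluxIn i))
        = ∫ ω, w (polar (b, ω)) ^ 2 ∂(fluxOut i) - ∫ ω, w (polar (b, ω)) ^ 2 ∂(fluxIn i) := by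
    filter_upwards [ho.prod_right_ae, hi.prod_right_ae, Measure.ae_ae_of_ae_prod hw.reflection]
      with b h1 h2 h3
    have hk : Measurable fun p : S2 × S2 => baseKernel K (b, p) :=
      hK.measurable_baseKernel.comp measurable_prodMk_left
    have k0 : ∀ᵐ p ∂((fluxOut i).prod (fluxIn i)), 0 ≤ baseKernel K (b, p) :=
      (hK.positivity b.2.1 _ (base_energy_pos b) i).mono fun p hp => hp.le
    have k1 := hK.flux_conservation b.2.1 _ (base_energy_pos b) i
    have k2 := hK.integral_fluxOut b.2.1 (base_energy_pos b) i
    have m1 : MemLp (fun ω => w (polar (b, ω))) 2 (fluxOut i) :=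
      (memLp_two_iff_integrable_sq (hsec b).aestronglyMeasurable).mpr h1
    have m2 : MemLp (fun ω => w (polar (b, ω))) 2 (fluxIn i) :=
      (memLp_two_iff_integrable_sq (hsec b).aestronglyMeasurable).mpr h2
    exact integral_kernel_mul_sub_sq (k := fun p : S2 × S2 => baseKernel K (b, p))
      (u := fun ω => w (polar (b, ω))) (w := fun ω => w (polar (b, ω))) hk k0 k1 k2 m1 m2 h3
  have hm : Measurable fun z => baseKernel K z * jump w z ^ 2 :=
    hK.measurable_baseKernel.mul ((measurable_jump hw.measurable).pow_const 2)
  have hint : Integrable (fun z => baseKernel K z * jump w z ^ 2)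
        (baseMeasure.prod ((fluxOut i).prod (fluxIn i))) := by
    rw [integrable_prod_iff hm.aestronglyMeasurable]
    refine ⟨hfib.mono fun b hb => hb.1, ?_⟩
    refine (ho.integral_prod_left.sub hi.integral_prod_left).congr ?_
    filter_upwards [hfib, Measure.ae_ae_of_ae_prod hkpos] with b hb hb'
    rw [Pi.sub_apply, ← hb.2]
    refine integral_congr_ae ?_
    filter_upwards [hb'] with p hp
    exact (Real.norm_of_nonneg (by positivity)).symm
  refine ⟨hint, ?_⟩
  rw [integral_prod _ hint, dissipation, integral_wallOut i (hw.measurable.pow_const 2),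
    integral_wallIn i (hw.measurable.pow_const 2), integral_prod _ ho, integral_prod _ hi,
    ← integral_sub ho.integral_prod_left hi.integral_prod_left]
  exact integral_congr_ae (hfib.mono fun b hb => hb.2)

lemma IsReflected.dissipation_nonneg (hK : IsReflectionKernel K) (hw : IsReflected K i w) :
    0 ≤ dissipation i w := by
  rw [← (hw.dissipation_eq hK).2]
  refine integral_nonneg_of_ae ?_
  filter_upwards [hK.ae_baseKernel_pos i] with z hz
  simp only [Pi.zero_apply]
  positivity

/-- By Cauchy-Schwarz, the dissipation controls the jumps, tested with a bounded function. -/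
lemma IsReflected.abs_integral_jump_le (hK : IsReflectionKernel K) (hw : IsReflected K i w)
    {S : Set Base} (hS : MeasurableSet S) (hSf : baseMeasure S < ∞)
    {h : Base × S2 × S2 → ℝ} (hh : Measurable h) (h1 : ∀ z, |h z| ≤ 1) :
    |∫ z, min (baseKernel K z) 1 * jump w z * (S.indicator 1 z.1 * h z)
        ∂(baseMeasure.prod ((fluxOut i).prod (fluxIn i)))|
      ≤ √(dissipation i w)
        * √(∫ z, S.indicator (1 : Base → ℝ) z.1
          ∂(baseMeasure.prod ((fluxOut i).prod (fluxIn i)))) := by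
  set ρ := baseMeasure.prod ((fluxOut i).prod (fluxIn i))
  obtain ⟨hint, heq⟩ := hw.dissipation_eq hK
  have hk := hK.measurable_baseKernel
  have hpos := hK.ae_baseKernel_pos i
  have hSm : Measurable fun z : Base × S2 × S2 => S.indicator (1 : Base → ℝ) z.1 :=
    (measurable_one.indicator hS).comp measurable_fst
  have hSi : Integrable (fun z : Base × S2 × S2 => S.indicator (1 : Base → ℝ) z.1) ρ := by
    have : Integrable (S.indicator (1 : Base → ℝ)) baseMeasure :=
      (integrable_indicator_iff hS).mpr (integrableOn_const hSf.ne)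
    exact this.comp_fst _
  have hu : Measurable fun z => √(baseKernel K z) * jump w z :=
    hk.sqrt.mul (measurable_jump hw.measurable)
  have hv : Measurable fun z => min (baseKernel K z) 1 / √(baseKernel K z)
      * (S.indicator 1 z.1 * h z) :=
    ((hk.min measurable_const).div hk.sqrt).mul (hSm.mul hh)
  have hu2 : (fun z => (√(baseKernel K z) * jump w z) ^ 2)
      =ᵐ[ρ] fun z => baseKernel K z * jump w z ^ 2 := by
    filter_upwards [hpos] with z hz
    rw [mul_pow, Real.sq_sqrt hz.le]
  have hv2 : ∀ᵐ z ∂ρ, (min (baseKernel K z) 1 / √(baseKernel K z)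
      * (S.indicator 1 z.1 * h z)) ^ 2 ≤ S.indicator (1 : Base → ℝ) z.1 := by
    filter_upwards [hpos] with z hz
    have e1 : (min (baseKernel K z) 1) ^ 2 / baseKernel K z ≤ 1 := by
      rw [div_le_one hz]
      have a1 : 0 < min (baseKernel K z) 1 := lt_min hz one_pos
      have a2 := min_le_left (baseKernel K z) 1
      have a3 := min_le_right (baseKernel K z) 1
      nlinarith
    have e2 : h z ^ 2 ≤ 1 := (sq_le_one_iff_abs_le_one _).mpr (h1 z)
    have e3 : 0 ≤ (min (baseKernel K z) 1) ^ 2 / baseKernel K z := by positivity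
    rw [mul_pow, div_pow, Real.sq_sqrt hz.le]
    by_cases hzS : z.1 ∈ S
    · simp only [indicator_of_mem hzS, Pi.one_apply, one_mul]
      nlinarith [sq_nonneg (h z)]
    · simp [indicator_of_notMem hzS]
  have huL : MemLp (fun z => √(baseKernel K z) * jump w z) 2 ρ :=
    (memLp_two_iff_integrable_sq hu.aestronglyMeasurable).mpr (hint.congr hu2.symm)
  have hvi : Integrable (fun z => (min (baseKernel K z) 1 / √(baseKernel K z)
      * (S.indicator 1 z.1 * h z)) ^ 2) ρ := by
    refine hSi.mono (hv.pow_const 2).aestronglyMeasurable ?_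
    filter_upwards [hv2] with z hz
    rw [Real.norm_of_nonneg (sq_nonneg _)]
    exact hz.trans (le_abs_self _)
  have hvL := (memLp_two_iff_integrable_sq hv.aestronglyMeasurable).mpr hvi
  have hcs := abs_integral_mul_le_sqrt huL hvL
  rw [integral_congr_ae hu2, heq] at hcs
  refine le_trans (le_of_eq ?_) (hcs.trans ?_)
  · congr 1
    refine integral_congr_ae ?_
    filter_upwards [hpos] with z hz
    have : √(baseKernel K z) ≠ 0 := (Real.sqrt_pos.mpr hz).ne'
    field_simp
  · exact mul_le_mul_of_nonneg_left (Real.sqrt_le_sqrt (integral_mono_ae hvi hSi hv2))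
      (Real.sqrt_nonneg _)

end Dissipation

/-! ### Vanishing dissipation -/

section Fubini

variable {X Y Z : Type*} [MeasurableSpace X] [MeasurableSpace Y] [MeasurableSpace Z]
  {μ : Measure X} {ν : Measure Y} {κ : Measure Z} [SFinite μ] [SFinite ν] [IsFiniteMeasure κ]

lemma integral_mul_bdd_fst {A : X × Y → ℝ} (hA : Integrable A (μ.prod ν)) {c : X × Y × Z → ℝ}
    (hc : Measurable c) (hc1 : ∀ z, |c z| ≤ 1) :
    Integrable (fun z : X × Y × Z => A (z.1, z.2.1) * c z) (μ.prod (ν.prod κ))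
      ∧ ∫ z : X × Y × Z, A (z.1, z.2.1) * c z ∂(μ.prod (ν.prod κ))
        = ∫ p, A p * ∫ y, c (p.1, p.2, y) ∂κ ∂(μ.prod ν) := by
  have hmp := measurePreserving_prodAssoc μ ν κ
  have h1 : Integrable (fun q : (X × Y) × Z => A q.1 * c (q.1.1, q.1.2, q.2))
      ((μ.prod ν).prod κ) :=
    (hA.comp_fst κ).mul_bdd (c := 1) (hc.comp (by fun_prop)).aestronglyMeasurable
      (Eventually.of_forall fun q => hc1 _)
  have h2 : (fun q : (X × Y) × Z => A q.1 * c (q.1.1, q.1.2, q.2))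
      = (fun z : X × Y × Z => A (z.1, z.2.1) * c z) ∘ MeasurableEquiv.prodAssoc := rfl
  have h3 : Integrable (fun z : X × Y × Z => A (z.1, z.2.1) * c z) (μ.prod (ν.prod κ)) :=
    (hmp.integrable_comp_emb MeasurableEquiv.prodAssoc.measurableEmbedding).mp (h2 ▸ h1)
  refine ⟨h3, ?_⟩
  rw [← hmp.integral_comp MeasurableEquiv.prodAssoc.measurableEmbedding]
  change ∫ q, (fun q : (X × Y) × Z => A q.1 * c (q.1.1, q.1.2, q.2)) q ∂_ = _
  rw [integral_prod _ h1]
  simp only [integral_const_mul]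

lemma integral_mul_bdd_snd [IsFiniteMeasure ν] [SFinite κ] {A : X × Z → ℝ}
    (hA : Integrable A (μ.prod κ)) {c : X × Y × Z → ℝ}
    (hc : Measurable c) (hc1 : ∀ z, |c z| ≤ 1) :
    Integrable (fun z : X × Y × Z => A (z.1, z.2.2) * c z) (μ.prod (ν.prod κ))
      ∧ ∫ z : X × Y × Z, A (z.1, z.2.2) * c z ∂(μ.prod (ν.prod κ))
        = ∫ p, A p * ∫ y, c (p.1, y, p.2) ∂ν ∂(μ.prod κ) := by
  have hmp : MeasurePreserving (Prod.map id Prod.swap : X × Z × Y → X × Y × Z)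
      (μ.prod (κ.prod ν)) (μ.prod (ν.prod κ)) :=
    (MeasurePreserving.id _).prod Measure.measurePreserving_swap
  have hemb : MeasurableEmbedding (Prod.map id Prod.swap : X × Z × Y → X × Y × Z) :=
    (MeasurableEquiv.prodCongr (MeasurableEquiv.refl X)
      (MeasurableEquiv.prodComm (α := Z) (β := Y))).measurableEmbedding
  obtain ⟨h1, h2⟩ := integral_mul_bdd_fst (κ := ν) hA (c := fun z => c (z.1, z.2.2, z.2.1))
    (hc.comp (by fun_prop)) fun z => hc1 _
  refine ⟨(hmp.integrable_comp_emb hemb).mp h1, ?_⟩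
  rw [← hmp.integral_comp hemb]
  exact h2

end Fubini

section Isotropy

variable {K : E2 → ℝ → E3 → E3 → ℝ} {i : Fin 2}

/-- The kernel, truncated to values in `[0, 1]`. -/
noncomputable def cutKernel (K : E2 → ℝ → E3 → E3 → ℝ) (z : Base × S2 × S2) : ℝ :=
  max (min (baseKernel K z) 1) 0

lemma cutKernel_nonneg (z : Base × S2 × S2) : 0 ≤ cutKernel K z := le_max_right _ _

lemma cutKernel_le_one (z : Base × S2 × S2) : cutKernel K z ≤ 1 :=
  max_le (min_le_right _ _) zero_le_one

lemma cutKernel_of_pos {z : Base × S2 × S2} (hz : 0 < baseKernel K z) :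
    cutKernel K z = min (baseKernel K z) 1 := max_eq_left (le_min hz.le zero_le_one)

/-- The weighted mean of the jumps is a difference of two wall integrals. -/
lemma integral_cutKernel_jump (hK : IsReflectionKernel K) {S : Set Base}
    {h : Base × S2 × S2 → ℝ} (hh : Measurable h) (h1 : ∀ z, |h z| ≤ 1)
    {W : ℝ × E2 × E3 → ℝ}
    (ho : Integrable (fun p => W (polar p) * S.indicator 1 p.1) (baseMeasure.prod (fluxOut i)))
    (hi : Integrable (fun p => W (polar p) * S.indicator 1 p.1) (baseMeasure.prod (fluxIn i))) :
    Integrable (fun z => cutKernel K z * jump W z * (S.indicator 1 z.1 * h z))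
      (baseMeasure.prod ((fluxOut i).prod (fluxIn i)))
    ∧ ∫ z, cutKernel K z * jump W z * (S.indicator 1 z.1 * h z)
        ∂(baseMeasure.prod ((fluxOut i).prod (fluxIn i)))
      = ∫ p, W (polar p) * (S.indicator 1 p.1
          * ∫ ω, cutKernel K (p.1, p.2, ω) * h (p.1, p.2, ω) ∂(fluxIn i))
          ∂(baseMeasure.prod (fluxOut i))
        - ∫ p, W (polar p) * (S.indicator 1 p.1
          * ∫ ω', cutKernel K (p.1, ω', p.2) * h (p.1, ω', p.2) ∂(fluxOut i))
          ∂(baseMeasure.prod (fluxIn i)) := by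
  have hcm : Measurable fun z => cutKernel K z * h z :=
    ((hK.measurable_baseKernel.min measurable_const).max measurable_const).mul hh
  have hc1 : ∀ z, |cutKernel K z * h z| ≤ 1 := fun z => by
    rw [abs_mul, abs_of_nonneg (cutKernel_nonneg z)]
    exact mul_le_one₀ (cutKernel_le_one z) (abs_nonneg _) (h1 z)
  obtain ⟨i1, e1⟩ := integral_mul_bdd_fst (κ := fluxIn i) ho hcm hc1
  obtain ⟨i2, e2⟩ := integral_mul_bdd_snd (ν := fluxOut i) hi hcm hc1
  have heq : (fun z => cutKernel K z * jump W z * (S.indicator 1 z.1 * h z))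
      = fun z => W (polar (z.1, z.2.1)) * S.indicator 1 z.1 * (cutKernel K z * h z)
        - W (polar (z.1, z.2.2)) * S.indicator 1 z.1 * (cutKernel K z * h z) := by
    funext z
    rw [jump]
    ring
  rw [heq]
  refine ⟨i1.sub i2, ?_⟩
  rw [integral_sub i1 i2, e1, e2]
  simp only [mul_assoc]

/-- A weak limit of reflected functions whose dissipation tends to zero has no jumps. The jumps of
the sequence, weighted with a bounded test function, tend to zero because the dissipation controls
them, and they converge to the jumps of the limit because they are a difference of two linear
functionals. The convergence of these functionals is assumed in `ho` and `hi`. -/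
lemma ae_jump_eq_zero_of_tendsto (hK : IsReflectionKernel K) {𝒰 : Filter ℕ} [𝒰.NeBot]
    {w : ℕ → ℝ × E2 × E3 → ℝ} (hw : ∀ n, IsReflected K i (w n))
    (hd : Tendsto (fun n => dissipation i (w n)) 𝒰 (𝓝 0)) {S : Set Base} (hS : MeasurableSet S)
    (hSf : baseMeasure S < ∞) {Γ : ℝ × E2 × E3 → ℝ} (hΓ : Measurable Γ)
    (hΓo : Integrable (fun p => Γ (polar p) * S.indicator 1 p.1) (baseMeasure.prod (fluxOut i)))
    (hΓi : Integrable (fun p => Γ (polar p) * S.indicator 1 p.1) (baseMeasure.prod (fluxIn i)))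
    (ho : ∀ m : Base × S2 → ℝ, Measurable m → (∃ C, ∀ p, |m p| ≤ C) →
      Tendsto (fun n => ∫ p, w n (polar p) * (S.indicator 1 p.1 * m p)
        ∂(baseMeasure.prod (fluxOut i))) 𝒰
        (𝓝 (∫ p, Γ (polar p) * (S.indicator 1 p.1 * m p) ∂(baseMeasure.prod (fluxOut i)))))
    (hi : ∀ m : Base × S2 → ℝ, Measurable m → (∃ C, ∀ p, |m p| ≤ C) →
      Tendsto (fun n => ∫ p, w n (polar p) * (S.indicator 1 p.1 * m p)
        ∂(baseMeasure.prod (fluxIn i))) 𝒰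
        (𝓝 (∫ p, Γ (polar p) * (S.indicator 1 p.1 * m p) ∂(baseMeasure.prod (fluxIn i))))) :
    ∀ᵐ z ∂(baseMeasure.prod ((fluxOut i).prod (fluxIn i))), z.1 ∈ S → jump Γ z = 0 := by
  set ρ := baseMeasure.prod ((fluxOut i).prod (fluxIn i)) with hρ
  -- a bounded test function with the sign of the jump
  set h : Base × S2 × S2 → ℝ := fun z => jump Γ z / (1 + |jump Γ z|) with hh
  have hhm : Measurable h :=
    (measurable_jump hΓ).div ((measurable_jump hΓ).abs.const_add 1)
  have h1 : ∀ z, |h z| ≤ 1 := fun z => by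
    have : (0 : ℝ) < 1 + |jump Γ z| := by positivity
    rw [hh, abs_div, abs_of_pos this, div_le_one this]
    linarith
  have hcm : Measurable fun z => cutKernel K z * h z :=
    ((hK.measurable_baseKernel.min measurable_const).max measurable_const).mul hhm
  have hc1 : ∀ z, |cutKernel K z * h z| ≤ 1 := fun z => by
    rw [abs_mul, abs_of_nonneg (cutKernel_nonneg z)]
    exact mul_le_one₀ (cutKernel_le_one z) (abs_nonneg _) (h1 z)
  have hpos := hK.ae_baseKernel_pos i
  have hS2 : MemLp (fun b => S.indicator (1 : Base → ℝ) b) 2 baseMeasure :=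
    memLp_indicator_const 2 hS 1 (Or.inr hSf.ne)
  have hwo : ∀ n, Integrable (fun p => w n (polar p) * S.indicator 1 p.1)
      (baseMeasure.prod (fluxOut i)) := fun n =>
    ((hw n).memOut.comp_measurePreserving (measurePreserving_polar_out i)).integrable_mul
      (hS2.comp_fst _)
  have hwi : ∀ n, Integrable (fun p => w n (polar p) * S.indicator 1 p.1)
      (baseMeasure.prod (fluxIn i)) := fun n =>
    ((hw n).memIn.comp_measurePreserving (measurePreserving_polar_in i)).integrable_mul
      (hS2.comp_fst _)
  -- the weighted jumps pass to the weak limit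
  have hlim : Tendsto (fun n => ∫ z, cutKernel K z * jump (w n) z * (S.indicator 1 z.1 * h z) ∂ρ)
      𝒰 (𝓝 (∫ z, cutKernel K z * jump Γ z * (S.indicator 1 z.1 * h z) ∂ρ)) := by
    rw [hρ, (integral_cutKernel_jump hK hhm h1 hΓo hΓi).2]
    simp_rw [fun n => (integral_cutKernel_jump hK hhm h1 (hwo n) (hwi n)).2]
    refine (ho _ ?_ ⟨(fluxIn i).real univ, fun p => ?_⟩).sub
      (hi _ ?_ ⟨(fluxOut i).real univ, fun p => ?_⟩)
    · have : StronglyMeasurable fun q : (Base × S2) × S2 =>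
          cutKernel K (q.1.1, q.1.2, q.2) * h (q.1.1, q.1.2, q.2) :=
        (hcm.comp (g := fun z : Base × S2 × S2 => cutKernel K z * h z)
          (f := fun q : (Base × S2) × S2 => (q.1.1, q.1.2, q.2)) (by fun_prop)).stronglyMeasurable
      exact this.integral_prod_right.measurable
    · refine (norm_integral_le_of_norm_le_const (C := 1)
        (f := fun ω => cutKernel K (p.1, p.2, ω) * h (p.1, p.2, ω))
        (Eventually.of_forall fun ω => hc1 _)).trans ?_
      rw [one_mul]
    · have : StronglyMeasurable fun q : (Base × S2) × S2 =>
          cutKernel K (q.1.1, q.2, q.1.2) * h (q.1.1, q.2, q.1.2) :=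
        (hcm.comp (g := fun z : Base × S2 × S2 => cutKernel K z * h z)
          (f := fun q : (Base × S2) × S2 => (q.1.1, q.2, q.1.2)) (by fun_prop)).stronglyMeasurable
      exact this.integral_prod_right.measurable
    · refine (norm_integral_le_of_norm_le_const (C := 1)
        (f := fun ω' => cutKernel K (p.1, ω', p.2) * h (p.1, ω', p.2))
        (Eventually.of_forall fun ω => hc1 _)).trans ?_
      rw [one_mul]
  have hzero : Tendsto
      (fun n => ∫ z, cutKernel K z * jump (w n) z * (S.indicator 1 z.1 * h z) ∂ρ) 𝒰 (𝓝 0) := by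
    have hb : Tendsto (fun n => √(dissipation i (w n))
        * √(∫ z, S.indicator (1 : Base → ℝ) z.1 ∂ρ)) 𝒰 (𝓝 0) := by
      have := (hd.sqrt).mul_const (√(∫ z, S.indicator (1 : Base → ℝ) z.1 ∂ρ))
      simpa using this
    refine squeeze_zero_norm (fun n => ?_) hb
    have := (hw n).abs_integral_jump_le hK hS hSf hhm h1
    refine le_trans (le_of_eq ?_) this
    rw [Real.norm_eq_abs]
    congr 1
    refine integral_congr_ae ?_
    filter_upwards [hpos] with z hz
    rw [cutKernel_of_pos hz]
  have hfin := tendsto_nhds_unique hlim hzero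
  have hint := (integral_cutKernel_jump hK hhm h1 hΓo hΓi).1
  have hnn : 0 ≤ fun z => cutKernel K z * jump Γ z * (S.indicator 1 z.1 * h z) := fun z => by
    have e : cutKernel K z * jump Γ z * (S.indicator 1 z.1 * h z)
        = cutKernel K z * S.indicator 1 z.1 * (jump Γ z ^ 2 / (1 + |jump Γ z|)) := by
      rw [hh]
      ring
    simp only [Pi.zero_apply]
    rw [e]
    refine mul_nonneg (mul_nonneg (cutKernel_nonneg z) ?_) (by positivity)
    exact indicator_nonneg (fun _ _ => zero_le_one) _
  -- the limit is the integral of `jump² / (1 + |jump|)`, with a positive weight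
  rw [integral_eq_zero_iff_of_nonneg hnn hint] at hfin
  filter_upwards [hfin, hpos] with z hz hzp hzS
  simp only [Pi.zero_apply, indicator_of_mem hzS, Pi.one_apply, one_mul] at hz
  have hcp : 0 < cutKernel K z := by
    rw [cutKernel_of_pos hzp]
    exact lt_min hzp one_pos
  rcases mul_eq_zero.mp hz with h2 | h2
  · exact (mul_eq_zero.mp h2).resolve_left hcp.ne'
  · have : (1 : ℝ) + |jump Γ z| ≠ 0 := by positivity
    exact (div_eq_zero_iff.mp h2).resolve_right this

end Isotropy

/-! ### Functions of the speed -/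

lemma ae_vx_ne_zero : ∀ᵐ v : E3, v 0 ≠ 0 := by
  have h : volume ((LinearMap.ker (EuclideanSpace.proj (0 : Fin 3) : E3 →L[ℝ] ℝ).toLinearMap
      : Submodule ℝ E3) : Set E3) = 0 := by
    refine Measure.addHaar_submodule _ _ fun htop => ?_
    have : EuclideanSpace.single (0 : Fin 3) (1 : ℝ)
        ∈ LinearMap.ker (EuclideanSpace.proj (0 : Fin 3) : E3 →L[ℝ] ℝ).toLinearMap := by
      rw [htop]
      trivial
    simp at this
  rw [ae_iff]
  refine measure_mono_null (fun v hv => ?_) h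
  simpa using hv

lemma ae_wall_vx_ne_zero : ∀ᵐ q : ℝ × E2 × E3, q.2.2 0 ≠ 0 := by
  have hm : Measure.QuasiMeasurePreserving (fun q : ℝ × E2 × E3 => q.2.2) volume volume :=
    Measure.quasiMeasurePreserving_snd.comp Measure.quasiMeasurePreserving_snd
  exact hm.ae ae_vx_ne_zero

lemma fluxIn_ne_zero (i : Fin 2) : fluxIn i ≠ 0 := by
  intro h
  have h1 : ∀ᵐ ω : S2 ∂surf, inDensity i (ω : E3) = 0 := by
    rw [fluxIn_eq, withDensity_eq_zero_iff] at h
    · exact h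
    · exact ((measurable_inDensity i).comp measurable_subtype_coe).aemeasurable
  have hopen : IsOpen {ω : S2 | (ω : E3) ∈ incoming i} := by
    have : Continuous fun ω : S2 => normal i * (ω : E3) 0 := by fun_prop
    exact isOpen_lt this continuous_const
  have hne : ({ω : S2 | (ω : E3) ∈ incoming i}).Nonempty := by
    refine ⟨⟨EuclideanSpace.single 0 (-normal i), ?_⟩, ?_⟩
    · fin_cases i <;> simp [normal]
    · fin_cases i <;> simp [normal, incoming]
  have hpos : 0 < surf {ω : S2 | (ω : E3) ∈ incoming i} := by
    unfold surf
    exact hopen.measure_pos _ hne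
  refine hpos.ne' (measure_mono_null (fun ω hω => ?_) (ae_iff.mp h1))
  have hω' : (ω : E3) ∈ incoming i := hω
  have h0 : (ω : E3) 0 ≠ 0 := fun h0 => by simp [incoming, h0] at hω'
  simp only [mem_ofPred_eq]
  rw [inDensity, indicator_of_mem (by exact hω')]
  simpa using h0

lemma fluxOut_ne_zero (i : Fin 2) : fluxOut i ≠ 0 := by
  intro h
  have h1 := (measurePreserving_neg_fluxOut i).map_eq
  rw [h, Measure.map_zero] at h1
  exact fluxIn_ne_zero i h1.symm

/-- The mean of a function near the wall over the outgoing directions. -/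
noncomputable def radialMean (i : Fin 2) (Γ : ℝ × E2 × E3 → ℝ) (b : ℝ × E2 × ℝ) : ℝ :=
  (∫ ω : S2, Γ (b.1, b.2.1, b.2.2 • (ω : E3)) ∂(fluxOut i)) / (fluxOut i).real univ

lemma measurable_radialMean {i : Fin 2} {Γ : ℝ × E2 × E3 → ℝ} (hΓ : Measurable Γ) :
    Measurable (radialMean i Γ) := by
  have h1 : Measurable fun p : (ℝ × E2 × ℝ) × S2 =>
      ((p.1.1, p.1.2.1, p.1.2.2 • (p.2 : E3)) : ℝ × E2 × E3) :=
    Continuous.measurable (by fun_prop)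
  have h2 := StronglyMeasurable.integral_prod_right (ν := fluxOut i)
    (f := fun (b : ℝ × E2 × ℝ) (ω : S2) => Γ (b.1, b.2.1, b.2.2 • (ω : E3)))
    (hΓ.comp h1).stronglyMeasurable
  exact h2.measurable.div_const _

/-- Time, position and speed. -/
noncomputable def speedPoint (q : ℝ × E2 × E3) : ℝ × E2 × ℝ := (q.1, q.2.1, ‖q.2.2‖)

lemma measurable_speedPoint : Measurable speedPoint :=
  Continuous.measurable (by unfold speedPoint; fun_prop)

/-- The inclusion of the base in `ℝ × E2 × ℝ`. -/
def basePoint (b : Base) : ℝ × E2 × ℝ := (b.1, b.2.1, (b.2.2 : ℝ))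

lemma measurable_basePoint : Measurable basePoint :=
  Continuous.measurable (by unfold basePoint; fun_prop)

lemma speedPoint_polar (p : Base × S2) : speedPoint (polar p) = basePoint p.1 := by
  have : (0 : ℝ) < p.1.2.2 := p.1.2.2.2
  simp [speedPoint, polar, basePoint, norm_smul, abs_of_pos this]

/-- A function without jumps depends on the velocity through its modulus only. -/
lemma ae_eq_radialMean {i : Fin 2} {Γ : ℝ × E2 × E3 → ℝ} (hΓ : Measurable Γ)
    {S : Set (ℝ × E2 × ℝ)} (hS : MeasurableSet S)
    (hj : ∀ᵐ z ∂(baseMeasure.prod ((fluxOut i).prod (fluxIn i))),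
      z.1 ∈ basePoint ⁻¹' S → jump Γ z = 0) :
    ∀ᵐ q : ℝ × E2 × E3, speedPoint q ∈ S → Γ q = radialMean i Γ (speedPoint q) := by
  have hmset : MeasurableSet {q : ℝ × E2 × E3 |
      speedPoint q ∈ S → Γ q = radialMean i Γ (speedPoint q)} := by
    have h1 : MeasurableSet {q : ℝ × E2 × E3 | speedPoint q ∈ S} := measurable_speedPoint hS
    have h2 : MeasurableSet {q : ℝ × E2 × E3 | Γ q = radialMean i Γ (speedPoint q)} :=
      measurableSet_eq_fun hΓ ((measurable_radialMean hΓ).comp measurable_speedPoint)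
    exact h1.imp h2
  have hmp : MeasurableSet {p : Base × S2 | speedPoint (polar p) ∈ S →
      Γ (polar p) = radialMean i Γ (speedPoint (polar p))} := measurable_polar hmset
  have hb : ∀ᵐ b ∂baseMeasure, b ∈ basePoint ⁻¹' S →
      (∀ᵐ ω ∂(fluxIn i), Γ (polar (b, ω)) = radialMean i Γ (basePoint b))
      ∧ ∀ᵐ ω ∂(fluxOut i), Γ (polar (b, ω)) = radialMean i Γ (basePoint b) := by
    filter_upwards [Measure.ae_ae_of_ae_prod hj] with b hb hbS
    have h1 : ∀ᵐ p ∂((fluxOut i).prod (fluxIn i)), Γ (polar (b, p.1)) = Γ (polar (b, p.2)) :=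
      hb.mono fun p hp => sub_eq_zero.mp (hp hbS)
    have h2 : ∀ᵐ p ∂((fluxIn i).prod (fluxOut i)), Γ (polar (b, p.2)) = Γ (polar (b, p.1)) :=
      (Measure.measurePreserving_swap (μ := fluxIn i)
        (ν := fluxOut i)).quasiMeasurePreserving.ae h1
    have h3 := Measure.ae_ae_of_ae_prod h1
    have h4 := Measure.ae_ae_of_ae_prod h2
    have hin : ∀ᵐ ω ∂(fluxIn i), Γ (polar (b, ω)) = radialMean i Γ (basePoint b) := by
      filter_upwards [h4] with ω hω
      have : ∫ ω' : S2, Γ (b.1, b.2.1, (b.2.2 : ℝ) • (ω' : E3)) ∂(fluxOut i)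
          = ∫ _, Γ (polar (b, ω)) ∂(fluxOut i) := integral_congr_ae hω
      rw [radialMean]
      simp only [basePoint]
      rw [this, integral_const, smul_eq_mul, mul_div_cancel_left₀]
      rw [measureReal_def, ENNReal.toReal_ne_zero]
      exact ⟨fun h => fluxOut_ne_zero i (Measure.measure_univ_eq_zero.mp h), measure_ne_top _ _⟩
    refine ⟨hin, ?_⟩
    filter_upwards [h3] with ω' hω'
    have : (ae (fluxIn i)).NeBot := ae_neBot.mpr (fluxIn_ne_zero i)
    obtain ⟨ω, e1, e2⟩ := (hω'.and hin).exists
    rw [e1, e2]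
  have hIn : ∀ᵐ q ∂(wallIn i), speedPoint q ∈ S → Γ q = radialMean i Γ (speedPoint q) := by
    rw [← (measurePreserving_polar_in i).map_eq, ae_map_iff measurable_polar.aemeasurable hmset,
      Measure.ae_prod_iff_ae_ae hmp]
    filter_upwards [hb] with b hb
    by_cases hbS : b ∈ basePoint ⁻¹' S
    · filter_upwards [(hb hbS).1] with ω hω _
      rw [speedPoint_polar, hω]
    · refine Eventually.of_forall fun ω h => absurd ?_ hbS
      rw [speedPoint_polar] at h
      exact h
  have hOut : ∀ᵐ q ∂(wallOut i), speedPoint q ∈ S → Γ q = radialMean i Γ (speedPoint q) := by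
    rw [← (measurePreserving_polar_out i).map_eq, ae_map_iff measurable_polar.aemeasurable hmset,
      Measure.ae_prod_iff_ae_ae hmp]
    filter_upwards [hb] with b hb
    by_cases hbS : b ∈ basePoint ⁻¹' S
    · filter_upwards [(hb hbS).2] with ω hω _
      rw [speedPoint_polar, hω]
    · refine Eventually.of_forall fun ω h => absurd ?_ hbS
      rw [speedPoint_polar] at h
      exact h
  have hIn' := (ae_withDensity_iff (f := fun q : ℝ × E2 × E3 => inDensity i q.2.2)
    ((measurable_inDensity i).comp (measurable_snd.comp measurable_snd))).mp hIn
  have hOut' := (ae_withDensity_iff (f := fun q : ℝ × E2 × E3 => outDensity i q.2.2)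
    ((measurable_outDensity i).comp (measurable_snd.comp measurable_snd))).mp hOut
  filter_upwards [hIn', hOut', ae_wall_vx_ne_zero] with q h1 h2 h0
  have hn : normal i ≠ 0 := by fin_cases i <;> simp [normal]
  rcases lt_or_gt_of_ne (mul_ne_zero hn h0) with h | h
  · refine h1 ?_
    rw [inDensity, indicator_of_mem (by exact h)]
    simpa using h0
  · refine h2 ?_
    rw [outDensity, indicator_of_mem (by exact h)]
    simpa using h0

/-! ### Cut off traces -/

lemma toReal_outDensity (i : Fin 2) (v : E3) :
    (outDensity i v).toReal = (outgoing i).indicator (fun v => normal i * v 0) v := by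
  by_cases h : v ∈ outgoing i
  · rw [outDensity, indicator_of_mem (by exact h), indicator_of_mem h,
      ENNReal.toReal_ofReal (abs_nonneg _), ← abs_of_pos (show 0 < normal i * v 0 from h), abs_mul]
    have : |normal i| = 1 := by fin_cases i <;> simp [normal]
    rw [this, one_mul]
  · rw [outDensity, indicator_of_notMem (by exact h), indicator_of_notMem h]
    simp

lemma toReal_inDensity (i : Fin 2) (v : E3) :
    (inDensity i v).toReal = (incoming i).indicator (fun v => -(normal i * v 0)) v := by
  by_cases h : v ∈ incoming i
  · rw [inDensity, indicator_of_mem (by exact h), indicator_of_mem h,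
      ENNReal.toReal_ofReal (abs_nonneg _), ← abs_of_neg (show normal i * v 0 < 0 from h), abs_mul]
    have : |normal i| = 1 := by fin_cases i <;> simp [normal]
    rw [this, one_mul]
  · rw [inDensity, indicator_of_notMem (by exact h), indicator_of_notMem h]
    simp

lemma toReal_outDensity_sub (i : Fin 2) (v : E3) :
    (outDensity i v).toReal - (inDensity i v).toReal = normal i * v 0 := by
  rw [toReal_outDensity, toReal_inDensity]
  rcases lt_trichotomy (normal i * v 0) 0 with h | h | h
  · rw [indicator_of_notMem (by exact not_lt.mpr h.le), indicator_of_mem (by exact h)]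
    ring
  · rw [indicator_of_notMem (by exact not_lt.mpr h.le),
      indicator_of_notMem (by exact not_lt.mpr h.ge), h, sub_zero]
  · rw [indicator_of_notMem (s := incoming i) (by exact not_lt.mpr h.le),
      indicator_of_mem (by exact h), sub_zero]

lemma measurable_outDensity_wall (i : Fin 2) :
    Measurable fun q : ℝ × E2 × E3 => outDensity i q.2.2 :=
  (measurable_outDensity i).comp (measurable_snd.comp measurable_snd)

lemma measurable_inDensity_wall (i : Fin 2) :
    Measurable fun q : ℝ × E2 × E3 => inDensity i q.2.2 :=
  (measurable_inDensity i).comp (measurable_snd.comp measurable_snd)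

lemma outDensity_lt_top (i : Fin 2) (v : E3) : outDensity i v < ∞ := by
  unfold outDensity indicator
  split_ifs <;> simp

lemma inDensity_lt_top (i : Fin 2) (v : E3) : inDensity i v < ∞ := by
  unfold inDensity indicator
  split_ifs <;> simp

lemma integral_wallOut_eq (i : Fin 2) (g : ℝ × E2 × E3 → ℝ) :
    ∫ q, g q ∂(wallOut i) = ∫ q, (outDensity i q.2.2).toReal * g q :=
  integral_withDensity_eq_integral_toReal_smul (measurable_outDensity_wall i)
    (Eventually.of_forall fun _ => outDensity_lt_top i _) g

lemma integral_wallIn_eq (i : Fin 2) (g : ℝ × E2 × E3 → ℝ) :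
    ∫ q, g q ∂(wallIn i) = ∫ q, (inDensity i q.2.2).toReal * g q :=
  integral_withDensity_eq_integral_toReal_smul (measurable_inDensity_wall i)
    (Eventually.of_forall fun _ => inDensity_lt_top i _) g

lemma integrable_wallOut_iff (i : Fin 2) (g : ℝ × E2 × E3 → ℝ) :
    Integrable g (wallOut i) ↔ Integrable fun q => (outDensity i q.2.2).toReal * g q :=
  integrable_withDensity_iff_integrable_smul' (measurable_outDensity_wall i)
    (Eventually.of_forall fun _ => outDensity_lt_top i _)

lemma integrable_wallIn_iff (i : Fin 2) (g : ℝ × E2 × E3 → ℝ) :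
    Integrable g (wallIn i) ↔ Integrable fun q => (inDensity i q.2.2).toReal * g q :=
  integrable_withDensity_iff_integrable_smul' (measurable_inDensity_wall i)
    (Eventually.of_forall fun _ => inDensity_lt_top i _)

lemma toReal_outDensity_le (i : Fin 2) (v : E3) : (outDensity i v).toReal ≤ |v 0| := by
  unfold outDensity indicator
  split_ifs <;> simp

lemma toReal_inDensity_le (i : Fin 2) (v : E3) : (inDensity i v).toReal ≤ |v 0| := by
  unfold inDensity indicator
  split_ifs <;> simp

section Cutoff

variable {K : E2 → ℝ → E3 → E3 → ℝ} {i : Fin 2} {T : ℝ} {γ : ℝ × E2 × E3 → ℝ}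
  {χ : ℝ × E2 × E3 → ℝ}

lemma aestronglyMeasurable_cutoff_mul_trace (h : ∀ R, MemLp γ 2 (wallMeasure T R))
    (hχ : IsRadialCutoff T χ) : AEStronglyMeasurable (fun q => χ q * γ q) volume := by
  obtain ⟨R, D, -, -, hR, -⟩ := hχ.exists_bounds
  have h1 := (memLp_vx_mul_trace_mul h hχ.contDiff.continuous.measurable hχ.le_one hR).1
  refine (h1.mul (measurable_wall_vx.inv.aestronglyMeasurable)).congr ?_
  filter_upwards [ae_wall_vx_ne_zero] with q hq
  simp only [Pi.mul_apply, Pi.inv_apply]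
  field_simp

lemma IsRadialCutoff.polar_eq (hχ : IsRadialCutoff T χ) (b : Base) (ω ω' : S2) :
    χ (polar (b, ω)) = χ (polar (b, ω')) := by
  obtain ⟨h, -, hq⟩ := hχ.radial
  rw [hq, hq]
  simp [polar, norm_smul]

lemma reflect_polar (p : Base × S2) (γ : ℝ × E2 × E3 → ℝ) :
    reflect K i (polar p).2.1 (fun v' => γ ((polar p).1, (polar p).2.1, v')) (polar p).2.2
      = ∫ ω' : S2, baseKernel K (p.1, ω', p.2) * γ (polar (p.1, ω')) ∂(fluxOut i) := by
  have hr : (0 : ℝ) < p.1.2.2 := p.1.2.2.2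
  have hn : ‖(polar p).2.2‖ = p.1.2.2 := by
    simp [polar, norm_smul, abs_of_pos hr]
  have hd : (p.1.2.2 : ℝ)⁻¹ • (polar p).2.2 = (p.2 : E3) := by
    simp only [polar]
    rw [smul_smul, inv_mul_cancel₀ hr.ne', one_smul]
  rw [reflect, hn, hd]
  rfl

/-- A radial cutoff of the trace is square integrable and satisfies the reflection law. -/
lemma exists_isReflected (h : ∀ R, MemLp γ 2 (wallMeasure T R))
    (hr : ∀ᵐ q ∂(volume.restrict (Ioo 0 T ×ˢ ((univ : Set E2) ×ˢ incoming i))),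
      γ q = reflect K i q.2.1 (fun v' => γ (q.1, q.2.1, v')) q.2.2)
    (hχ : IsRadialCutoff T χ) :
    ∃ w, IsReflected K i w ∧ w =ᵐ[volume] (fun q => χ q * γ q)
      ∧ dissipation i w = normal i * ∫ q, q.2.2 0 * γ q ^ 2 * χ q ^ 2 := by
  obtain ⟨R, D, -, -, hR, -⟩ := hχ.exists_bounds
  have hsm := aestronglyMeasurable_cutoff_mul_trace h hχ
  set w := hsm.mk with hw
  have hwm : Measurable w := hsm.stronglyMeasurable_mk.measurable
  have hwe : w =ᵐ[volume] fun q => χ q * γ q := hsm.ae_eq_mk.symm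
  have hχ2 : Measurable fun q => χ q ^ 2 := hχ.contDiff.continuous.measurable.pow_const 2
  have hint : Integrable fun q => |q.2.2 0| * γ q ^ 2 * χ q ^ 2 :=
    integrable_abs_vx_mul_sq_mul (h R) hχ2 (C := 1)
      (fun q => by
        rw [abs_of_nonneg (sq_nonneg _)]
        exact (sq_le_one_iff_abs_le_one _).mpr (hχ.le_one q))
      fun q hq => hR q fun h0 => hq (by simp [h0])
  have hOut : Integrable fun q => (outDensity i q.2.2).toReal * w q ^ 2 := by
    refine hint.mono (((measurable_outDensity_wall i).ennreal_toReal.mul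
      (hwm.pow_const 2)).aestronglyMeasurable) ?_
    filter_upwards [hwe] with q hq
    rw [Real.norm_of_nonneg (by positivity), Real.norm_of_nonneg (by positivity), hq]
    calc _ ≤ |q.2.2 0| * (χ q * γ q) ^ 2 :=
          mul_le_mul_of_nonneg_right (toReal_outDensity_le i _) (sq_nonneg _)
      _ = _ := by ring
  have hIn : Integrable fun q => (inDensity i q.2.2).toReal * w q ^ 2 := by
    refine hint.mono (((measurable_inDensity_wall i).ennreal_toReal.mul
      (hwm.pow_const 2)).aestronglyMeasurable) ?_
    filter_upwards [hwe] with q hq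
    rw [Real.norm_of_nonneg (by positivity), Real.norm_of_nonneg (by positivity), hq]
    calc _ ≤ |q.2.2 0| * (χ q * γ q) ^ 2 :=
          mul_le_mul_of_nonneg_right (toReal_inDensity_le i _) (sq_nonneg _)
      _ = _ := by ring
  refine ⟨w, ⟨hwm, ?_, ?_, ?_⟩, hwe, ?_⟩
  · exact (memLp_two_iff_integrable_sq hwm.aestronglyMeasurable).mpr
      ((integrable_wallOut_iff i _).mpr hOut)
  · exact (memLp_two_iff_integrable_sq hwm.aestronglyMeasurable).mpr
      ((integrable_wallIn_iff i _).mpr hIn)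
  · have qI := (measurePreserving_polar_in i).quasiMeasurePreserving
    have qO := (measurePreserving_polar_out i).quasiMeasurePreserving
    have h1 := qI.ae ((wallIn_absolutelyContinuous i).ae_le hwe)
    have h2 := Measure.ae_ae_of_ae_prod (qO.ae ((wallOut_absolutelyContinuous i).ae_le hwe))
    have h2' : ∀ᵐ p ∂(baseMeasure.prod (fluxIn i)), ∀ᵐ ω' ∂(fluxOut i),
        w (polar (p.1, ω')) = χ (polar (p.1, ω')) * γ (polar (p.1, ω')) :=
      Measure.quasiMeasurePreserving_fst.ae h2
    have hset : MeasurableSet (Ioo 0 T ×ˢ ((univ : Set E2) ×ˢ incoming i)) :=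
      measurableSet_Ioo.prod (MeasurableSet.univ.prod (measurableSet_incoming i))
    have h3 := qI.ae ((wallIn_absolutelyContinuous i).ae_le ((ae_restrict_iff' hset).mp hr))
    have hinc : ∀ᵐ q ∂(wallIn i), q.2.2 ∈ incoming i := by
      rw [wallIn, ae_withDensity_iff (measurable_inDensity_wall i)]
      refine Eventually.of_forall fun q hq => ?_
      by_contra hc
      exact hq (by rw [inDensity, indicator_of_notMem (by exact hc)])
    filter_upwards [h1, h2', h3, qI.ae hinc] with p e1 e2 e3 e4
    rw [e1]
    have e5 : ∫ ω' : S2, baseKernel K (p.1, ω', p.2) * w (polar (p.1, ω')) ∂(fluxOut i)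
        = χ (polar p) * ∫ ω' : S2, baseKernel K (p.1, ω', p.2) * γ (polar (p.1, ω'))
          ∂(fluxOut i) := by
      rw [← integral_const_mul]
      refine integral_congr_ae ?_
      filter_upwards [e2] with ω' hω'
      rw [hω', hχ.polar_eq p.1 ω' p.2]
      ring
    rw [e5]
    by_cases h0 : χ (polar p) = 0
    · rw [h0, zero_mul, zero_mul]
    · rw [e3 ⟨(hR _ h0).1, mem_univ _, e4⟩, reflect_polar]
  · rw [dissipation, integral_wallOut_eq, integral_wallIn_eq, ← integral_sub hOut hIn,
      ← integral_const_mul]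
    refine integral_congr_ae ?_
    filter_upwards [hwe] with q hq
    rw [hq, ← sub_mul, toReal_outDensity_sub]
    ring

end Cutoff

/-! ### Weak limits with vanishing dissipation -/

open Classical in
/-- A left inverse of polar coordinates; the values at `v = 0` are arbitrary. -/
noncomputable def polarInv (q : ℝ × E2 × E3) : Base × S2 :=
  ((q.1, q.2.1, ⟨if q.2.2 = 0 then 1 else ‖q.2.2‖, by
      split_ifs with h
      · exact mem_Ioi.mpr one_pos
      · exact norm_pos_iff.mpr h⟩),
    ⟨if q.2.2 = 0 then EuclideanSpace.single 0 1 else ‖q.2.2‖⁻¹ • q.2.2, by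
      split_ifs with h
      · simp
      · have := norm_ne_zero_iff.mpr h
        simp [norm_smul, this]⟩)

lemma polarInv_polar (p : Base × S2) : polarInv (polar p) = p := by
  have hr : (0 : ℝ) < p.1.2.2 := p.1.2.2.2
  have hn : ‖(polar p).2.2‖ = p.1.2.2 := by
    simp [polar, norm_smul, abs_of_pos hr]
  have h0 : (polar p).2.2 ≠ 0 := by
    rw [← norm_ne_zero_iff, hn]
    exact hr.ne'
  simp only [polarInv, if_neg h0, hn]
  refine Prod.ext rfl (Subtype.ext ?_)
  simp only [polar]
  rw [smul_smul, inv_mul_cancel₀ hr.ne', one_smul]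

lemma measurable_polarInv : Measurable polarInv := by
  have hs : MeasurableSet {q : ℝ × E2 × E3 | q.2.2 = 0} :=
    measurableSet_eq_fun (measurable_snd.comp measurable_snd) measurable_const
  have h1 : Measurable fun q : ℝ × E2 × E3 => if q.2.2 = 0 then (1 : ℝ) else ‖q.2.2‖ :=
    Measurable.ite hs measurable_const (by fun_prop)
  have h2 : Measurable fun q : ℝ × E2 × E3 =>
      if q.2.2 = 0 then (EuclideanSpace.single 0 1 : E3) else ‖q.2.2‖⁻¹ • q.2.2 :=
    Measurable.ite hs measurable_const (by fun_prop)
  unfold polarInv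
  exact Measurable.prodMk (Measurable.prodMk (by fun_prop)
    (Measurable.prodMk (by fun_prop) (h1.subtype_mk))) (h2.subtype_mk)

section WeakLimit

variable {K : E2 → ℝ → E3 → E3 → ℝ} {i : Fin 2}

/-- Weak limits of traces with vanishing dissipation are radial in the velocity: `G` is the weak
limit of `v_x w`, so that the limit of `w` itself is `G / v_x`. -/
lemma exists_radial_of_weak_limit (hK : IsReflectionKernel K) {𝒰 : Filter ℕ} [𝒰.NeBot]
    {w : ℕ → ℝ × E2 × E3 → ℝ} (hw : ∀ n, IsReflected K i (w n))
    (hd : Tendsto (fun n => dissipation i (w n)) 𝒰 (𝓝 0))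
    {G : ℝ × E2 × E3 → ℝ} (hGm : Measurable G) (hG : MemLp G 2 volume)
    (hlim : ∀ g : ℝ × E2 × E3 → ℝ, MemLp g 2 volume →
      Tendsto (fun n => ∫ q, q.2.2 0 * w n q * g q) 𝒰 (𝓝 (∫ q, G q * g q)))
    {S : Set (ℝ × E2 × ℝ)} (hS : MeasurableSet S) (hSf : volume (speedPoint ⁻¹' S) < ∞)
    (hSb : baseMeasure (basePoint ⁻¹' S) < ∞) :
    ∃ r : ℝ × E2 × ℝ → ℝ, Measurable r ∧
      ∀ᵐ q : ℝ × E2 × E3, speedPoint q ∈ S → G q = q.2.2 0 * r (speedPoint q) := by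
  set Γ : ℝ × E2 × E3 → ℝ := fun q => G q / q.2.2 0 with hΓ
  have hΓm : Measurable Γ := hGm.div measurable_wall_vx
  have hn : normal i ^ 2 = 1 := by fin_cases i <;> simp [normal]
  -- the weights that turn `v_x dt dξ dv` into the measures of the outgoing and incoming fluxes
  set so : E3 → ℝ := (outgoing i).indicator fun _ => normal i with hso
  set si : E3 → ℝ := (incoming i).indicator fun _ => -normal i with hsi
  have hsom : Measurable fun q : ℝ × E2 × E3 => so q.2.2 :=
    (measurable_const.indicator (measurableSet_outgoing i)).comp
      (measurable_snd.comp measurable_snd)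
  have hsim : Measurable fun q : ℝ × E2 × E3 => si q.2.2 :=
    (measurable_const.indicator (measurableSet_incoming i)).comp
      (measurable_snd.comp measurable_snd)
  have hn1 : |normal i| = 1 := by fin_cases i <;> simp [normal]
  have hso1 : ∀ v, |so v| ≤ 1 := fun v => by
    by_cases h : v ∈ outgoing i <;> simp [hso, h, hn1]
  have hsi1 : ∀ v, |si v| ≤ 1 := fun v => by
    by_cases h : v ∈ incoming i <;> simp [hsi, h, hn1]
  have hoE : ∀ v, (outDensity i v).toReal = v 0 * so v := fun v => by
    rw [toReal_outDensity]
    by_cases h : v ∈ outgoing i <;> simp [hso, h, mul_comm]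
  have hiE : ∀ v, (inDensity i v).toReal = v 0 * si v := fun v => by
    rw [toReal_inDensity]
    by_cases h : v ∈ incoming i <;> simp [hsi, h, mul_comm]
  have hSm : Measurable fun q => (S.indicator 1 (speedPoint q) : ℝ) :=
    (measurable_one.indicator hS).comp measurable_speedPoint
  have hgL : ∀ (s : ℝ × E2 × E3 → ℝ), Measurable s → (∃ C, ∀ q, |s q| ≤ C) →
      MemLp (fun q => s q * S.indicator (1 : ℝ × E2 × ℝ → ℝ) (speedPoint q)) 2 volume := by
    rintro s hs ⟨C, hC⟩
    have h1 : MemLp ((speedPoint ⁻¹' S).indicator fun _ => C) 2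
        (volume : Measure (ℝ × E2 × E3)) :=
      memLp_indicator_const 2 (measurable_speedPoint hS) C (Or.inr hSf.ne)
    refine h1.mono (hs.mul hSm).aestronglyMeasurable (Eventually.of_forall fun q => ?_)
    by_cases hq : speedPoint q ∈ S
    · rw [indicator_of_mem hq, indicator_of_mem (by exact hq)]
      simpa using (hC q).trans (le_abs_self C)
    · rw [indicator_of_notMem hq]
      simp
  have hbI : ∀ p : Base × S2, (basePoint ⁻¹' S).indicator (1 : Base → ℝ) p.1
      = S.indicator 1 (speedPoint (polar p)) := fun p => by
    rw [speedPoint_polar]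
    rfl
  have key : ∀ᵐ q : ℝ × E2 × E3, q.2.2 0 * Γ q = G q := by
    filter_upwards [ae_wall_vx_ne_zero] with q hq
    rw [hΓ]
    field_simp
  have hIo : Integrable (fun q => Γ q * S.indicator (1 : ℝ × E2 × ℝ → ℝ) (speedPoint q))
      (wallOut i) := by
    rw [integrable_wallOut_iff]
    refine (hG.integrable_mul (hgL _ hsom ⟨1, fun q => hso1 _⟩)).congr ?_
    filter_upwards [key] with q hq
    simp only [Pi.mul_apply]
    rw [← hq, hoE]
    ring
  have hIi : Integrable (fun q => Γ q * S.indicator (1 : ℝ × E2 × ℝ → ℝ) (speedPoint q))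
      (wallIn i) := by
    rw [integrable_wallIn_iff]
    refine (hG.integrable_mul (hgL _ hsim ⟨1, fun q => hsi1 _⟩)).congr ?_
    filter_upwards [key] with q hq
    simp only [Pi.mul_apply]
    rw [← hq, hiE]
    ring
  refine ⟨radialMean i Γ, measurable_radialMean hΓm, ?_⟩
  have hj := ae_jump_eq_zero_of_tendsto hK hw hd (measurable_basePoint hS) hSb hΓm ?_ ?_ ?_ ?_
  · filter_upwards [ae_eq_radialMean hΓm hS hj, key] with q h1 h2 hqS
    rw [← h2, h1 hqS]
  · have := (measurePreserving_polar_out i).integrable_comp_of_integrable hIo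
    simp only [hbI]
    exact this
  · have := (measurePreserving_polar_in i).integrable_comp_of_integrable hIi
    simp only [hbI]
    exact this
  · rintro m hm ⟨C, hC⟩
    have hmm : Measurable fun q => m (polarInv q) := hm.comp measurable_polarInv
    have hbase : ∀ W : ℝ × E2 × E3 → ℝ, Measurable W →
        ∫ p, W (polar p) * ((basePoint ⁻¹' S).indicator 1 p.1 * m p)
          ∂(baseMeasure.prod (fluxOut i))
        = ∫ q, q.2.2 0 * W q * (so q.2.2 * m (polarInv q) * S.indicator 1 (speedPoint q)) := by
      intro W hW
      have h1 := integral_wallOut i (hW.mul (hSm.mul hmm))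
      simp only [Pi.mul_apply, polarInv_polar] at h1
      simp only [hbI]
      rw [← h1, integral_wallOut_eq]
      refine integral_congr_ae (Eventually.of_forall fun q => ?_)
      simp only [hoE]
      ring
    simp_rw [fun n => hbase (w n) (hw n).measurable, hbase Γ hΓm]
    have h2 := hlim _ (hgL (fun q => so q.2.2 * m (polarInv q)) (hsom.mul hmm) ⟨C, fun q => by
      rw [abs_mul]
      exact (mul_le_of_le_one_left (abs_nonneg _) (hso1 _)).trans (hC _)⟩)
    convert h2 using 2
    refine integral_congr_ae ?_
    filter_upwards [key] with q hq
    rw [hq]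
  · rintro m hm ⟨C, hC⟩
    have hmm : Measurable fun q => m (polarInv q) := hm.comp measurable_polarInv
    have hbase : ∀ W : ℝ × E2 × E3 → ℝ, Measurable W →
        ∫ p, W (polar p) * ((basePoint ⁻¹' S).indicator 1 p.1 * m p)
          ∂(baseMeasure.prod (fluxIn i))
        = ∫ q, q.2.2 0 * W q * (si q.2.2 * m (polarInv q) * S.indicator 1 (speedPoint q)) := by
      intro W hW
      have h1 := integral_wallIn i (hW.mul (hSm.mul hmm))
      simp only [Pi.mul_apply, polarInv_polar] at h1
      simp only [hbI]
      rw [← h1, integral_wallIn_eq]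
      refine integral_congr_ae (Eventually.of_forall fun q => ?_)
      simp only [hiE]
      ring
    simp_rw [fun n => hbase (w n) (hw n).measurable, hbase Γ hΓm]
    have h2 := hlim _ (hgL (fun q => si q.2.2 * m (polarInv q)) (hsim.mul hmm) ⟨C, fun q => by
      rw [abs_mul]
      exact (mul_le_of_le_one_left (abs_nonneg _) (hsi1 _)).trans (hC _)⟩)
    convert h2 using 2
    refine integral_congr_ae ?_
    filter_upwards [key] with q hq
    rw [hq]

end WeakLimit

/-! ### Weak limits in `L²` -/

section Weak

variable {X : Type*} [MeasurableSpace X] {μ : Measure X}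

lemma inner_toLp {f g : X → ℝ} (hf : MemLp f 2 μ) (hg : MemLp g 2 μ) :
    inner ℝ (hf.toLp f) (hg.toLp g) = ∫ x, f x * g x ∂μ := by
  rw [L2.inner_def]
  refine integral_congr_ae ?_
  filter_upwards [hf.coeFn_toLp, hg.coeFn_toLp] with x h1 h2
  rw [h1, h2]
  simp [mul_comm]

/-- A bounded sequence in `L²` has a weak limit along every ultrafilter. -/
lemma exists_weak_limit {u : ℕ → X → ℝ} (hu : ∀ n, MemLp (u n) 2 μ) {C : ℝ}
    (hC : ∀ n, ∫ x, u n x ^ 2 ∂μ ≤ C) (𝒰 : Ultrafilter ℕ) :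
    ∃ G : X → ℝ, Measurable G ∧ MemLp G 2 μ ∧ ∀ g : X → ℝ, MemLp g 2 μ →
      Tendsto (fun n => ∫ x, u n x * g x ∂μ) 𝒰 (𝓝 (∫ x, G x * g x ∂μ)) := by
  let ℓ : ℕ → WeakDual ℝ (Lp ℝ 2 μ) := fun n =>
    StrongDual.toWeakDual (InnerProductSpace.toDual ℝ (Lp ℝ 2 μ) ((hu n).toLp (u n)))
  have hmem : ∀ n, ℓ n ∈ WeakDual.toStrongDual ⁻¹'
      Metric.closedBall (0 : StrongDual ℝ (Lp ℝ 2 μ)) (√C) := by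
    intro n
    rw [mem_preimage, mem_closedBall_zero_iff]
    have h1 : ‖(hu n).toLp (u n)‖ ≤ √C := by
      refine Real.le_sqrt_of_sq_le ?_
      rw [← real_inner_self_eq_norm_sq, inner_toLp]
      simpa only [← sq] using hC n
    calc _ = ‖InnerProductSpace.toDual ℝ (Lp ℝ 2 μ) ((hu n).toLp (u n))‖ := rfl
      _ ≤ _ := by rwa [LinearIsometryEquiv.norm_map]
  have hcomp := WeakDual.isCompact_closedBall (𝕜 := ℝ) (0 : StrongDual ℝ (Lp ℝ 2 μ)) (√C)
  obtain ⟨L, -, hL⟩ := hcomp.ultrafilter_le_nhds (𝒰.map ℓ) (by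
    rw [le_principal_iff]
    exact mem_map.mpr (Eventually.of_forall hmem))
  have hL' : Tendsto ℓ 𝒰 (𝓝 L) := hL
  let G : Lp ℝ 2 μ := (InnerProductSpace.toDual ℝ (Lp ℝ 2 μ)).symm (WeakDual.toStrongDual L)
  have hGm := (Lp.memLp G)
  refine ⟨hGm.1.mk G, hGm.1.stronglyMeasurable_mk.measurable, hGm.ae_eq hGm.1.ae_eq_mk,
    fun g hg => ?_⟩
  have h1 : Tendsto (fun n => ℓ n (hg.toLp g)) 𝒰 (𝓝 (L (hg.toLp g))) :=
    ((WeakDual.eval_continuous (hg.toLp g)).tendsto L).comp hL'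
  have h2 : ∀ n, ℓ n (hg.toLp g) = ∫ x, u n x * g x ∂μ := fun n => by
    rw [← inner_toLp (hu n) hg]
    exact InnerProductSpace.toDual_apply_apply
  have h3 : L (hg.toLp g) = ∫ x, hGm.1.mk G x * g x ∂μ := by
    have h4 : inner ℝ G (hg.toLp g) = L (hg.toLp g) := by
      exact InnerProductSpace.toDual_symm_apply
    rw [← h4, L2.inner_def]
    refine integral_congr_ae ?_
    filter_upwards [hg.coeFn_toLp, hGm.1.ae_eq_mk] with x e1 e2
    rw [e1, ← e2]
    simp [mul_comm]
  simp_rw [h2] at h1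
  rwa [h3] at h1

/-- A weakly convergent sequence in `L²` is bounded. -/
lemma exists_bound_of_weakly_convergent {u : ℕ → X → ℝ} (hu : ∀ n, MemLp (u n) 2 μ)
    (h : ∀ g : X → ℝ, MemLp g 2 μ → ∃ c, Tendsto (fun n => ∫ x, u n x * g x ∂μ) atTop (𝓝 c)) :
    ∃ N, ∀ n, ∫ x, u n x ^ 2 ∂μ ≤ N := by
  obtain ⟨C, hC⟩ := banach_steinhaus
    (g := fun n => InnerProductSpace.toDual ℝ (Lp ℝ 2 μ) ((hu n).toLp (u n))) (by
      intro g
      obtain ⟨c, hc⟩ := h g (Lp.memLp g)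
      obtain ⟨C, hC⟩ := hc.norm.bddAbove_range
      refine ⟨C, fun n => ?_⟩
      have h1 : (InnerProductSpace.toDual ℝ (Lp ℝ 2 μ) ((hu n).toLp (u n))) g
          = ∫ x, u n x * g x ∂μ := by
        rw [← inner_toLp (hu n) (Lp.memLp g), Lp.toLp_coeFn]
        exact InnerProductSpace.toDual_apply_apply
      rw [h1]
      exact hC ⟨n, rfl⟩)
  refine ⟨C ^ 2, fun n => ?_⟩
  have h1 := hC n
  rw [LinearIsometryEquiv.norm_map] at h1
  have h2 : ∫ x, u n x ^ 2 ∂μ = ‖(hu n).toLp (u n)‖ ^ 2 := by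
    rw [← real_inner_self_eq_norm_sq, inner_toLp]
    simp only [sq]
  rw [h2]
  gcongr

end Weak

section Spaces

variable {T : ℝ} {f : ℝ × Phase → ℝ}

lemma volume_restrict_slab : (volume.restrict (Ioo 0 T ×ˢ Theta) : Measure (ℝ × Phase))
    = (volume.restrict (Ioo 0 T)).prod (volume.restrict Theta) := by
  rw [Measure.prod_restrict]
  rfl

lemma lintegral_eLpNorm_sq (hf : AEStronglyMeasurable f (volume.restrict (Ioo 0 T ×ˢ Theta))) :
    eLpNorm f 2 (volume.restrict (Ioo 0 T ×ˢ Theta)) ^ (2 : ℝ)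
      = ∫⁻ t in Ioo 0 T, eLpNorm (fun p => f (t, p)) 2 (volume.restrict Theta) ^ (2 : ℝ) := by
  have h : ∀ {Y : Type} [MeasurableSpace Y] (μ : Measure Y) (g : Y → ℝ),
      eLpNorm g 2 μ ^ (2 : ℝ) = ∫⁻ y, ‖g y‖ₑ ^ (2 : ℝ) ∂μ := fun μ g =>
    eLpNorm_nnreal_pow_eq_lintegral (f := g) (p := 2) two_ne_zero
  rw [volume_restrict_slab] at hf ⊢
  rw [h, lintegral_prod _ (hf.enorm.pow_const 2)]
  simp only [h]

lemma MemLinftyL2.memLp (hf : MemLinftyL2 T f) :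
    MemLp f 2 (volume.restrict (Ioo 0 T ×ˢ Theta)) := by
  obtain ⟨h1, M, hM⟩ := hf
  refine ⟨h1, ?_⟩
  have h2 : eLpNorm f 2 (volume.restrict (Ioo 0 T ×ˢ Theta)) ^ (2 : ℝ) < ∞ := by
    rw [lintegral_eLpNorm_sq h1]
    calc _ ≤ ∫⁻ t in Ioo 0 T, (M : ℝ≥0∞) ^ (2 : ℝ) := by
          refine lintegral_mono_ae (hM.mono fun t ht => ?_)
          gcongr
      _ < ∞ := by
          rw [lintegral_const]
          refine ENNReal.mul_lt_top (ENNReal.rpow_lt_top_of_nonneg (by norm_num)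
            ENNReal.coe_ne_top) ?_
          simp
  by_contra h3
  rw [not_lt, top_le_iff] at h3
  rw [h3, ENNReal.top_rpow_of_pos (by norm_num)] at h2
  exact lt_irrefl _ h2

lemma memL1L2_of_memLp (hf : MemLp f 2 (volume.restrict (Ioo 0 T ×ˢ Theta))) : MemL1L2 T f := by
  refine ⟨hf.1, ?_⟩
  have h1 : ∫⁻ t in Ioo 0 T, eLpNorm (fun p => f (t, p)) 2 (volume.restrict Theta) ^ (2 : ℝ)
      < ∞ := by
    rw [← lintegral_eLpNorm_sq hf.1]
    exact ENNReal.rpow_lt_top_of_nonneg (by norm_num) hf.2.ne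
  calc _ ≤ ∫⁻ t in Ioo 0 T,
        (1 + eLpNorm (fun p => f (t, p)) 2 (volume.restrict Theta) ^ (2 : ℝ)) := by
        refine lintegral_mono fun t => ?_
        set a := eLpNorm (fun p => f (t, p)) 2 (volume.restrict Theta)
        rcases le_total a 1 with h | h
        · exact h.trans le_self_add
        · refine le_trans ?_ le_add_self
          simpa using ENNReal.rpow_le_rpow_of_exponent_le h (show (1 : ℝ) ≤ 2 by norm_num)
    _ < ∞ := by
        rw [lintegral_add_left measurable_const]
        refine ENNReal.add_lt_top.mpr ⟨?_, h1⟩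
        simp

end Spaces

/-! ### Cutoffs -/

/-- The cutoff used on the region `1/k ≤ t ≤ T - 1/k`, `|ξ| ≤ k`, `|v| ≤ k`. -/
noncomputable def cutoff (T : ℝ) (k : ℕ) (q : ℝ × E2 × E3) : ℝ :=
  Real.smoothTransition (2 * k * q.1 - 1) * Real.smoothTransition (2 * k * (T - q.1) - 1)
    * (Real.smoothTransition (k ^ 2 + 1 - ‖q.2.1‖ ^ 2)
      * Real.smoothTransition (k ^ 2 + 1 - ‖q.2.2‖ ^ 2))

lemma cutoff_nonneg (T : ℝ) (k : ℕ) (q : ℝ × E2 × E3) : 0 ≤ cutoff T k q := by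
  unfold cutoff
  have := Real.smoothTransition.nonneg
  exact mul_nonneg (mul_nonneg (this _) (this _)) (mul_nonneg (this _) (this _))

lemma cutoff_eq_one {T : ℝ} {k : ℕ} {q : ℝ × E2 × E3} (h1 : 1 ≤ k * q.1)
    (h2 : 1 ≤ k * (T - q.1)) (h3 : ‖q.2.1‖ ≤ k) (h4 : ‖q.2.2‖ ≤ k) : cutoff T k q = 1 := by
  have e3 : ‖q.2.1‖ ^ 2 ≤ (k : ℝ) ^ 2 := by gcongr
  have e4 : ‖q.2.2‖ ^ 2 ≤ (k : ℝ) ^ 2 := by gcongr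
  unfold cutoff
  rw [Real.smoothTransition.one_of_one_le (by linarith),
    Real.smoothTransition.one_of_one_le (by linarith),
    Real.smoothTransition.one_of_one_le (by linarith),
    Real.smoothTransition.one_of_one_le (by linarith)]
  norm_num

lemma cutoff_support {T : ℝ} {k : ℕ} (hk : 0 < k) {q : ℝ × E2 × E3} (h : cutoff T k q ≠ 0) :
    q ∈ Icc (1 / (2 * k : ℝ)) (T - 1 / (2 * k)) ×ˢ
      (Metric.closedBall (0 : E2) (k + 1) ×ˢ Metric.closedBall (0 : E3) (k + 1)) := by
  have hk' : (0 : ℝ) < k := by exact_mod_cast hk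
  have hpos : ∀ {x : ℝ}, Real.smoothTransition x ≠ 0 → 0 < x := fun {x} hx => by
    by_contra hc
    exact hx (Real.smoothTransition.zero_of_nonpos (not_lt.mp hc))
  unfold cutoff at h
  have a1 := hpos (left_ne_zero_of_mul (left_ne_zero_of_mul h))
  have a2 := hpos (right_ne_zero_of_mul (left_ne_zero_of_mul h))
  have a3 := hpos (left_ne_zero_of_mul (right_ne_zero_of_mul h))
  have a4 := hpos (right_ne_zero_of_mul (right_ne_zero_of_mul h))
  refine ⟨⟨?_, ?_⟩, ?_, ?_⟩
  · rw [div_le_iff₀ (by positivity)]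
    linarith
  · rw [le_sub_iff_add_le, ← le_sub_iff_add_le', div_le_iff₀ (by positivity)]
    linarith
  · rw [mem_closedBall_zero_iff]
    exact le_of_sq_le_sq (by nlinarith) (by positivity)
  · rw [mem_closedBall_zero_iff]
    exact le_of_sq_le_sq (by nlinarith) (by positivity)

lemma isRadialCutoff_cutoff (T : ℝ) {k : ℕ} (hk : 0 < k) : IsRadialCutoff T (cutoff T k) := by
  have hk' : (0 : ℝ) < k := by exact_mod_cast hk
  have hs : ContDiff ℝ 1 Real.smoothTransition := Real.smoothTransition.contDiff
  set A := Icc (1 / (2 * k : ℝ)) (T - 1 / (2 * k)) ×ˢ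
      (Metric.closedBall (0 : E2) (k + 1) ×ˢ Metric.closedBall (0 : E3) (k + 1)) with hA
  have hAc : IsCompact A :=
    isCompact_Icc.prod ((isCompact_closedBall _ _).prod (isCompact_closedBall _ _))
  have hsub : tsupport (cutoff T k) ⊆ A :=
    closure_minimal (fun q hq => cutoff_support hk hq) hAc.isClosed
  constructor
  · unfold cutoff
    exact ((hs.comp (by fun_prop)).mul (hs.comp (by fun_prop))).mul
      ((hs.comp (contDiff_const.sub ((by fun_prop : ContDiff ℝ 1
        fun q : ℝ × E2 × E3 => q.2.1).norm_sq ℝ))).mul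
      (hs.comp (contDiff_const.sub ((by fun_prop : ContDiff ℝ 1
        fun q : ℝ × E2 × E3 => q.2.2).norm_sq ℝ))))
  · exact hAc.of_isClosed_subset (isClosed_tsupport _) hsub
  · intro q hq
    have := (hsub hq).1
    have h2 : (0 : ℝ) < 1 / (2 * k) := by positivity
    exact ⟨by linarith [this.1], by linarith [this.2]⟩
  · intro q
    rw [abs_of_nonneg (cutoff_nonneg T k q)]
    unfold cutoff
    have h0 := Real.smoothTransition.nonneg
    have h1 := Real.smoothTransition.le_one
    exact mul_le_one₀ (mul_le_one₀ (h1 _) (h0 _) (h1 _)) (mul_nonneg (h0 _) (h0 _))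
      (mul_le_one₀ (h1 _) (h0 _) (h1 _))
  · refine ⟨fun z => Real.smoothTransition (2 * k * z.1 - 1)
      * Real.smoothTransition (2 * k * (T - z.1) - 1)
      * (Real.smoothTransition (k ^ 2 + 1 - ‖z.2.1‖ ^ 2)
        * Real.smoothTransition (k ^ 2 + 1 - z.2.2)), ?_, fun q => rfl⟩
    exact ((hs.comp (by fun_prop)).mul (hs.comp (by fun_prop))).mul
      ((hs.comp (contDiff_const.sub ((by fun_prop : ContDiff ℝ 1
        fun q : ℝ × E2 × ℝ => q.2.1).norm_sq ℝ))).mul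
      (hs.comp (by fun_prop)))

/-! ### The electric field -/

/-- The electric field of a regular potential can be modified at a null set of times so that it
is measurable, and bounded and Lipschitz at every time. -/
lemma IsRegularPotential.exists_field {T : ℝ} {M L : ℝ≥0} {φ : ℝ → E2 → ℝ}
    (hφ : IsRegularPotential T M L φ) :
    ∃ E : ℝ → E2 → E2, IsRegularField M L E ∧
      ∀ᵐ t ∂(volume.restrict (Ioo 0 T)), ∀ ξ, E t ξ = -gradient (φ t) ξ := by
  classical
  obtain ⟨hm, hae⟩ := hφ
  obtain ⟨N, hN, hNm, hN0⟩ := exists_measurable_superset_of_null (ae_iff.mp hae)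
  have hgood : ∀ t, t ∉ N → Differentiable ℝ (φ t) ∧ (∀ ξ, ‖gradient (φ t) ξ‖ ≤ M) ∧
      LipschitzWith L (gradient (φ t)) := fun t ht => by
    by_contra hc
    exact ht (hN hc)
  refine ⟨fun t ξ => if t ∈ N then 0 else -gradient (φ t) ξ, ⟨?_, ?_, ?_⟩, ?_⟩
  · let e : Fin 2 → E2 := fun j => EuclideanSpace.single j 1
    let D : ℕ → ℝ × E2 → E2 := fun n q => if q.1 ∈ N then 0 else
      -∑ j, ((n + 1 : ℝ) * (φ q.1 (q.2 + (n + 1 : ℝ)⁻¹ • e j) - φ q.1 q.2)) • e j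
    have hDm : ∀ n, Measurable (D n) := fun n => by
      refine Measurable.ite (measurable_fst hNm) measurable_const ?_
      refine (Finset.measurable_sum _ fun j _ => ?_).neg
      have h1 : Measurable fun q : ℝ × E2 => φ q.1 (q.2 + (n + 1 : ℝ)⁻¹ • e j) :=
        hm.comp (g := fun q : ℝ × E2 => φ q.1 q.2)
          (f := fun q : ℝ × E2 => (q.1, q.2 + (n + 1 : ℝ)⁻¹ • e j)) (by fun_prop)
      exact ((h1.sub hm).const_mul _).smul_const _
    refine measurable_of_tendsto_metrizable hDm (tendsto_pi_nhds.mpr fun q => ?_)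
    by_cases hq : q.1 ∈ N
    · simp [D, hq]
    · simp only [D, hq, if_false]
      refine Tendsto.neg ?_
      have h1 : gradient (φ q.1) q.2 = ∑ j, (fderiv ℝ (φ q.1) q.2 (e j)) • e j := by
        have h2 := (EuclideanSpace.basisFun (Fin 2) ℝ).sum_repr' (gradient (φ q.1) q.2)
        rw [← h2]
        refine Finset.sum_congr rfl fun j _ => ?_
        congr 1
        rw [real_inner_comm, EuclideanSpace.basisFun_apply, inner_gradient_left]
        exact EuclideanSpace.basisFun_apply _ _ j
      rw [h1]
      refine tendsto_finsetSum _ fun j _ => Tendsto.smul_const ?_ _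
      have h3 : Tendsto (fun n : ℕ => (n : ℝ) + 1) atTop atTop :=
        tendsto_atTop_add_const_right _ _ tendsto_natCast_atTop_atTop
      exact (((hgood q.1 hq).1 q.2).hasFDerivAt.lim_real (e j)).comp h3
  · intro t ξ
    by_cases ht : t ∈ N
    · simp [ht]
    · simpa [ht] using (hgood t ht).2.1 ξ
  · intro t ξ ξ'
    by_cases ht : t ∈ N
    · simp only [ht, if_true, sub_self, norm_zero]
      positivity
    · simp only [ht, if_false]
      rw [neg_sub_neg, norm_sub_rev]
      exact (hgood t ht).2.2.norm_sub_le ξ ξ'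
  · have : ∀ᵐ t ∂(volume.restrict (Ioo 0 T)), t ∉ N := by
      rw [ae_iff]
      simpa using hN0
    exact this.mono fun t ht ξ => by simp [ht]

lemma IsMagneticField.exists_bounds {B : E2 → ℝ} (hB : IsMagneticField B) :
    Continuous B ∧ ∃ b : ℝ, (∀ ξ, |B ξ| ≤ b) ∧ ∀ ξ ξ', |B ξ - B ξ'| ≤ b * ‖ξ - ξ'‖ := by
  obtain ⟨h1, b, hb⟩ := hB
  refine ⟨h1.continuous, b, fun ξ => (hb ξ).1, fun ξ ξ' => ?_⟩
  exact convex_univ.norm_image_sub_le_of_norm_fderiv_le (𝕜 := ℝ)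
    (fun x _ => h1.differentiable (by norm_num) x) (fun x _ => (hb x).2) (mem_univ ξ')
    (mem_univ ξ)

lemma IsVlasovSolution.isWeakTransport {T α : ℝ} {B : E2 → ℝ} {K : E2 → ℝ → E3 → E3 → ℝ}
    {fI : Phase → ℝ} {φ : ℝ → E2 → ℝ} {f : ℝ × Phase → ℝ} {γ : Fin 2 → ℝ × E2 × E3 → ℝ}
    (h : IsVlasovSolution T α B K fI φ f γ) {E : ℝ → E2 → E2}
    (hE : ∀ᵐ t ∂(volume.restrict (Ioo 0 T)), ∀ ξ, E t ξ = -gradient (φ t) ξ) :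
    IsWeakTransport T α B E f γ := by
  refine ⟨h.mem.memLp, h.trace_mem, fun ψ hψ hψc hψt => ?_⟩
  have h1 := h.green ψ hψ hψc (hψt.trans fun p hp => hp.2)
  have h2 : ∀ p : Phase, ψ (0, p) = 0 := fun p => by
    by_contra hc
    exact lt_irrefl _ (hψt (subset_tsupport _ hc)).1
  simp only [h2, mul_zero, integral_zero, add_zero] at h1
  rw [← h1]
  refine integral_congr_ae ?_
  have h3 : ∀ᵐ p ∂(volume.restrict (Ioo 0 T ×ˢ Theta) : Measure (ℝ × Phase)),
      ∀ ξ, E p.1 ξ = -gradient (φ p.1) ξ := by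
    rw [volume_restrict_slab]
    exact Measure.quasiMeasurePreserving_fst.ae hE
  filter_upwards [h3] with p hp
  rw [field, transportField, hp]

/-! ### Integration along the characteristics -/

/-- Integrals over `[0, 1]` of functions that are continuously differentiable in all variables
are continuously differentiable in the parameter. -/
lemma contDiff_intervalIntegral {H : Type*} [NormedAddCommGroup H] [NormedSpace ℝ H]
    [FiniteDimensional ℝ H] {g : H × ℝ → ℝ} (hg : ContDiff ℝ 1 g) :
    ContDiff ℝ 1 fun p => ∫ s in (0 : ℝ)..1, g (p, s) := by
  have : ProperSpace H := FiniteDimensional.proper ℝ H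
  let g' : H → ℝ → H →L[ℝ] ℝ := fun p s =>
    (fderiv ℝ g (p, s)).comp (ContinuousLinearMap.inl ℝ H ℝ)
  have hg'c : Continuous fun z : H × ℝ => g' z.1 z.2 :=
    (hg.continuous_fderiv (by norm_num)).clm_comp continuous_const
  have hgd : ∀ p s, HasFDerivAt (fun p => g (p, s)) (g' p s) p := fun p s => by
    have h1 : HasFDerivAt (fun p : H => (p, s)) (ContinuousLinearMap.inl ℝ H ℝ) p :=
      hasFDerivAt_prodMk_left p s
    exact ((hg.differentiable (by norm_num)) (p, s)).hasFDerivAt.comp p h1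
  have hd : ∀ p₀, HasFDerivAt (fun p => ∫ s in (0 : ℝ)..1, g (p, s))
      (∫ s in (0 : ℝ)..1, g' p₀ s) p₀ := fun p₀ => by
    obtain ⟨C, hC⟩ := ((isCompact_closedBall p₀ 1).prod (isCompact_Icc (a := (0 : ℝ)) (b := 1)))
      |>.exists_bound_of_continuousOn hg'c.continuousOn
    refine hasFDerivAt_integral_of_dominated_of_fderiv_le'' (μ := volume)
      (s := Metric.closedBall p₀ 1) (bound := fun _ => C) (F := fun p s => g (p, s)) (F' := g')
      (Metric.closedBall_mem_nhds p₀ one_pos) ?_ ?_ ?_ ?_ ?_ ?_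
    · exact Eventually.of_forall fun p =>
        (hg.continuous.comp (by fun_prop : Continuous fun s : ℝ => (p, s))).aestronglyMeasurable
    · exact (hg.continuous.comp
        (by fun_prop : Continuous fun s : ℝ => (p₀, s))).intervalIntegrable _ _
    · exact (hg'c.comp (by fun_prop : Continuous fun s : ℝ => (p₀, s))).aestronglyMeasurable
    · refine (ae_restrict_mem measurableSet_uIoc).mono fun s hs p hp => hC (p, s) ⟨hp, ?_⟩
      rw [uIoc_of_le zero_le_one] at hs
      exact ⟨hs.1.le, hs.2⟩
    · exact intervalIntegrable_const
    · exact Eventually.of_forall fun s p _ => hgd p s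
  rw [contDiff_one_iff_fderiv]
  refine ⟨fun p => (hd p).differentiableAt, ?_⟩
  have h1 : fderiv ℝ (fun p => ∫ s in (0 : ℝ)..1, g (p, s)) = fun p => ∫ s in (0 : ℝ)..1, g' p s :=
    funext fun p => (hd p).fderiv
  rw [h1]
  exact intervalIntegral.continuous_parametric_intervalIntegral_of_continuous' hg'c 0 1

/-- The rotation by the angle `θ` around the `x`-axis. -/
noncomputable def rot (θ : ℝ) (v : E3) : E3 :=
  !₂[v 0, Real.cos θ * v 1 - Real.sin θ * v 2, Real.sin θ * v 1 + Real.cos θ * v 2]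

@[simp] lemma rot_apply_zero (θ : ℝ) (v : E3) : rot θ v 0 = v 0 := by simp [rot]

@[simp] lemma rot_apply_one (θ : ℝ) (v : E3) :
    rot θ v 1 = Real.cos θ * v 1 - Real.sin θ * v 2 := by simp [rot]

@[simp] lemma rot_apply_two (θ : ℝ) (v : E3) :
    rot θ v 2 = Real.sin θ * v 1 + Real.cos θ * v 2 := by simp [rot]

lemma E3.ext_coord {u v : E3} (h0 : u 0 = v 0) (h1 : u 1 = v 1) (h2 : u 2 = v 2) : u = v := by
  ext j
  fin_cases j <;> assumption

lemma rot_zero (v : E3) : rot 0 v = v := E3.ext_coord (by simp) (by simp) (by simp)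

lemma rot_rot (θ θ' : ℝ) (v : E3) : rot θ (rot θ' v) = rot (θ + θ') v := by
  refine E3.ext_coord (by simp) ?_ ?_
  · simp only [rot_apply_one, rot_apply_two, Real.cos_add, Real.sin_add]
    ring
  · simp only [rot_apply_one, rot_apply_two, Real.cos_add, Real.sin_add]
    ring

lemma norm_rot (θ : ℝ) (v : E3) : ‖rot θ v‖ = ‖v‖ := by
  rw [EuclideanSpace.norm_eq, EuclideanSpace.norm_eq]
  congr 1
  simp only [Fin.sum_univ_three, Real.norm_eq_abs, sq_abs, rot_apply_zero, rot_apply_one,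
    rot_apply_two]
  linear_combination (v 1 ^ 2 + v 2 ^ 2) * Real.sin_sq_add_cos_sq θ

lemma contDiff_rot : ContDiff ℝ 1 fun z : ℝ × E3 => rot z.1 z.2 := by
  have h : ∀ j : Fin 3, ContDiff ℝ 1 fun z : ℝ × E3 => z.2 j := fun j =>
    (EuclideanSpace.proj j : E3 →L[ℝ] ℝ).contDiff.comp contDiff_snd
  rw [contDiff_euclidean]
  intro j
  have hc := Real.contDiff_cos.comp (contDiff_fst : ContDiff ℝ 1 fun z : ℝ × E3 => z.1)
  have hs := Real.contDiff_sin.comp (contDiff_fst : ContDiff ℝ 1 fun z : ℝ × E3 => z.1)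
  fin_cases j
  · simpa using h 0
  · simpa using (hc.mul (h 1)).sub (hs.mul (h 2))
  · simpa using (hs.mul (h 1)).add (hc.mul (h 2))

/-- The magnetic field generates the rotations around the `x`-axis. -/
lemma hasDerivAt_rot (b : ℝ) (v : E3) :
    HasDerivAt (fun τ : ℝ => rot (b * τ) v) (-crossB v b) 0 := by
  have hc : HasDerivAt (fun τ : ℝ => Real.cos (b * τ)) 0 0 := by
    have := ((hasDerivAt_id (0 : ℝ)).const_mul b).cos
    simpa using this
  have hs : HasDerivAt (fun τ : ℝ => Real.sin (b * τ)) b 0 := by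
    have := ((hasDerivAt_id (0 : ℝ)).const_mul b).sin
    simpa using this
  have he : (fun τ : ℝ => rot (b * τ) v) = fun τ => Real.cos (b * τ) • (!₂[0, v 1, v 2] : E3)
      + Real.sin (b * τ) • (!₂[0, -v 2, v 1] : E3) + !₂[v 0, 0, 0] := by
    funext τ
    refine E3.ext_coord (by simp) ?_ ?_
    · simp
      ring
    · simp
      ring
  rw [he]
  have h := ((hc.smul_const (!₂[0, v 1, v 2] : E3)).add
    (hs.smul_const (!₂[0, -v 2, v 1] : E3))).add_const (!₂[v 0, 0, 0] : E3)
  refine h.congr_deriv (E3.ext_coord (by simp) ?_ ?_)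
  · simp [mul_comm]
  · simp [mul_comm]

/-- A smooth function that is equal to `1/s` for `|s| ≥ δ`, used as the time per unit of `x` along
the characteristics. -/
noncomputable def smoothInv (δ s : ℝ) : ℝ := s / (s ^ 2 + Real.smoothTransition (1 - s ^ 2 / δ ^ 2))

lemma contDiff_smoothInv (δ : ℝ) : ContDiff ℝ 1 (smoothInv δ) := by
  have hs : ContDiff ℝ 1 Real.smoothTransition := Real.smoothTransition.contDiff
  refine contDiff_id.div ((by fun_prop : ContDiff ℝ 1 fun s : ℝ => s ^ 2).add
    (hs.comp (by fun_prop))) fun s => ne_of_gt ?_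
  rcases eq_or_ne s 0 with rfl | h
  · rw [Real.smoothTransition.one_of_one_le (by simp)]
    norm_num
  · have := Real.smoothTransition.nonneg (1 - s ^ 2 / δ ^ 2)
    have := sq_pos_of_ne_zero h
    linarith

lemma smoothInv_eq {δ s : ℝ} (hδ : 0 < δ) (h : δ ≤ |s|) : smoothInv δ s = s⁻¹ := by
  have h1 : δ ^ 2 ≤ s ^ 2 := by
    rw [← sq_abs s]
    gcongr
  have h2 : s ≠ 0 := fun h0 => by
    rw [h0, abs_zero] at h
    linarith
  rw [smoothInv, Real.smoothTransition.zero_of_nonpos, add_zero]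
  · field_simp
  · rw [sub_nonpos, one_le_div (by positivity)]
    exact h1

/-- Rotations whose angle depends on `v_x` preserve the Lebesgue measure. -/
lemma measurePreserving_rot {θ : ℝ → ℝ} (hθ : Measurable θ) :
    MeasurePreserving (fun v : E3 => rot (θ (v 0)) v) volume volume := by
  have hS := (volume_preserving_piFinSuccAbove (fun _ : Fin 3 => ℝ) 0).comp
    (PiLp.volume_preserving_ofLp (Fin 3))
  have hS' := (PiLp.volume_preserving_toLp (Fin 3)).comp
    (volume_preserving_piFinSuccAbove (fun _ : Fin 3 => ℝ) 0).symm
  let A : ℝ → Matrix (Fin 2) (Fin 2) ℝ := fun s =>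
    !![Real.cos (θ s), -Real.sin (θ s); Real.sin (θ s), Real.cos (θ s)]
  have hdet : ∀ s, (A s).det = 1 := fun s => by
    simp only [A, Matrix.det_fin_two_of]
    nlinarith [Real.sin_sq_add_cos_sq (θ s)]
  have hskew : MeasurePreserving (fun p : ℝ × (Fin 2 → ℝ) => (p.1, Matrix.toLin' (A p.1) p.2))
      (volume.prod volume) (volume.prod volume) := by
    refine (MeasurePreserving.id (volume : Measure ℝ)).skew_product
      (g := fun s w => Matrix.toLin' (A s) w) ?_ (Eventually.of_forall fun s => ?_)
    · refine measurable_pi_lambda _ fun j => ?_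
      have hc : Measurable fun p : ℝ × (Fin 2 → ℝ) => Real.cos (θ p.1) :=
        Real.measurable_cos.comp (hθ.comp measurable_fst)
      have hs : Measurable fun p : ℝ × (Fin 2 → ℝ) => Real.sin (θ p.1) :=
        Real.measurable_sin.comp (hθ.comp measurable_fst)
      have h0 : Measurable fun p : ℝ × (Fin 2 → ℝ) => p.2 0 := by fun_prop
      have h1 : Measurable fun p : ℝ × (Fin 2 → ℝ) => p.2 1 := by fun_prop
      fin_cases j
      · have := (hc.mul h0).sub (hs.mul h1)
        refine (congrArg Measurable (funext fun p => ?_)).mp this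
        simp [A, Function.uncurry, Matrix.mulVec, dotProduct, Fin.sum_univ_two, sub_eq_add_neg]
      · have := (hs.mul h0).add (hc.mul h1)
        refine (congrArg Measurable (funext fun p => ?_)).mp this
        simp [A, Function.uncurry, Matrix.mulVec, dotProduct, Fin.sum_univ_two]
    · rw [Real.map_matrix_volume_pi_eq_smul_volume_pi (by rw [hdet]; exact one_ne_zero), hdet]
      simp
  have h := hS'.comp (hskew.comp hS)
  have e : (fun v : E3 => rot (θ (v 0)) v)
      = (WithLp.toLp 2 ∘ ⇑(MeasurableEquiv.piFinSuccAbove (fun _ : Fin 3 => ℝ) 0).symm)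
        ∘ (fun p : ℝ × (Fin 2 → ℝ) => (p.1, Matrix.toLin' (A p.1) p.2))
        ∘ ⇑(MeasurableEquiv.piFinSuccAbove (fun _ : Fin 3 => ℝ) 0) ∘ WithLp.ofLp := by
    funext v
    refine E3.ext_coord rfl ?_ ?_
    · rw [rot_apply_one]
      change _ = Matrix.toLin' (A (v 0)) _ 0
      rw [Matrix.toLin'_apply, Matrix.mulVec, dotProduct, Fin.sum_univ_two]
      change _ = Real.cos (θ (v 0)) * v 1 + -Real.sin (θ (v 0)) * v 2
      ring
    · rw [rot_apply_two]
      change _ = Matrix.toLin' (A (v 0)) _ 1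
      rw [Matrix.toLin'_apply, Matrix.mulVec, dotProduct, Fin.sum_univ_two]
      rfl
  rw [e]
  exact h

/-- The domain in which the limit is identified: away from the initial and the final time, from
infinity and from the velocities that are parallel to the walls. -/
def region (T : ℝ) (k : ℕ) (δ : ℝ) : Set (ℝ × Phase) :=
  {p | 1 < k * p.1 ∧ 1 < k * (T - p.1) ∧ 0 < p.2.1 ∧ p.2.1 < 1 ∧ ‖p.2.2.1‖ < k ∧ ‖p.2.2.2‖ < k
    ∧ δ < |p.2.2.2 0|}

lemma isOpen_region (T : ℝ) (k : ℕ) (δ : ℝ) : IsOpen (region T k δ) := by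
  have h : ∀ {g h : ℝ × Phase → ℝ}, Continuous g → Continuous h → IsOpen {p | g p < h p} :=
    fun hg hh => isOpen_lt hg hh
  exact (h (by fun_prop) (by fun_prop)).inter ((h (by fun_prop) (by fun_prop)).inter
    ((h (by fun_prop) (by fun_prop)).inter ((h (by fun_prop) (by fun_prop)).inter
    ((h (by fun_prop) (by fun_prop)).inter ((h (by fun_prop) (by fun_prop)).inter
    (h (by fun_prop) (by fun_prop)))))))

/-- The integral of `ζ` along the characteristic of `v_x ∂_x - (v × B)·∇_v` through `p`, from `p`
to the wall `x = 1`, parametrized over `[0, 1]`. -/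
noncomputable def charIntegral (δ : ℝ) (B : E2 → ℝ) (ζ : ℝ × Phase → ℝ) (p : ℝ × Phase) : ℝ :=
  (1 - p.2.1) * ∫ s in (0 : ℝ)..1, ζ (p.1, p.2.1 + (1 - p.2.1) * s, p.2.2.1,
    rot (B p.2.2.1 * smoothInv δ (p.2.2.2 0) * ((1 - p.2.1) * s)) p.2.2.2)

/-- A solution `ψ` of `(v_x ∂_x - (v × B)·∇_v) ψ = ζ` in the slab that vanishes at `x = 1`, cut off
in `x` away from the slab. The variables `t` and `ξ` are parameters. -/
noncomputable def charTest (δ : ℝ) (B : E2 → ℝ) (ζ : ℝ × Phase → ℝ) (p : ℝ × Phase) : ℝ :=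
  -(xCut p.2.1 * (smoothInv δ (p.2.2.2 0) * charIntegral δ B ζ p))

section CharTest

variable {T δ : ℝ} {k : ℕ} {B : E2 → ℝ} {ζ : ℝ × Phase → ℝ}

lemma contDiff_vx : ContDiff ℝ 1 fun p : ℝ × Phase => p.2.2.2 0 :=
  (EuclideanSpace.proj (0 : Fin 3) : E3 →L[ℝ] ℝ).contDiff.comp (by fun_prop)

lemma contDiff_charTest (hB : ContDiff ℝ 1 B) (hζ : ContDiff ℝ 1 ζ) :
    ContDiff ℝ 1 (charTest δ B ζ) := by
  have hk : ContDiff ℝ 1 fun p : ℝ × Phase => smoothInv δ (p.2.2.2 0) :=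
    (contDiff_smoothInv δ).comp contDiff_vx
  have hBp : ContDiff ℝ 1 fun p : ℝ × Phase => B p.2.2.1 := hB.comp (by fun_prop)
  have hang : ContDiff ℝ 1 fun z : (ℝ × Phase) × ℝ =>
      B z.1.2.2.1 * smoothInv δ (z.1.2.2.2 0) * ((1 - z.1.2.1) * z.2) :=
    ((hBp.mul hk).comp contDiff_fst).mul (by fun_prop)
  have hrot : ContDiff ℝ 1 fun z : (ℝ × Phase) × ℝ =>
      rot (B z.1.2.2.1 * smoothInv δ (z.1.2.2.2 0) * ((1 - z.1.2.1) * z.2)) z.1.2.2.2 :=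
    contDiff_rot.comp (hang.prodMk (by fun_prop))
  have h1 : ContDiff ℝ 1 fun z : (ℝ × Phase) × ℝ => ζ (z.1.1, z.1.2.1 + (1 - z.1.2.1) * z.2,
      z.1.2.2.1, rot (B z.1.2.2.1 * smoothInv δ (z.1.2.2.2 0) * ((1 - z.1.2.1) * z.2))
        z.1.2.2.2) :=
    hζ.comp (ContDiff.prodMk (by fun_prop) (ContDiff.prodMk (by fun_prop)
      (ContDiff.prodMk (by fun_prop) hrot)))
  have h2 : ContDiff ℝ 1 (charIntegral δ B ζ) :=
    ContDiff.mul (by fun_prop) (contDiff_intervalIntegral h1)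
  exact ((xCut_contDiff.comp (by fun_prop)).mul (hk.mul h2)).neg

/-- The integral along a characteristic, in the variable `x`. -/
lemma charIntegral_eq (p : ℝ × Phase) :
    charIntegral δ B ζ p = ∫ x in p.2.1..1, ζ (p.1, x, p.2.2.1,
      rot (B p.2.2.1 * smoothInv δ (p.2.2.2 0) * (x - p.2.1)) p.2.2.2) := by
  have h := intervalIntegral.mul_integral_comp_add_mul (a := 0) (b := 1)
    (f := fun x => ζ (p.1, x, p.2.2.1,
      rot (B p.2.2.1 * smoothInv δ (p.2.2.2 0) * (x - p.2.1)) p.2.2.2)) (1 - p.2.1) p.2.1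
  rw [mul_zero, add_zero, mul_one, add_sub_cancel] at h
  rw [← h, charIntegral]
  simp only [add_sub_cancel_left]

lemma charTest_one (t : ℝ) (q : E2 × E3) : charTest δ B ζ (t, 1, q) = 0 := by
  simp [charTest, charIntegral]

/-- At the wall `x = 0` the test function is an integral over the full width of the slab. -/
lemma charTest_zero (t : ℝ) (q : E2 × E3) :
    charTest δ B ζ (t, 0, q) = -(smoothInv δ (q.2 0) * ∫ x in (0 : ℝ)..1, ζ (t, x, q.1,
      rot (B q.1 * smoothInv δ (q.2 0) * x) q.2)) := by
  rw [charTest, charIntegral_eq, xCut_eq_one ⟨by norm_num, by norm_num⟩]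
  simp

lemma charIntegral_eq_zero {p : ℝ × Phase} (h : ∀ x θ, ζ (p.1, x, p.2.2.1, rot θ p.2.2.2) = 0) :
    charIntegral δ B ζ p = 0 := by
  simp [charIntegral, h]

lemma charTest_support (hζ : ∀ p, ζ p ≠ 0 → p ∈ region T k δ) {p : ℝ × Phase}
    (hp : charTest δ B ζ p ≠ 0) :
    p.2.1 ∈ Icc (-2 : ℝ) 3 ∧ 1 < k * p.1 ∧ 1 < k * (T - p.1) ∧ ‖p.2.2.1‖ < k ∧ ‖p.2.2.2‖ < k
      ∧ δ < |p.2.2.2 0| := by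
  constructor
  · by_contra h
    exact hp (by rw [charTest, xCut_eq_zero h]; simp)
  · by_contra h
    refine hp ?_
    rw [charTest, charIntegral_eq_zero, mul_zero, mul_zero, neg_zero]
    intro x θ
    by_contra h2
    obtain ⟨a1, a2, -, -, a3, a4, a5⟩ := hζ _ h2
    simp only [norm_rot, rot_apply_zero] at a1 a2 a3 a4 a5
    exact h ⟨a1, a2, a3, a4, a5⟩

lemma tsupport_charTest (hk : 0 < k) (hζ : ∀ p, ζ p ≠ 0 → p ∈ region T k δ) :
    tsupport (charTest δ B ζ) ⊆ Icc (1 / k : ℝ) (T - 1 / k) ×ˢ (Icc (-2 : ℝ) 3 ×ˢ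
      (Metric.closedBall (0 : E2) k ×ˢ Metric.closedBall (0 : E3) k)) := by
  have hk' : (0 : ℝ) < k := by exact_mod_cast hk
  refine closure_minimal (fun p hp => ?_) (isClosed_Icc.prod (isClosed_Icc.prod
    (Metric.isClosed_closedBall.prod Metric.isClosed_closedBall)))
  obtain ⟨a0, a1, a2, a3, a4, -⟩ := charTest_support hζ hp
  refine ⟨⟨?_, ?_⟩, a0, by simpa using a3.le, by simpa using a4.le⟩
  · rw [div_le_iff₀ hk']
    linarith
  · rw [le_sub_iff_add_le, ← le_sub_iff_add_le', div_le_iff₀ hk']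
    linarith

lemma charTest_compact (hk : 0 < k) (hζ : ∀ p, ζ p ≠ 0 → p ∈ region T k δ) :
    HasCompactSupport (charTest δ B ζ) :=
  (isCompact_Icc.prod (isCompact_Icc.prod ((isCompact_closedBall _ _).prod
    (isCompact_closedBall _ _)))).of_isClosed_subset (isClosed_tsupport _)
    (tsupport_charTest hk hζ)

lemma charTest_time (hk : 0 < k) (hζ : ∀ p, ζ p ≠ 0 → p ∈ region T k δ) :
    tsupport (charTest δ B ζ) ⊆ {p | p.1 ∈ Ioo 0 T} := by
  have hk' : (0 : ℝ) < 1 / k := by positivity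
  intro p hp
  have := (tsupport_charTest hk hζ hp).1
  exact ⟨by linarith [this.1], by linarith [this.2]⟩

/-- Along a characteristic the integral is taken over a shrinking interval. -/
lemma charIntegral_flow (p : ℝ × Phase) (τ : ℝ) :
    charIntegral δ B ζ (p.1, p.2.1 + τ, p.2.2.1,
        rot (B p.2.2.1 * smoothInv δ (p.2.2.2 0) * τ) p.2.2.2)
      = ∫ x in (p.2.1 + τ)..1, ζ (p.1, x, p.2.2.1,
        rot (B p.2.2.1 * smoothInv δ (p.2.2.2 0) * (x - p.2.1)) p.2.2.2) := by
  rw [charIntegral_eq]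
  simp only [rot_apply_zero, rot_rot]
  refine intervalIntegral.integral_congr fun x _ => ?_
  congr 5
  ring

/-- The test function solves the equation along the characteristics. -/
lemma fderiv_charTest (hδ : 0 < δ) (hB : ContDiff ℝ 1 B) (hζ : ContDiff ℝ 1 ζ)
    (hζs : ∀ p, ζ p ≠ 0 → p ∈ region T k δ) {p : ℝ × Phase} (hp : p.2.1 ∈ Icc (0 : ℝ) 1) :
    fderiv ℝ (charTest δ B ζ) p (0, p.2.2.2 0, 0, -crossB p.2.2.2 (B p.2.2.1)) = ζ p := by
  have hcd := contDiff_charTest (δ := δ) hB hζ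
  rcases lt_or_ge |p.2.2.2 0| δ with hlt | hge
  · have h0 : ζ p = 0 := by
      by_contra h
      exact absurd (hζs p h).2.2.2.2.2.2 (not_lt.mpr hlt.le)
    have hev : charTest δ B ζ =ᶠ[𝓝 p] fun _ => 0 := by
      have hopen : IsOpen {p : ℝ × Phase | |p.2.2.2 0| < δ} :=
        isOpen_lt (by fun_prop) continuous_const
      filter_upwards [hopen.mem_nhds hlt] with p' hp'
      by_contra h
      exact absurd (charTest_support hζs h).2.2.2.2.2 (not_lt.mpr (le_of_lt hp'))
    rw [hev.fderiv_eq, h0]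
    simp
  · set κ := smoothInv δ (p.2.2.2 0) with hκ
    have hκ' : κ = (p.2.2.2 0)⁻¹ := smoothInv_eq hδ hge
    have hv0 : p.2.2.2 0 ≠ 0 := fun h => by
      rw [h, abs_zero] at hge
      linarith
    set c : ℝ → ℝ × Phase := fun τ =>
      (p.1, p.2.1 + τ, p.2.2.1, rot (B p.2.2.1 * κ * τ) p.2.2.2) with hc
    have hc0 : c 0 = p := by simp [hc, rot_zero]
    have hcd' : HasDerivAt c (0, 1, 0, -crossB p.2.2.2 (B p.2.2.1 * κ)) 0 := by
      refine (hasDerivAt_const 0 p.1).prodMk (HasDerivAt.prodMk ?_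
        ((hasDerivAt_const 0 p.2.2.1).prodMk (hasDerivAt_rot _ _)))
      simpa using (hasDerivAt_id (0 : ℝ)).const_add p.2.1
    have h1 : HasDerivAt (charTest δ B ζ ∘ c)
        (fderiv ℝ (charTest δ B ζ) p (0, 1, 0, -crossB p.2.2.2 (B p.2.2.1 * κ))) 0 := by
      have := (hcd.differentiable (by norm_num) (c 0)).hasFDerivAt.comp_hasDerivAt 0 hcd'
      rwa [hc0] at this
    set g : ℝ → ℝ := fun x => ζ (p.1, x, p.2.2.1, rot (B p.2.2.1 * κ * (x - p.2.1)) p.2.2.2)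
      with hg
    have hgc : Continuous g := by
      have hr : Continuous fun x : ℝ => rot (B p.2.2.1 * κ * (x - p.2.1)) p.2.2.2 :=
        contDiff_rot.continuous.comp (f := fun x : ℝ => (B p.2.2.1 * κ * (x - p.2.1), p.2.2.2))
          (by fun_prop)
      exact hζ.continuous.comp (by fun_prop)
    have h2 : HasDerivAt (fun τ : ℝ => -(κ * ∫ x in (p.2.1 + τ)..1, g x)) (κ * g p.2.1) 0 := by
      have h3 := intervalIntegral.integral_hasDerivAt_left (hgc.intervalIntegrable (p.2.1 + 0) 1)
        (hgc.stronglyMeasurableAtFilter _ _) hgc.continuousAt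
      have h4 : HasDerivAt (fun τ : ℝ => p.2.1 + τ) 1 0 := by
        simpa using (hasDerivAt_id (0 : ℝ)).const_add p.2.1
      have h5 := ((h3.comp 0 h4).const_mul κ).neg
      refine h5.congr_deriv ?_
      rw [add_zero]
      ring
    have hev : charTest δ B ζ ∘ c =ᶠ[𝓝 0] fun τ : ℝ => -(κ * ∫ x in (p.2.1 + τ)..1, g x) := by
      have : Ioo (-1 : ℝ) 1 ∈ 𝓝 (0 : ℝ) := Ioo_mem_nhds (by norm_num) (by norm_num)
      filter_upwards [this] with τ hτ
      have hx : p.2.1 + τ ∈ Icc (-1 : ℝ) 2 :=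
        ⟨by linarith [hp.1, hτ.1], by linarith [hp.2, hτ.2]⟩
      simp only [Function.comp, hc, charTest, hκ, charIntegral_flow, rot_apply_zero]
      rw [xCut_eq_one hx, one_mul]
    have h6 := h1.unique (h2.congr_of_eventuallyEq hev)
    have hg0 : g p.2.1 = ζ p := by simp [hg, rot_zero]
    -- the curve `c` is parametrized by `x` and not by time, hence the factor `v_x`
    have h7 : ((0, p.2.2.2 0, 0, -crossB p.2.2.2 (B p.2.2.1)) : ℝ × Phase)
        = p.2.2.2 0 • ((0, 1, 0, -crossB p.2.2.2 (B p.2.2.1 * κ)) : ℝ × Phase) := by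
      have h8 : crossB p.2.2.2 (B p.2.2.1) = p.2.2.2 0 • crossB p.2.2.2 (B p.2.2.1 * κ) := by
        refine E3.ext_coord (by simp [crossB]) ?_ ?_
        · simp [crossB, hκ']
          field_simp
        · simp [crossB, hκ']
          field_simp
      rw [h8]
      simp
    rw [h7, map_smul, h6, hg0, hκ', smul_eq_mul, ← mul_assoc, mul_inv_cancel₀ hv0, one_mul]

end CharTest

/-! ### Rotations of the velocities and Fubini -/

section Shear

variable {δ : ℝ} {B : E2 → ℝ}

/-- The rotation of the velocities produced by the magnetic field between the wall `x = 0` and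
the abscissa `x`. -/
noncomputable def gyration (δ : ℝ) (B : E2 → ℝ) (x : ℝ) (q : ℝ × E2 × E3) : ℝ × E2 × E3 :=
  (q.1, q.2.1, rot (B q.2.1 * smoothInv δ (q.2.2 0) * x) q.2.2)

lemma continuous_gyration_snd (hB : Continuous B) :
    Continuous fun z : (E2 × E3) × ℝ => rot (B z.1.1 * smoothInv δ (z.1.2 0) * z.2) z.1.2 :=
  contDiff_rot.continuous.comp (f := fun z : (E2 × E3) × ℝ =>
    (B z.1.1 * smoothInv δ (z.1.2 0) * z.2, z.1.2))
    ((((hB.comp (by fun_prop)).mul ((contDiff_smoothInv δ).continuous.comp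
      (by fun_prop))).mul continuous_snd).prodMk (by fun_prop))

lemma continuous_gyration (hB : Continuous B) :
    Continuous fun z : (ℝ × E2 × E3) × ℝ => (gyration δ B z.2 z.1).2 := by
  have h1 := (continuous_gyration_snd (δ := δ) hB).comp
    (by fun_prop : Continuous fun z : (ℝ × E2 × E3) × ℝ => (z.1.2, z.2))
  exact (by fun_prop : Continuous fun z : (ℝ × E2 × E3) × ℝ => z.1.2.1).prodMk h1

lemma measurePreserving_gyration (hB : Continuous B) (x : ℝ) :
    MeasurePreserving (gyration δ B x) volume volume := by
  have hk : Measurable (smoothInv δ) := (contDiff_smoothInv δ).continuous.measurable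
  let g : E2 → E3 → E3 := fun ξ v => rot (B ξ * smoothInv δ (v 0) * x) v
  have h2 : Measurable (Function.uncurry g) :=
    ((continuous_gyration_snd (δ := δ) hB).comp
      (by fun_prop : Continuous fun p : E2 × E3 => (p, x))).measurable
  have h3 : ∀ ξ, Measure.map (g ξ) volume = volume := fun ξ =>
    (measurePreserving_rot (θ := fun s => B ξ * smoothInv δ s * x)
      ((hk.const_mul _).mul_const _)).map_eq
  have e : gyration δ B x = fun q : ℝ × E2 × E3 => (q.1, q.2.1, g q.2.1 q.2.2) := rfl
  rw [e]
  clear_value g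
  have h4 : MeasurePreserving (fun p : E2 × E3 => (p.1, g p.1 p.2)) volume volume :=
    (MeasurePreserving.id (volume : Measure E2)).skew_product h2 (Eventually.of_forall h3)
  exact (MeasurePreserving.id (volume : Measure ℝ)).prod h4

/-- Rotating the velocities does not change the integral against a function that is invariant
under rotations. -/
lemma integral_mul_gyration (hB : Continuous B) {Q : ℝ × E2 × E3 → ℝ} (hQ : Integrable Q)
    (hrot : ∀ q θ, Q (q.1, q.2.1, rot θ q.2.2) = Q q) {ζ : ℝ × Phase → ℝ} (hζ : Continuous ζ)
    {c : ℝ} (hc : ∀ p, |ζ p| ≤ c) :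
    ∫ q, Q q * (∫ x in (0 : ℝ)..1, ζ (q.1, x, q.2.1,
        rot (B q.2.1 * smoothInv δ (q.2.2 0) * x) q.2.2))
      = ∫ p in {p : ℝ × Phase | p.2.1 ∈ Ioc (0 : ℝ) 1}, Q (p.1, p.2.2) * ζ p := by
  set μ : Measure ℝ := volume.restrict (Ioc (0 : ℝ) 1) with hμ
  have hQ' : Integrable (fun z : (ℝ × E2 × E3) × ℝ => Q z.1) (volume.prod μ) :=
    hQ.comp_fst μ
  have hi1 : Integrable (fun z : (ℝ × E2 × E3) × ℝ => Q z.1 * ζ (z.1.1, z.2,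
      (gyration δ B z.2 z.1).2)) (volume.prod μ) := by
    refine hQ'.mul_bdd (c := c) ?_ (Eventually.of_forall fun z => hc _)
    have := continuous_gyration (δ := δ) hB
    exact (hζ.comp (continuous_fst.fst.prodMk
      (continuous_snd.prodMk this))).aestronglyMeasurable
  have hi2 : Integrable (fun z : (ℝ × E2 × E3) × ℝ => Q z.1 * ζ (z.1.1, z.2, z.1.2))
      (volume.prod μ) :=
    hQ'.mul_bdd (c := c) (hζ.comp (by fun_prop)).aestronglyMeasurable
      (Eventually.of_forall fun z => hc _)
  -- at fixed `x` the rotation is a measure preserving change of variables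
  have hx : ∀ x : ℝ, ∫ q, Q q * ζ (q.1, x, (gyration δ B x q).2)
      = ∫ q : ℝ × E2 × E3, Q q * ζ (q.1, x, q.2) := by
    intro x
    have hmp := measurePreserving_gyration (δ := δ) hB x
    have hm : AEStronglyMeasurable (fun q : ℝ × E2 × E3 => Q q * ζ (q.1, x, q.2)) volume :=
      hQ.1.mul (hζ.comp (by fun_prop)).aestronglyMeasurable
    rw [← hmp.map_eq] at hm
    have h := integral_map hmp.measurable.aemeasurable hm
    rw [hmp.map_eq] at h
    rw [h]
    refine integral_congr_ae (Eventually.of_forall fun q => ?_)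
    simp only [gyration, hrot]
  have hi3 : IntegrableOn (fun p : ℝ × Phase => Q (p.1, p.2.2) * ζ p)
      {p | p.2.1 ∈ Ioc (0 : ℝ) 1} := by
    have h1 := hi2.swap
    have h2 : {p : ℝ × Phase | p.2.1 ∈ Ioc (0 : ℝ) 1} = xFirst ⁻¹' (Ioc 0 1 ×ˢ univ) := by
      ext p; simp
    rw [h2]
    refine (measurePreserving_xFirst.integrableOn_comp_preimage xFirst.measurableEmbedding
      (f := fun z : ℝ × (ℝ × E2 × E3) => Q z.2 * ζ (z.2.1, z.1, z.2.2))).mpr ?_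
    unfold IntegrableOn
    rw [Measure.volume_eq_prod, ← Measure.restrict_prod_eq_prod_univ]
    exact h1
  calc _ = ∫ q, ∫ x, Q q * ζ (q.1, x, (gyration δ B x q).2) ∂μ := by
        refine integral_congr_ae (Eventually.of_forall fun q => ?_)
        simp only [intervalIntegral.integral_of_le zero_le_one, integral_const_mul, gyration, hμ]
    _ = ∫ x, ∫ q, Q q * ζ (q.1, x, (gyration δ B x q).2) ∂volume ∂μ :=
        integral_integral_swap hi1
    _ = ∫ x, ∫ q : ℝ × E2 × E3, Q q * ζ (q.1, x, q.2) ∂volume ∂μ := by simp only [hx]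
    _ = ∫ q : ℝ × E2 × E3, ∫ x, Q q * ζ (q.1, x, q.2) ∂μ :=
        (integral_integral_swap hi2).symm
    _ = _ := (setIntegral_x_mem hi3).symm

end Shear

/-! ### The weak limit of the traces -/

/-- The range of times, positions and speeds in which the limit is identified. -/
def speedRegion (T : ℝ) (k : ℕ) : Set (ℝ × E2 × ℝ) :=
  Ioo 0 T ×ˢ (Metric.closedBall 0 k ×ˢ Iio (k : ℝ))

lemma measurableSet_speedRegion (T : ℝ) (k : ℕ) : MeasurableSet (speedRegion T k) :=
  measurableSet_Ioo.prod (Metric.isClosed_closedBall.measurableSet.prod measurableSet_Iio)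

lemma volume_speedRegion_lt_top (T : ℝ) (k : ℕ) :
    volume (speedPoint ⁻¹' speedRegion T k) < ∞ := by
  have h : Bornology.IsBounded (Ioo (0 : ℝ) T ×ˢ (Metric.closedBall (0 : E2) k ×ˢ
      Metric.closedBall (0 : E3) k)) :=
    (Metric.isBounded_Ioo 0 T).prod (Metric.isBounded_closedBall.prod Metric.isBounded_closedBall)
  refine (measure_mono fun q hq => ?_).trans_lt h.measure_lt_top
  exact ⟨hq.1, hq.2.1, by simpa using (show ‖q.2.2‖ < k from hq.2.2).le⟩

lemma baseMeasure_speedRegion_lt_top (T : ℝ) (k : ℕ) :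
    baseMeasure (basePoint ⁻¹' speedRegion T k) < ∞ := by
  have h : basePoint ⁻¹' speedRegion T k = Ioo 0 T ×ˢ (Metric.closedBall 0 k ×ˢ
      {r : Ioi (0 : ℝ) | (r : ℝ) < k}) := rfl
  rw [h]
  unfold baseMeasure
  rw [Measure.prod_prod, Measure.prod_prod]
  refine ENNReal.mul_lt_top (by simp) (ENNReal.mul_lt_top
    Metric.isBounded_closedBall.measure_lt_top ?_)
  rcases Nat.eq_zero_or_pos k with rfl | hk
  · have : {r : Ioi (0 : ℝ) | (r : ℝ) < (0 : ℕ)} = ∅ := by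
      ext r
      simpa using (show (0 : ℝ) < r from r.2).le
    rw [this]
    simp
  · have hk' : (0 : ℝ) < k := by exact_mod_cast hk
    have e : {r : Ioi (0 : ℝ) | (r : ℝ) < k} = Iio (⟨k, hk'⟩ : Ioi (0 : ℝ)) := rfl
    rw [e, Measure.volumeIoiPow_apply_Iio]
    exact ENNReal.ofReal_lt_top

section Limit

variable {T M b N : ℝ} {α L : ℕ → ℝ} {B : E2 → ℝ} {E : ℕ → ℝ → E2 → E2}
  {K : E2 → ℝ → E3 → E3 → ℝ} {f : ℕ → ℝ × Phase → ℝ} {γ : ℕ → Fin 2 → ℝ × E2 × E3 → ℝ}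

/-- The cut off fluxes `v_x γ` at the wall `x = 0` have a weak limit of the form `v_x r(t, ξ, |v|)`:
they are bounded in `L²`, and their dissipation, which is at most the total flux of energy through
both walls, tends to zero. -/
lemma exists_radial_wall_limit (hB : Continuous B) (hb : ∀ ξ, |B ξ| ≤ b)
    (hbL : ∀ ξ ξ', |B ξ - B ξ'| ≤ b * ‖ξ - ξ'‖) (hE : ∀ n, IsRegularField M (L n) (E n))
    (hL : ∀ n, 0 ≤ L n) (hα : ∀ n, 0 < α n) (hα0 : Tendsto α atTop (𝓝 0))
    (hf : ∀ n, IsWeakTransport T (α n) B (E n) (f n) (γ n))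
    (hN : ∀ n, ∫ p in Ioo 0 T ×ˢ Theta, f n p ^ 2 ≤ N) (hK : IsReflectionKernel K)
    (hr : ∀ n i, ∀ᵐ q ∂(volume.restrict (Ioo 0 T ×ˢ ((univ : Set E2) ×ˢ incoming i))),
      γ n i q = reflect K i q.2.1 (fun v' => γ n i (q.1, q.2.1, v')) q.2.2)
    {k : ℕ} (hk : 0 < k) :
    ∃ (G : ℝ × E2 × E3 → ℝ) (r : ℝ × E2 × ℝ → ℝ), Measurable r ∧ MemLp G 2 volume ∧
      (∀ g : ℝ × E2 × E3 → ℝ, MemLp g 2 volume →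
        Tendsto (fun n => ∫ q, q.2.2 0 * (cutoff T k q * γ n 0 q) * g q)
          (hyperfilter ℕ) (𝓝 (∫ q, G q * g q))) ∧
      ∀ᵐ q, speedPoint q ∈ speedRegion T k → G q = q.2.2 0 * r (speedPoint q) := by
  have hχ := isRadialCutoff_cutoff T hk
  obtain ⟨R, D, hR0, -, hR, hD⟩ := hχ.exists_bounds
  choose w hw hwe hwd using fun n i =>
    exists_isReflected (fun R => (hf n).trace i R) (hr n i) hχ
  have hue : ∀ n, (fun q : ℝ × E2 × E3 => q.2.2 0 * w n 0 q)
      =ᵐ[volume] fun q => q.2.2 0 * γ n 0 q * cutoff T k q := fun n => by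
    filter_upwards [hwe n 0] with q hq
    rw [hq]
    ring
  have hu : ∀ n, MemLp (fun q : ℝ × E2 × E3 => q.2.2 0 * w n 0 q) 2 volume := fun n =>
    (memLp_congr_ae (hue n)).mpr (memLp_vx_mul_trace_mul ((hf n).trace 0)
      hχ.contDiff.continuous.measurable hχ.le_one hR)
  have hC : ∃ C, ∀ n, ∫ q : ℝ × E2 × E3, (q.2.2 0 * w n 0 q) ^ 2 ≤ C := by
    have h1 : Tendsto (fun n => ((1 + R) ^ 2 * D * (α n + R + M) * α n + 2 * (1 + R) * R ^ 2) * N)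
        atTop (𝓝 (((1 + R) ^ 2 * D * (0 + R + M) * 0 + 2 * (1 + R) * R ^ 2) * N)) :=
      (((((hα0.add_const R).add_const M).const_mul _).mul hα0).add_const _).mul_const N
    obtain ⟨C, hC⟩ := h1.bddAbove_range
    refine ⟨C, fun n => le_trans ?_ (hC ⟨n, rfl⟩)⟩
    refine le_trans ?_ (sum_integral_sq_vx_trace_le hB hb hbL (hE n) (hL n) (hα n) (hf n) (hN n)
      hχ hR hR0 hD)
    have h2 : ∫ q : ℝ × E2 × E3, (q.2.2 0 * w n 0 q) ^ 2
        = ∫ q : ℝ × E2 × E3, (q.2.2 0 * γ n 0 q * cutoff T k q) ^ 2 :=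
      integral_congr_ae ((hue n).fun_comp (· ^ 2))
    rw [h2]
    exact Finset.single_le_sum (f := fun i =>
      ∫ q : ℝ × E2 × E3, (q.2.2 0 * γ n i q * cutoff T k q) ^ 2)
      (fun i _ => integral_nonneg fun q => sq_nonneg _) (Finset.mem_univ 0)
  obtain ⟨C, hC⟩ := hC
  have hd : Tendsto (fun n => dissipation 0 (w n 0)) (hyperfilter ℕ) (𝓝 0) := by
    have h1 : Tendsto (fun n => 2 * D * (α n + R + M) * N * α n) atTop
        (𝓝 (2 * D * (0 + R + M) * N * 0)) :=
      ((((hα0.add_const R).add_const M).const_mul _).mul_const N).mul hα0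
    rw [mul_zero] at h1
    refine (squeeze_zero (fun n => (hw n 0).dissipation_nonneg hK) (fun n => ?_) h1).mono_left
      Nat.hyperfilter_le_atTop
    refine le_trans ?_ (abs_sum_flux_le hB hb hbL (hE n) (hL n) (hα n) (hf n) (hN n)
      hχ hR hR0 hD)
    refine le_trans ?_ (le_abs_self _)
    simp only [← hwd n]
    exact Finset.single_le_sum (f := fun i => dissipation i (w n i))
      (fun i _ => (hw n i).dissipation_nonneg hK) (Finset.mem_univ 0)
  obtain ⟨G, hGm, hG, hlim⟩ := exists_weak_limit hu hC (hyperfilter ℕ)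
  obtain ⟨r, hrm, hr'⟩ := exists_radial_of_weak_limit hK (fun n => hw n 0) hd hGm hG hlim
    (measurableSet_speedRegion T k) (volume_speedRegion_lt_top T k)
    (baseMeasure_speedRegion_lt_top T k)
  refine ⟨G, r, hrm, hG, fun g hg => (hlim g hg).congr fun n => ?_, hr'⟩
  refine integral_congr_ae ?_
  filter_upwards [hwe n 0] with q hq
  rw [hq]

end Limit

/-! ### Identification of the limit -/

section Transport

variable {T M L N δ α : ℝ} {k : ℕ} {B : E2 → ℝ} {E : ℝ → E2 → E2} {ζ : ℝ × Phase → ℝ}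
  {f : ℝ × Phase → ℝ} {γ : Fin 2 → ℝ × E2 × E3 → ℝ}

/-- The part of the transport field that stays bounded as `α` tends to zero. -/
def driftField (α : ℝ) (E : ℝ → E2 → E2) (p : ℝ × Phase) : ℝ × Phase :=
  (α, 0, par p.2.2.2, lift (E p.1 p.2.2.1))

lemma smul_field (hα : α ≠ 0) (p : ℝ × Phase) :
    α • field α B E p
      = (0, p.2.2.2 0, 0, -crossB p.2.2.2 (B p.2.2.1)) + α • driftField α E p := by
  have h : α * (α⁻¹ * p.2.2.2 0) = p.2.2.2 0 := by field_simp
  simp only [field, driftField, Prod.smul_mk, Prod.mk_add_mk, smul_eq_mul, h, smul_sub, smul_smul,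
    mul_inv_cancel₀ hα, one_smul, zero_add, mul_zero, add_zero]
  congr 3
  abel

/-- The weak formulation with the test function `charTest`, multiplied by `α`: the singular part of
the field produces `ζ`, and the boundary term at `x = 1` vanishes. -/
lemma IsWeakTransport.integral_mul_add (hf : IsWeakTransport T α B E f γ) (hα : 0 < α)
    (hδ : 0 < δ) (hk : 0 < k) (hB : ContDiff ℝ 1 B) (hζ : ContDiff ℝ 1 ζ)
    (hζs : ∀ p, ζ p ≠ 0 → p ∈ region T k δ) :
    ∫ p in Ioo 0 T ×ˢ Theta,
        f p * (ζ p + α * fderiv ℝ (charTest δ B ζ) p (driftField α E p))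
      = -∫ q : ℝ × E2 × E3, q.2.2 0 * (cutoff T k q * γ 0 q) * charTest δ B ζ (q.1, 0, q.2) := by
  have h1 := hf.green (charTest δ B ζ) (contDiff_charTest hB hζ) (charTest_compact hk hζs)
    (charTest_time hk hζs)
  have h2 : ∀ q : ℝ × E2 × E3, charTest δ B ζ (q.1, wall 1, q.2.1, q.2.2) = 0 := fun q => by
    simpa [wall] using charTest_one (δ := δ) (B := B) (ζ := ζ) q.1 q.2
  rw [Fin.sum_univ_two] at h1
  simp only [h2, mul_zero, integral_zero, add_zero] at h1
  have h3 : ∫ q in Ioo 0 T ×ˢ (univ : Set (E2 × E3)),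
        normal 0 * q.2.2 0 * γ 0 q * charTest δ B ζ (q.1, wall 0, q.2.1, q.2.2)
      = -∫ q : ℝ × E2 × E3, q.2.2 0 * (cutoff T k q * γ 0 q)
        * charTest δ B ζ (q.1, 0, q.2) := by
    rw [← integral_neg, setIntegral_eq_integral_of_forall_compl_eq_zero]
    · refine integral_congr_ae (Eventually.of_forall fun q => ?_)
      have e0 : charTest δ B ζ (q.1, wall 0, q.2.1, q.2.2) = charTest δ B ζ (q.1, 0, q.2) := by
        simp [wall]
      simp only [e0]
      by_cases h : charTest δ B ζ (q.1, 0, q.2) = 0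
      · simp [h]
      · obtain ⟨-, a1, a2, a3, a4, -⟩ := charTest_support hζs h
        rw [cutoff_eq_one a1.le a2.le a3.le a4.le]
        simp [normal]
    · intro q hq
      by_contra h
      have h5 := charTest_time hk hζs (subset_tsupport _ (right_ne_zero_of_mul h))
      exact hq ⟨h5, mem_univ _⟩
  rw [h3] at h1
  have h6 := congrArg (α * ·) h1
  simp only [← mul_assoc, mul_inv_cancel₀ hα.ne', one_mul] at h6
  simp only [mul_assoc] at h6 ⊢
  rw [← h6, ← integral_const_mul]
  refine setIntegral_congr_fun
    (measurableSet_Ioo.prod (measurableSet_Icc.prod MeasurableSet.univ)) fun p hp => ?_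
  have h7 : α * fderiv ℝ (charTest δ B ζ) p (field α B E p)
      = ζ p + α * fderiv ℝ (charTest δ B ζ) p (driftField α E p) := by
    rw [← smul_eq_mul α, ← map_smul, smul_field hα.ne', map_add, map_smul, smul_eq_mul,
      fderiv_charTest hδ hB hζ hζs hp.2.1]
  rw [← h7]
  ring

/-- The contribution of the drift is bounded, uniformly in `α ≤ a`, in the solution and in the
Lipschitz constant of the electric field: `2 |f h| ≤ f² + h²`, and `h` is bounded with compact
support. -/
lemma exists_bound_driftField (hk : 0 < k) (hB : ContDiff ℝ 1 B) (hζ : ContDiff ℝ 1 ζ)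
    (hζs : ∀ p, ζ p ≠ 0 → p ∈ region T k δ) {a : ℝ} :
    ∃ C, ∀ (α L : ℝ) (E : ℝ → E2 → E2) (f : ℝ × Phase → ℝ), 0 < α → α ≤ a →
      IsRegularField M L E → MemLp f 2 (volume.restrict (Ioo 0 T ×ˢ Theta)) →
      ∫ p in Ioo 0 T ×ˢ Theta, f p ^ 2 ≤ N →
      |∫ p in Ioo 0 T ×ˢ Theta, f p * fderiv ℝ (charTest δ B ζ) p (driftField α E p)| ≤ C
      ∧ IntegrableOn (fun p => f p * fderiv ℝ (charTest δ B ζ) p (driftField α E p))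
        (Ioo 0 T ×ˢ Theta) := by
  have hcd := contDiff_charTest (δ := δ) hB hζ
  have hcc := charTest_compact (δ := δ) (B := B) hk hζs
  set ψ := charTest δ B ζ with hψ
  obtain ⟨D, hD⟩ := (hcd.continuous_fderiv (by norm_num)).bounded_above_of_compact_support
    (hcc.fderiv (𝕜 := ℝ))
  have hD0 : 0 ≤ D := (norm_nonneg _).trans (hD 0)
  set S := tsupport ψ with hS
  have hSm : MeasurableSet S := (isClosed_tsupport _).measurableSet
  have hSf : volume S < ∞ := hcc.measure_lt_top
  set c : ℝ := D * (a + k + M) with hc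
  have hind : Integrable (S.indicator fun _ => c ^ 2) (volume.restrict (Ioo 0 T ×ˢ Theta)) :=
    ((integrable_indicator_iff hSm).mpr (integrableOn_const hSf.ne)).integrableOn
  refine ⟨(N + ∫ p in Ioo 0 T ×ˢ Theta, S.indicator (fun _ => c ^ 2) p) / 2,
    fun α L E f hα hαa hE hf hN => ?_⟩
  have hbd : ∀ p, |fderiv ℝ ψ p (driftField α E p)| ^ 2 ≤ S.indicator (fun _ => c ^ 2) p := by
    intro p
    by_cases hp : p ∈ S
    · rw [indicator_of_mem hp]
      have hv := (tsupport_charTest hk hζs hp).2.2.2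
      rw [mem_closedBall_zero_iff] at hv
      have hM : 0 ≤ M := (norm_nonneg _).trans (hE.bound 0 0)
      have h1 : ‖driftField α E p‖ ≤ a + k + M := by
        have e1 : ‖par p.2.2.2‖ ≤ k := (norm_par_le _).trans hv
        have e2 : ‖lift (E p.1 p.2.2.1)‖ ≤ M := by
          rw [norm_lift_eq]
          exact hE.bound _ _
        have hk0 : (0 : ℝ) ≤ k := Nat.cast_nonneg k
        simp only [driftField, Prod.norm_def, norm_zero, Real.norm_eq_abs, abs_of_pos hα,
          sup_le_iff]
        refine ⟨?_, ?_, ?_, ?_⟩ <;> linarith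
      have h2 : |fderiv ℝ ψ p (driftField α E p)| ≤ c :=
        ((fderiv ℝ ψ p).le_opNorm _).trans (mul_le_mul (hD p) h1 (norm_nonneg _) hD0)
      gcongr
    · have h0 : fderiv ℝ ψ p = 0 := by
        by_contra h
        exact hp (support_fderiv_subset ℝ h)
      simp [h0, hp]
  have hdm : AEStronglyMeasurable (fun p => fderiv ℝ ψ p (driftField α E p))
      (volume.restrict (Ioo 0 T ×ˢ Theta)) := by
    have hEm : Measurable fun p : ℝ × Phase => E p.1 p.2.2.1 :=
      hE.measurable.comp (by fun_prop : Measurable fun p : ℝ × Phase => (p.1, p.2.2.1))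
    have hm : Measurable (driftField α E) := by
      have e1 : Measurable fun p : ℝ × Phase => par p.2.2.2 :=
        (continuous_par.comp (by fun_prop)).measurable
      have e2 : Measurable fun p : ℝ × Phase => lift (E p.1 p.2.2.1) :=
        continuous_lift.measurable.comp hEm
      exact measurable_const.prodMk (measurable_const.prodMk (e1.prodMk e2))
    have h3 : Continuous fun z : (ℝ × Phase) × (ℝ × Phase) => fderiv ℝ ψ z.1 z.2 :=
      ((hcd.continuous_fderiv (by norm_num)).comp continuous_fst).clm_apply continuous_snd
    exact (h3.measurable.comp (measurable_id.prodMk hm)).aestronglyMeasurable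
  have hptw : ∀ p, |f p * fderiv ℝ ψ p (driftField α E p)|
      ≤ (f p ^ 2 + S.indicator (fun _ => c ^ 2) p) / 2 := by
    intro p
    have := hbd p
    rw [abs_mul]
    nlinarith [sq_nonneg (|f p| - |fderiv ℝ ψ p (driftField α E p)|), sq_abs (f p)]
  have hdom : Integrable (fun p => (f p ^ 2 + S.indicator (fun _ => c ^ 2) p) / 2)
      (volume.restrict (Ioo 0 T ×ˢ Theta)) := (hf.integrable_sq.add hind).div_const 2
  constructor
  · refine (abs_integral_le_integral_abs).trans ?_
    calc _ ≤ ∫ p in Ioo 0 T ×ˢ Theta, (f p ^ 2 + S.indicator (fun _ => c ^ 2) p) / 2 :=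
          integral_mono_of_nonneg (Eventually.of_forall fun p => abs_nonneg _) hdom
            (Eventually.of_forall hptw)
      _ ≤ _ := by
          rw [integral_div, integral_add hf.integrable_sq hind]
          gcongr
  · exact hdom.mono' (hf.1.mul hdm) (Eventually.of_forall hptw)

end Transport

section Identification

variable {T M b N δ : ℝ} {α L : ℕ → ℝ} {B : E2 → ℝ} {E : ℕ → ℝ → E2 → E2} {k : ℕ}
  {f : ℕ → ℝ × Phase → ℝ} {γ : ℕ → Fin 2 → ℝ × E2 × E3 → ℝ} {f₀ : ℝ × Phase → ℝ}
  {G : ℝ × E2 × E3 → ℝ} {r : ℝ × E2 × ℝ → ℝ} {ζ : ℝ × Phase → ℝ}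

/-- The weak formulation in the limit: `f₀` is constant along the characteristics of
`v_x ∂_x - (v × B)·∇_v`, with the value given by the limit of the traces. -/
lemma integral_mul_eq_neg_integral_charTest
    (hE : ∀ n, IsRegularField M (L n) (E n)) (hα : ∀ n, 0 < α n) (hα0 : Tendsto α atTop (𝓝 0))
    (hf : ∀ n, IsWeakTransport T (α n) B (E n) (f n) (γ n))
    (hN : ∀ n, ∫ p in Ioo 0 T ×ˢ Theta, f n p ^ 2 ≤ N) (hlim : WeakStarTendsto T f f₀)
    (hG : ∀ g : ℝ × E2 × E3 → ℝ, MemLp g 2 volume →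
        Tendsto (fun n => ∫ q, q.2.2 0 * (cutoff T k q * γ n 0 q) * g q)
          (hyperfilter ℕ) (𝓝 (∫ q, G q * g q)))
    (hδ : 0 < δ) (hk : 0 < k) (hB : ContDiff ℝ 1 B) (hζ : ContDiff ℝ 1 ζ)
    (hζc : HasCompactSupport ζ) (hζs : ∀ p, ζ p ≠ 0 → p ∈ region T k δ) :
    ∫ p in Ioo 0 T ×ˢ Theta, f₀ p * ζ p = -∫ q, G q * charTest δ B ζ (q.1, 0, q.2) := by
  obtain ⟨a, ha⟩ := hα0.bddAbove_range
  obtain ⟨C, hC⟩ := exists_bound_driftField (N := N) (M := M) (a := a) hk hB hζ hζs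
  have hCn := fun n => hC (α n) (L n) (E n) (f n) (hα n) (ha ⟨n, rfl⟩) (hE n) (hf n).memLp (hN n)
  have hζ2 : MemLp ζ 2 (volume.restrict (Ioo 0 T ×ˢ Theta)) :=
    (hζ.continuous.memLp_of_hasCompactSupport hζc).restrict _
  have h0 : Tendsto (fun n => ∫ p in Ioo 0 T ×ˢ Theta, f n p * ζ p) (hyperfilter ℕ)
      (𝓝 (∫ p in Ioo 0 T ×ˢ Theta, f₀ p * ζ p)) :=
    (hlim ζ (memL1L2_of_memLp hζ2)).mono_left Nat.hyperfilter_le_atTop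
  have h1 : Tendsto (fun n => α n * ∫ p in Ioo 0 T ×ˢ Theta,
      f n p * fderiv ℝ (charTest δ B ζ) p (driftField (α n) (E n) p)) (hyperfilter ℕ) (𝓝 0) := by
    refine Tendsto.mono_left ?_ Nat.hyperfilter_le_atTop
    have h2 : Tendsto (fun n => α n * C) atTop (𝓝 0) := by simpa using hα0.mul_const C
    refine squeeze_zero_norm (fun n => ?_) h2
    rw [norm_mul, Real.norm_eq_abs, Real.norm_eq_abs, abs_of_pos (hα n)]
    exact mul_le_mul_of_nonneg_left (hCn n).1 (hα n).le
  have hψ : MemLp (fun q : ℝ × E2 × E3 => charTest δ B ζ (q.1, 0, q.2)) 2 volume := by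
    have hc : Continuous fun q : ℝ × E2 × E3 => charTest δ B ζ (q.1, 0, q.2) :=
      (contDiff_charTest hB hζ).continuous.comp (by fun_prop)
    refine hc.memLp_of_hasCompactSupport (HasCompactSupport.of_support_subset_isCompact
      (K := Icc (1 / k : ℝ) (T - 1 / k) ×ˢ
        (Metric.closedBall (0 : E2) k ×ˢ Metric.closedBall (0 : E3) k))
      (isCompact_Icc.prod ((isCompact_closedBall _ _).prod (isCompact_closedBall _ _)))
      fun q hq => ?_)
    have := tsupport_charTest hk hζs (subset_tsupport _ hq)
    exact ⟨this.1, this.2.2⟩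
  have h2 := (hG _ hψ).neg
  have h3 : ∀ n, (∫ p in Ioo 0 T ×ˢ Theta, f n p * ζ p) + α n * ∫ p in Ioo 0 T ×ˢ Theta,
        f n p * fderiv ℝ (charTest δ B ζ) p (driftField (α n) (E n) p)
      = -∫ q : ℝ × E2 × E3, q.2.2 0 * (cutoff T k q * γ n 0 q)
        * charTest δ B ζ (q.1, 0, q.2) := by
    intro n
    have hi : Integrable (fun p => f n p * ζ p) (volume.restrict (Ioo 0 T ×ˢ Theta)) :=
      (hf n).memLp.integrable_mul hζ2
    rw [← (hf n).integral_mul_add (hα n) hδ hk hB hζ hζs, ← integral_const_mul,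
      ← integral_add hi ((hCn n).2.const_mul _)]
    refine integral_congr_ae (Eventually.of_forall fun p => ?_)
    simp only
    ring
  have h4 := h0.add h1
  simp only [h3, add_zero] at h4
  exact tendsto_nhds_unique h4 h2

open Classical in
/-- The radial limit of the traces, away from grazing velocities. -/
noncomputable def radialPart (T : ℝ) (k : ℕ) (δ : ℝ) (r : ℝ × E2 × ℝ → ℝ) (q : ℝ × E2 × E3) : ℝ :=
  if speedPoint q ∈ speedRegion T k ∧ δ ≤ |q.2.2 0| then r (speedPoint q) else 0

lemma radialPart_rot (q : ℝ × E2 × E3) (θ : ℝ) :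
    radialPart T k δ r (q.1, q.2.1, rot θ q.2.2) = radialPart T k δ r q := by
  have h : speedPoint (q.1, q.2.1, rot θ q.2.2) = speedPoint q := by simp [speedPoint, norm_rot]
  rw [radialPart, radialPart, h, rot_apply_zero]

lemma integrable_radialPart (hr : Measurable r) (hG : MemLp G 2 volume) (hδ : 0 < δ)
    (hGr : ∀ᵐ q, speedPoint q ∈ speedRegion T k → G q = q.2.2 0 * r (speedPoint q)) :
    Integrable (radialPart T k δ r) := by
  have hSm : MeasurableSet (speedPoint ⁻¹' speedRegion T k) :=
    measurable_speedPoint (measurableSet_speedRegion T k)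
  have hGi : Integrable ((speedPoint ⁻¹' speedRegion T k).indicator fun q => δ⁻¹ * |G q|) := by
    rw [integrable_indicator_iff hSm]
    have : IsFiniteMeasure (volume.restrict (speedPoint ⁻¹' speedRegion T k)) :=
      ⟨by simpa using volume_speedRegion_lt_top T k⟩
    exact (((hG.restrict _).integrable one_le_two).abs).const_mul _
  refine hGi.mono' ?_ ?_
  · exact (Measurable.ite (hSm.inter (measurableSet_le measurable_const measurable_wall_vx.abs))
      (hr.comp measurable_speedPoint) measurable_const).aestronglyMeasurable
  · filter_upwards [hGr] with q hq
    by_cases h : speedPoint q ∈ speedRegion T k ∧ δ ≤ |q.2.2 0|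
    · rw [radialPart, if_pos h, indicator_of_mem (by exact h.1), hq h.1, abs_mul,
        Real.norm_eq_abs, ← mul_assoc, inv_mul_eq_div]
      exact le_mul_of_one_le_left (abs_nonneg _) ((one_le_div hδ).mpr h.2)
    · rw [radialPart, if_neg h, norm_zero]
      exact indicator_nonneg (fun q _ => by positivity) q

/-- Undoing the rotations, under which the radial limit of the traces is invariant, gives the
integral of that limit against `ζ`. -/
lemma neg_integral_charTest (hr : Measurable r) (hG : MemLp G 2 volume) (hδ : 0 < δ)
    (hk : 0 < k) (hB : ContDiff ℝ 1 B)
    (hGr : ∀ᵐ q, speedPoint q ∈ speedRegion T k → G q = q.2.2 0 * r (speedPoint q))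
    (hζ : Continuous ζ) (hζc : HasCompactSupport ζ) (hζs : ∀ p, ζ p ≠ 0 → p ∈ region T k δ) :
    -∫ q, G q * charTest δ B ζ (q.1, 0, q.2)
      = ∫ p in {p : ℝ × Phase | p.2.1 ∈ Ioc (0 : ℝ) 1}, radialPart T k δ r (p.1, p.2.2) * ζ p := by
  obtain ⟨c, hc⟩ := hζ.bounded_above_of_compact_support hζc
  rw [← integral_mul_gyration (δ := δ) hB.continuous (integrable_radialPart hr hG hδ hGr)
    radialPart_rot hζ hc, ← integral_neg]
  refine integral_congr_ae ?_
  filter_upwards [hGr] with q hq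
  -- where the integrand does not vanish, `G / v_x` is the radial limit
  rw [charTest_zero]
  by_cases h : ∀ x, ζ (q.1, x, q.2.1, rot (B q.2.1 * smoothInv δ (q.2.2 0) * x) q.2.2) = 0
  · simp [h]
  · push Not at h
    obtain ⟨x, hx⟩ := h
    obtain ⟨a1, a2, -, -, a3, a4, a5⟩ := hζs _ hx
    simp only [norm_rot, rot_apply_zero] at a1 a2 a3 a4 a5
    have hk' : (0 : ℝ) < k := by exact_mod_cast hk
    have hS : speedPoint q ∈ speedRegion T k := by
      refine ⟨⟨?_, ?_⟩, by simpa [speedPoint] using a3.le, a4⟩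
      · exact pos_of_mul_pos_right (zero_lt_one.trans a1) hk'.le
      · exact sub_pos.mp (pos_of_mul_pos_right (zero_lt_one.trans a2) hk'.le)
    have hv : q.2.2 0 ≠ 0 := fun h0 => by
      rw [h0, abs_zero] at a5
      linarith
    rw [radialPart, if_pos ⟨hS, a5.le⟩, hq hS, smoothInv_eq hδ a5.le]
    field_simp

/-- The weak identity against test functions in `region T k δ` determines `f₀` there. -/
lemma ae_eq_radial_of_integral_eq (hf₀ : MemLp f₀ 2 (volume.restrict (Ioo 0 T ×ˢ Theta)))
    (hr : Measurable r) (hG : MemLp G 2 volume) (hδ : 0 < δ)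
    (hGr : ∀ᵐ q, speedPoint q ∈ speedRegion T k → G q = q.2.2 0 * r (speedPoint q)) (hk : 0 < k)
    (h : ∀ ζ : ℝ × Phase → ℝ, ContDiff ℝ (⊤ : ℕ∞) ζ → HasCompactSupport ζ →
      (∀ p, ζ p ≠ 0 → p ∈ region T k δ) → ∫ p in Ioo 0 T ×ˢ Theta, f₀ p * ζ p
        = ∫ p in {p : ℝ × Phase | p.2.1 ∈ Ioc (0 : ℝ) 1},
          radialPart T k δ r (p.1, p.2.2) * ζ p) :
    ∀ᵐ p, p ∈ region T k δ → f₀ p = r (speedPoint (p.1, p.2.2)) := by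
  have hk' : (0 : ℝ) < k := by exact_mod_cast hk
  have hSm : MeasurableSet (Ioo 0 T ×ˢ Theta : Set (ℝ × Phase)) :=
    measurableSet_Ioo.prod (measurableSet_Icc.prod MeasurableSet.univ)
  have hXm : MeasurableSet {p : ℝ × Phase | p.2.1 ∈ Ioc (0 : ℝ) 1} :=
    (by fun_prop : Measurable fun p : ℝ × Phase => p.2.1) measurableSet_Ioc
  have hi1 : LocallyIntegrable ((Ioo 0 T ×ˢ Theta).indicator f₀) :=
    ((memLp_indicator_iff_restrict hSm).mpr hf₀).locallyIntegrable one_le_two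
  have hi2 : LocallyIntegrable ({p : ℝ × Phase | p.2.1 ∈ Ioc (0 : ℝ) 1}.indicator
      fun p => radialPart T k δ r (p.1, p.2.2)) := by
    have h1 : Integrable (fun z : ℝ × (ℝ × E2 × E3) => radialPart T k δ r z.2)
        ((volume.restrict (Ioc (0 : ℝ) 1)).prod volume) :=
      (integrable_radialPart hr hG hδ hGr).comp_snd _
    rw [Measure.restrict_prod_eq_prod_univ] at h1
    have h2 : {p : ℝ × Phase | p.2.1 ∈ Ioc (0 : ℝ) 1} = xFirst ⁻¹' (Ioc 0 1 ×ˢ univ) := by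
      ext p; simp
    refine Integrable.locallyIntegrable ((integrable_indicator_iff hXm).mpr ?_)
    rw [h2]
    exact (measurePreserving_xFirst.integrableOn_comp_preimage xFirst.measurableEmbedding
      (f := fun z : ℝ × (ℝ × E2 × E3) => radialPart T k δ r z.2)).mpr h1
  have hmain := (isOpen_region T k δ).ae_eq_zero_of_integral_contDiff_smul_eq_zero
    (μ := volume) (f := fun p => (Ioo 0 T ×ˢ Theta).indicator f₀ p
      - {p : ℝ × Phase | p.2.1 ∈ Ioc (0 : ℝ) 1}.indicator
        (fun p => radialPart T k δ r (p.1, p.2.2)) p)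
    ((hi1.sub hi2).locallyIntegrableOn _) fun ζ hζ hζc hζs => by
      have hζs' : ∀ p, ζ p ≠ 0 → p ∈ region T k δ := fun p hp => hζs (subset_tsupport _ hp)
      have h3 := h ζ hζ hζc hζs'
      rw [← integral_indicator hSm, ← integral_indicator hXm] at h3
      have j1 : Integrable fun p => ζ p • (Ioo 0 T ×ˢ Theta).indicator f₀ p :=
        hi1.integrable_smul_left_of_hasCompactSupport hζ.continuous hζc
      have j2 : Integrable fun p => ζ p • {p : ℝ × Phase | p.2.1 ∈ Ioc (0 : ℝ) 1}.indicator
          (fun p => radialPart T k δ r (p.1, p.2.2)) p :=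
        hi2.integrable_smul_left_of_hasCompactSupport hζ.continuous hζc
      simp only [smul_sub]
      rw [integral_sub j1 j2, sub_eq_zero]
      refine Eq.trans ?_ (h3.trans ?_)
      · refine integral_congr_ae (Eventually.of_forall fun p => ?_)
        simp only [smul_eq_mul, indicator_mul_left, mul_comm (ζ p)]
      · refine integral_congr_ae (Eventually.of_forall fun p => ?_)
        simp only [smul_eq_mul, mul_comm (ζ p)]
        rw [indicator_mul_left]
  filter_upwards [hmain] with p hp hpr
  have h4 := hp hpr
  obtain ⟨a1, a2, x0, x1, a3, a4, a5⟩ := hpr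
  have ht : p.1 ∈ Ioo 0 T := ⟨pos_of_mul_pos_right (zero_lt_one.trans a1) hk'.le,
    sub_pos.mp (pos_of_mul_pos_right (zero_lt_one.trans a2) hk'.le)⟩
  have hS : speedPoint (p.1, p.2.2) ∈ speedRegion T k :=
    ⟨ht, by simpa [speedPoint] using a3.le, a4⟩
  rw [indicator_of_mem (show p ∈ Ioo 0 T ×ˢ Theta from ⟨ht, ⟨x0.le, x1.le⟩, mem_univ _⟩),
    indicator_of_mem (show p ∈ {p : ℝ × Phase | p.2.1 ∈ Ioc (0 : ℝ) 1} from ⟨x0, x1.le⟩),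
    radialPart, if_pos ⟨hS, a5.le⟩, sub_eq_zero] at h4
  exact h4

end Identification

/-! ### Gluing -/

/-- The sequence of solutions is bounded in `L²`. -/
lemma WeakStarTendsto.exists_bound {T : ℝ} {f : ℕ → ℝ × Phase → ℝ} {f₀ : ℝ × Phase → ℝ}
    (hlim : WeakStarTendsto T f f₀)
    (hf : ∀ n, MemLp (f n) 2 (volume.restrict (Ioo 0 T ×ˢ Theta))) :
    ∃ N, ∀ n, ∫ p in Ioo 0 T ×ˢ Theta, f n p ^ 2 ≤ N :=
  exists_bound_of_weakly_convergent hf fun _ hg => ⟨_, hlim _ (memL1L2_of_memLp hg)⟩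

/-- The limit is radial on each of the regions that exhaust the phase space. -/
lemma exists_radial_on_region {T : ℝ} {B : E2 → ℝ} (hB : IsMagneticField B)
    {K : E2 → ℝ → E3 → E3 → ℝ} (hK : IsReflectionKernel K) {C : E2 → ℝ} {fI : Phase → ℝ}
    {α : ℕ → ℝ} (hα : ∀ n, 0 < α n) (hα0 : Tendsto α atTop (𝓝 0))
    {f : ℕ → ℝ × Phase → ℝ} {φ : ℕ → ℝ → E2 → ℝ} {M : ℝ≥0} {L : ℕ → ℝ≥0}
    (hφ : ∀ n, IsRegularPotential T M (L n) (φ n))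
    (hsol : ∀ n, IsKineticSolution T (α n) B K C fI (f n) (φ n))
    {f₀ : ℝ × Phase → ℝ} (hf₀ : MemLinftyL2 T f₀) (hlim : WeakStarTendsto T f f₀)
    {k : ℕ} (hk : 0 < k) :
    ∃ r : ℝ × E2 × ℝ → ℝ, Measurable r ∧
      ∀ᵐ p, p ∈ region T k 0 → f₀ p = r (speedPoint (p.1, p.2.2)) := by
  choose γ hγ using fun n => (hsol n).1
  choose E hE hEφ using fun n => (hφ n).exists_field
  obtain ⟨hBc, b, hb, hbL⟩ := hB.exists_bounds
  have hf := fun n => (hγ n).isWeakTransport (hEφ n)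
  obtain ⟨N, hN⟩ := hlim.exists_bound fun n => (hf n).memLp
  obtain ⟨G, r, hr, hG, hGlim, hGr⟩ := exists_radial_wall_limit hBc hb hbL hE
    (fun n => (L n).coe_nonneg) hα hα0 hf hN hK (fun n => (hγ n).reflection) hk
  refine ⟨r, hr, ?_⟩
  have hδ : ∀ m : ℕ, ∀ᵐ p, p ∈ region T k (1 / (m + 1 : ℝ)) →
      f₀ p = r (speedPoint (p.1, p.2.2)) := fun m => by
    have hm : (0 : ℝ) < 1 / (m + 1) := by positivity
    refine ae_eq_radial_of_integral_eq hf₀.memLp hr hG hm hGr hk fun ζ hζ hζc hζs => ?_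
    have hζ1 : ContDiff ℝ 1 ζ := hζ.of_le (by exact_mod_cast le_top)
    rw [integral_mul_eq_neg_integral_charTest hE hα hα0 hf hN hlim hGlim hm hk hB.1 hζ1 hζc hζs,
      neg_integral_charTest hr hG hm hk hB.1 hGr hζ1.continuous hζc hζs]
  -- the regions with `|v_x| > 1/(m+1)` exhaust the region with `v_x ≠ 0`
  filter_upwards [ae_all_iff.mpr hδ] with p hp hpr
  obtain ⟨m, hm⟩ := exists_nat_one_div_lt hpr.2.2.2.2.2.2
  exact hp m ⟨hpr.1, hpr.2.1, hpr.2.2.1, hpr.2.2.2.1, hpr.2.2.2.2.1, hpr.2.2.2.2.2.1, hm⟩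

/-- The index, up to a shift by one, of a region that contains a given point with `0 < t < T`. -/
noncomputable def regionIndex (T : ℝ) (z : ℝ × E2 × ℝ) : ℕ :=
  ⌊1 / z.1 + 1 / (T - z.1) + ‖z.2.1‖ + z.2.2⌋₊

lemma measurable_regionIndex (T : ℝ) : Measurable (regionIndex T) :=
  Nat.measurable_floor.comp (by fun_prop)

lemma mem_region_regionIndex {T : ℝ} {p : ℝ × Phase} (ht : p.1 ∈ Ioo 0 T)
    (hx : p.2.1 ∈ Ioo (0 : ℝ) 1) (hv : p.2.2.2 0 ≠ 0) :
    p ∈ region T (regionIndex T (speedPoint (p.1, p.2.2)) + 1) 0 := by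
  have h := Nat.lt_floor_add_one (1 / p.1 + 1 / (T - p.1) + ‖p.2.2.1‖ + ‖p.2.2.2‖)
  have h1 : 0 < 1 / p.1 := one_div_pos.mpr ht.1
  have h2 : 0 < 1 / (T - p.1) := one_div_pos.mpr (sub_pos.mpr ht.2)
  have h3 := norm_nonneg p.2.2.1
  have h4 := norm_nonneg p.2.2.2
  have e : regionIndex T (speedPoint (p.1, p.2.2))
      = ⌊1 / p.1 + 1 / (T - p.1) + ‖p.2.2.1‖ + ‖p.2.2.2‖⌋₊ := rfl
  rw [← e] at h
  refine ⟨?_, ?_, hx.1, hx.2, ?_, ?_, abs_pos.mpr hv⟩ <;> push_cast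
  · exact (div_lt_iff₀ ht.1).mp (by linarith)
  · exact (div_lt_iff₀ (sub_pos.mpr ht.2)).mp (by linarith)
  · linarith
  · linarith

/-- Functions that are radial on each region can be glued. -/
lemma exists_measurable_of_radial_on_regions {T : ℝ} {f₀ : ℝ × Phase → ℝ}
    (h : ∀ k : ℕ, 0 < k → ∃ r : ℝ × E2 × ℝ → ℝ, Measurable r ∧
      ∀ᵐ p, p ∈ region T k 0 → f₀ p = r (speedPoint (p.1, p.2.2))) :
    ∃ F : E2 → ℝ → ℝ → ℝ, Measurable (fun q : E2 × ℝ × ℝ => F q.1 q.2.1 q.2.2) ∧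
      ∀ᵐ p ∂(volume.restrict (Ioo 0 T ×ˢ Theta)), f₀ p = F p.2.2.1 (‖p.2.2.2‖ ^ 2 / 2) p.1 := by
  choose r hr hrf using fun k : ℕ => h (k + 1) k.succ_pos
  have hglue : Measurable fun z : ℝ × E2 × ℝ => r (regionIndex T z) z :=
    (measurable_from_prod_countable_right (f := fun z : ℕ × (ℝ × E2 × ℝ) => r z.1 z.2)
      hr).comp ((measurable_regionIndex T).prodMk measurable_id)
  -- `√(2ε)` is the speed at the energy `ε`; the values at negative energies are irrelevant
  refine ⟨fun ξ ε t => r (regionIndex T (t, ξ, √(2 * ε))) (t, ξ, √(2 * ε)),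
    hglue.comp (by fun_prop : Measurable fun q : E2 × ℝ × ℝ => (q.2.2, q.1, √(2 * q.2.1))), ?_⟩
  have hvx : ∀ᵐ p : ℝ × Phase, p.2.2.2 0 ≠ 0 :=
    (Measure.quasiMeasurePreserving_snd.comp (Measure.quasiMeasurePreserving_snd.comp
      Measure.quasiMeasurePreserving_snd)).ae ae_vx_ne_zero
  have hx : ∀ a : ℝ, ∀ᵐ p : ℝ × Phase, p.2.1 ≠ a := fun a =>
    (Measure.quasiMeasurePreserving_fst.comp Measure.quasiMeasurePreserving_snd).ae
      (Measure.ae_ne volume a)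
  have hS : MeasurableSet (Ioo 0 T ×ˢ Theta : Set (ℝ × Phase)) :=
    measurableSet_Ioo.prod (measurableSet_Icc.prod MeasurableSet.univ)
  rw [ae_restrict_iff' hS]
  filter_upwards [hvx, hx 0, hx 1, ae_all_iff.mpr hrf] with p h1 h2 h3 h4 hp
  have h5 : √(2 * (‖p.2.2.2‖ ^ 2 / 2)) = ‖p.2.2.2‖ := by
    rw [mul_div_cancel₀ _ two_ne_zero, Real.sqrt_sq (norm_nonneg _)]
  simp only [h5]
  exact h4 _ (mem_region_regionIndex hp.1
    ⟨lt_of_le_of_ne hp.2.1.1 (Ne.symm h2), lt_of_le_of_ne hp.2.1.2 h3⟩ h1)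

end SHE

theorem mainTheorem5 (T : ℝ) (hT : 0 < T)
    (B : SHE.E2 → ℝ) (hB : SHE.IsMagneticField B)
    (K : SHE.E2 → ℝ → SHE.E3 → SHE.E3 → ℝ) (hK : SHE.IsReflectionKernel K)
    (C : SHE.E2 → ℝ) (hC : ContDiff ℝ (⊤ : ℕ∞) C) (hC0 : ∀ ξ, 0 ≤ C ξ)
    (fI : SHE.Phase → ℝ) (hfI : MemLp fI 2 (volume.restrict SHE.Theta))
    (α : ℕ → ℝ) (hα : ∀ n, 0 < α n) (hα0 : Tendsto α atTop (𝓝 0))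
    (f : ℕ → ℝ × SHE.Phase → ℝ) (φ : ℕ → ℝ → SHE.E2 → ℝ)
    (M : ℝ≥0) (L : ℕ → ℝ≥0) (hφ : ∀ n, SHE.IsRegularPotential T M (L n) (φ n))
    (hsol : ∀ n, SHE.IsKineticSolution T (α n) B K C fI (f n) (φ n))
    (f₀ : ℝ × SHE.Phase → ℝ) (hf₀ : SHE.MemLinftyL2 T f₀)
    (hlim : SHE.WeakStarTendsto T f f₀) :
    ∃ F : SHE.E2 → ℝ → ℝ → ℝ,
      Measurable (fun q : SHE.E2 × ℝ × ℝ => F q.1 q.2.1 q.2.2) ∧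
      ∀ᵐ p ∂(volume.restrict (Ioo 0 T ×ˢ SHE.Theta)),
        f₀ p = F p.2.2.1 (‖p.2.2.2‖ ^ 2 / 2) p.1 := by
  exact SHE.exists_measurable_of_radial_on_regions fun k hk =>
    SHE.exists_radial_on_region hB hK hα hα0 hφ hsol hf₀ hlim hk
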